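/- All (co)homology is simplicial, unreduced, with coefficients in $\mathbb Z_2$. Let $\emptyset=\mathsf K_0\subset\mathsf K_1\subset\dots\subset\mathsf K_n=\mathsf K$ be a simplex-wise filtration of finite simplicial complexes, i.e. $\mathsf K_i\setminus\mathsf K_{i-1}$ is a single simplex for $1\le i\le n$, and fix a total order on the vertices. Restriction of cochains makes $\mathsf H^*(\mathsf K_\bullet)$ a persistence module $\mathsf H^*(\mathsf K_n)\to\dots\to\mathsf H^*(\mathsf K_0)$. The persistent cup module $\operatorname{im}\mathsf H^*(\smile_\bullet)$ is its submodule whose $i$-th space is the image of the linear map $\mathsf H^{>0}(\mathsf K_i)\otimes\mathsf H^{>0}(\mathsf K_i)\to\mathsf H^*(\mathsf K_i)$ induced by the cup product, where $\mathsf H^{>0}=\bigoplus_{p\ge1}\mathsf H^p$; write $\operatorname{im}\mathsf H^p(\smile_\bullet)$ for its degree-$p$ part. The barcode of such a persistence module is the multiset of nonempty intervals $(d,b]=\{d+1,\dots,b\}$, $0\le d<b\le n$, such that the module is isomorphic to the direct sum of the corresponding interval modules. A persistent cohomology basis consists of the bars $(d_i,b_i]$ of the barcode of $\mathsf H^*(\mathsf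 K_\bullet)$ and, for every bar, a homogeneous cocycle $\xi_i$ of $\mathsf K_{b_i}$ such that, for every $j$, the restrictions to $\mathsf K_j$ of those $\xi_i$ with $d_i<j\le b_i$ represent a basis of $\mathsf H^*(\mathsf K_j)$, while the restriction of $\xi_i$ to $\mathsf K_j$ is a coboundary for $j\le d_i$. A bar with $b_i=n$ is called essential. Algorithm CupPers$(\mathsf K_\bullet)$. Step 1. Compute a persistent cohomology basis $\{((d_i,b_i],\xi_i)\}$. Let $\mathbf H$ be the list of the $\xi_i$ with $b_i=n$ and $\deg\xi_i>0$. Let $\mathbf S$ be the coboundary matrix of $\mathsf K$ (the columns are the coboundaries of the simplices, in filtration order). Step 2. For $k=n,n-1,\dots,1$: restrict all columns of $\mathbf S$ and $\mathbf H$ to $\mathsf K_k$. Step 2.1. For every $i$ with $b_i=k$ and $\deg\xi_i>0$: if $k\ne n$, append $\xi_i$ to $\mathbf H$; then, for every $\xi_j$ in $\mathbf H$, if $\zeta=\xi_i\smile\xi_j$ is nonzero and is not in the span of the columns of $\mathbf S$, append $\zeta$ to $\mathbf S$ on the right, annotated with $\zeta.\mathrm{birth}=k$ and $\zeta.\mathrm{rep@birth}=\zeta$.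 Step 2.2. If $k=d_i$ for some $i$ with $\deg\xi_i>0$: reduce $\mathbf S$ by left-to-right column additions (until the lowest nonzero entries of its nonzero columns are in pairwise different rows); if an annotated column $\zeta$ has become zero, remove it from $\mathbf S$ and output the bar $(k,\zeta.\mathrm{birth}]$ with the representative $\zeta.\mathrm{rep@birth}$; remove $\xi_i$ from $\mathbf H$. Theorem. For every simplex-wise filtration $\mathsf K_\bullet$, Algorithm CupPers computes the barcode of the persistent cup module. That is: a persistent cohomology basis as required in Step 1 exists; whichever one is used, the remaining steps can be carried out; and, whichever one is used and whichever column additions are made in Step 2.2, the multiset of bars that are output is the barcode of $\operatorname{im}\mathsf H^*(\smile_\bullet)$. Moreover, for every $p$, the output bars whose representatives have degree $p$ form the barcode of $\operatorname{im}\mathsf H^p(\smile_\bullet)$. -/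

import Mathlib

/-!
# Persistent cup modules of simplex-wise filtrations and the algorithm CupPers

All coefficients are in `ZMod 2`.  The vertices are elements of a linearly ordered type `V`.
-/

set_option linter.unusedSectionVars false

noncomputable section

namespace CupPersistence

universe u

/-! ## Simplicial cochains, cohomology and cup products of one complex -/

section OneComplex

variable {V : Type u} [LinearOrder V]

/-- Functions on all finite vertex sets.  The cochains of all complexes with vertices in `V` live
in this space; it contains the cochains of all degrees. -/
abbrev Cochain (V : Type u) : Type u := Finset V → ZMod 2

/-- `C^*(K)`: the total cochain space of `K`, i.e. functions on the simplices of `K`, extended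
by zero to the other vertex sets. -/
def cochains (K : PreAbstractSimplicialComplex V) : Submodule (ZMod 2) (Cochain V) where
  carrier := {x | ∀ τ, τ ∉ K.faces → x τ = 0}
  add_mem' := by
    intro x y hx hy τ hτ
    simp [hx τ hτ, hy τ hτ]
  zero_mem' := by
    intro τ _
    rfl
  smul_mem' := by
    intro c x hx τ hτ
    simp [hx τ hτ]

/-- Restriction of cochains to `K`: all values outside of `K` are set to zero. -/
def restrict (K : PreAbstractSimplicialComplex V) : Cochain V →ₗ[ZMod 2] Cochain V where
  toFun x := Set.indicator K.faces x
  map_add' x y := Set.indicator_add _ x y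
  map_smul' c x := Set.indicator_const_smul _ c x

/-- The homogeneous cochains of degree `p`: those supported on vertex sets of dimension `p`. -/
def homogeneous (V : Type u) (p : ℕ) : Submodule (ZMod 2) (Cochain V) where
  carrier := {x | ∀ τ : Finset V, τ.card ≠ p + 1 → x τ = 0}
  add_mem' := by
    intro x y hx hy τ hτ
    simp [hx τ hτ, hy τ hτ]
  zero_mem' := by
    intro τ _
    rfl
  smul_mem' := by
    intro c x hx τ hτ
    simp [hx τ hτ]

/-- The sum of the values of a cochain over the facets of a vertex set. -/
def facetSum : Cochain V →ₗ[ZMod 2] Cochain V where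
  toFun x := fun τ => ∑ v ∈ τ, x (τ.erase v)
  map_add' x y := by
    funext τ
    simp [Finset.sum_add_distrib]
  map_smul' c x := by
    funext τ
    simp [Finset.mul_sum]

/-- The coboundary operator `δ : C^*(K) → C^*(K)`; on a simplex `τ` of `K` it is
`(δ x)(τ) = ∑_{v ∈ τ} x(τ ∖ {v})`. -/
def coboundary (K : PreAbstractSimplicialComplex V) : Cochain V →ₗ[ZMod 2] Cochain V :=
  (restrict K).comp facetSum

/-- `Z^*(K)`. -/
def cocycles (K : PreAbstractSimplicialComplex V) : Submodule (ZMod 2) (Cochain V) :=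
  cochains K ⊓ LinearMap.ker (coboundary K)

/-- `B^*(K)`. -/
def coboundaries (K : PreAbstractSimplicialComplex V) : Submodule (ZMod 2) (Cochain V) :=
  (cochains K).map (coboundary K)

/-- `H^*(K)`, the (unreduced) total simplicial cohomology of `K`. -/
abbrev Cohomology (K : PreAbstractSimplicialComplex V) : Type u :=
  ↥(cocycles K) ⧸ (coboundaries K).submoduleOf (cocycles K)

/-- The class of a cocycle. -/
def cls (K : PreAbstractSimplicialComplex V) : ↥(cocycles K) →ₗ[ZMod 2] Cohomology K :=
  ((coboundaries K).submoduleOf (cocycles K)).mkQ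

/-- `H^p(K)` as a subspace of `H^*(K)`. -/
def cohomologyDeg (K : PreAbstractSimplicialComplex V) (p : ℕ) :
    Submodule (ZMod 2) (Cohomology K) :=
  ((homogeneous V p).submoduleOf (cocycles K)).map (cls K)

/-- The positive part of `H^*(K)`: the sum of all `H^p(K)` with `p ≥ 1`. -/
def cohomologyPos (K : PreAbstractSimplicialComplex V) : Submodule (ZMod 2) (Cohomology K) :=
  ⨆ p : ℕ, cohomologyDeg K (p + 1)

/-- The sum over all ways to split a vertex set at one of its vertices into a front part and a
back part, which share this vertex. -/
def splitSum : Cochain V →ₗ[ZMod 2] Cochain V →ₗ[ZMod 2] Cochain V :=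
  LinearMap.mk₂ (ZMod 2)
    (fun x y τ => ∑ v ∈ τ, x (τ.filter (fun w => w ≤ v)) * y (τ.filter (fun w => v ≤ w)))
    (by intro x x' y; funext τ; simp [add_mul, Finset.sum_add_distrib])
    (by intro c x y; funext τ; simp [Finset.mul_sum, mul_assoc])
    (by intro x y y'; funext τ; simp [mul_add, Finset.sum_add_distrib])
    (by intro c x y; funext τ; simp [Finset.mul_sum, mul_left_comm])

/-- The cup product `C^*(K) × C^*(K) → C^*(K)`.  If `x` and `y` are homogeneous of degrees `p` and
`q`, then on a simplex `v₀ < ⋯ < v_{p+q}` of `K` the only term of the sum that can be nonzero is the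
one that splits at `v_p`, namely `x {v₀, …, v_p} * y {v_p, …, v_{p+q}}`, and on simplices
of other dimensions there is none. -/
def cup (K : PreAbstractSimplicialComplex V) :
    Cochain V →ₗ[ZMod 2] Cochain V →ₗ[ZMod 2] Cochain V :=
  splitSum.compr₂ (restrict K)

/-! ### Elementary facts -/

theorem restrict_of_mem {K : PreAbstractSimplicialComplex V} (x : Cochain V) {τ : Finset V}
    (h : τ ∈ K.faces) : restrict K x τ = x τ :=
  Set.indicator_of_mem h x

theorem restrict_of_notMem {K : PreAbstractSimplicialComplex V} (x : Cochain V) {τ : Finset V}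
    (h : τ ∉ K.faces) : restrict K x τ = 0 :=
  Set.indicator_of_notMem h x

theorem restrict_mem_cochains (K : PreAbstractSimplicialComplex V) (x : Cochain V) :
    restrict K x ∈ cochains K :=
  fun _ h => restrict_of_notMem x h

theorem coboundary_apply {K : PreAbstractSimplicialComplex V} (x : Cochain V) {τ : Finset V}
    (h : τ ∈ K.faces) : coboundary K x τ = ∑ v ∈ τ, x (τ.erase v) :=
  restrict_of_mem _ h

theorem cup_apply {K : PreAbstractSimplicialComplex V} (x y : Cochain V) {τ : Finset V}
    (h : τ ∈ K.faces) : cup K x y τ =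
      ∑ v ∈ τ, x (τ.filter (fun w => w ≤ v)) * y (τ.filter (fun w => v ≤ w)) :=
  restrict_of_mem _ h

theorem cup_mem_cochains (K : PreAbstractSimplicialComplex V) (x y : Cochain V) :
    cup K x y ∈ cochains K :=
  restrict_mem_cochains K _

theorem empty_notMem (K : PreAbstractSimplicialComplex V) : (∅ : Finset V) ∉ K.faces :=
  fun h => by simpa using (K.isRelLowerSet_faces h).1

theorem mem_of_subset {K : PreAbstractSimplicialComplex V} {s t : Finset V} (h : s ∈ K.faces)
    (hts : t ⊆ s) (ht : t.Nonempty) : t ∈ K.faces :=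
  (K.isRelLowerSet_faces h).2 hts ht

theorem telescope (τ : Finset V) : ∀ x y : Cochain V,
    (∑ v ∈ τ, (x (τ.filter (fun w => w < v)) * y (τ.filter (fun w => v ≤ w)) +
      x (τ.filter (fun w => w ≤ v)) * y (τ.filter (fun w => v < w)))) =
      x ∅ * y τ + x τ * y ∅ := by
  induction τ using Finset.induction_on_max with
  | empty =>
    intro x y
    have := CharTwo.add_self_eq_zero (x ∅ * y ∅)
    simp [this]
  | insert a s hs ih =>
    intro x y
    have ha : a ∉ s := fun h => lt_irrefl _ (hs a h)
    rw [Finset.sum_insert ha]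
    have e1 : (insert a s).filter (fun w => w < a) = s := by
      ext w; simp only [Finset.mem_filter, Finset.mem_insert]; grind
    have e2 : (insert a s).filter (fun w => a ≤ w) = {a} := by
      ext w; simp only [Finset.mem_filter, Finset.mem_insert, Finset.mem_singleton]; grind
    have e3 : (insert a s).filter (fun w => w ≤ a) = insert a s := by
      ext w; simp only [Finset.mem_filter, Finset.mem_insert]; grind
    have e4 : (insert a s).filter (fun w => a < w) = ∅ := by
      ext w; simp only [Finset.mem_filter, Finset.mem_insert, Finset.notMem_empty]; grind
    rw [e1, e2, e3, e4]
    have key := ih x (fun t => y (insert a t))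
    have hsum : (∑ v ∈ s, (x ((insert a s).filter (fun w => w < v)) *
          y ((insert a s).filter (fun w => v ≤ w)) +
        x ((insert a s).filter (fun w => w ≤ v)) *
          y ((insert a s).filter (fun w => v < w)))) =
        ∑ v ∈ s, (x (s.filter (fun w => w < v)) * y (insert a (s.filter (fun w => v ≤ w))) +
          x (s.filter (fun w => w ≤ v)) * y (insert a (s.filter (fun w => v < w)))) := by
      refine Finset.sum_congr rfl fun v hv => ?_
      have hva := hs v hv
      rw [Finset.filter_insert, Finset.filter_insert, Finset.filter_insert, Finset.filter_insert,
        if_neg (not_lt.2 hva.le), if_pos hva.le, if_neg (not_le.2 hva), if_pos hva]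
    rw [hsum, key]
    have h2 := CharTwo.add_self_eq_zero (x s * y {a})
    simp only [insert_empty_eq]
    linear_combination h2

/-- The Leibniz rule. -/
theorem coboundary_cup {K : PreAbstractSimplicialComplex V} {x y : Cochain V}
    (hx : x ∈ cochains K) (hy : y ∈ cochains K) :
    coboundary K (cup K x y) = cup K (coboundary K x) y + cup K x (coboundary K y) := by
  funext τ
  by_cases hτ : τ ∈ K.faces
  swap
  · simp [coboundary, cup, restrict_of_notMem _ hτ]
  have hx0 : x ∅ = 0 := hx _ (empty_notMem K)
  have hy0 : y ∅ = 0 := hy _ (empty_notMem K)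
  rw [Pi.add_apply, coboundary_apply _ hτ, cup_apply _ _ hτ, cup_apply _ _ hτ]
  have hL : ∀ v ∈ τ, cup K x y (τ.erase v) = ∑ w ∈ τ.erase v,
      x ((τ.erase v).filter (fun u => u ≤ w)) * y ((τ.erase v).filter (fun u => w ≤ u)) := by
    intro v _
    rcases (τ.erase v).eq_empty_or_nonempty with h | h
    · rw [h, cup_mem_cochains K x y _ (empty_notMem K)]; simp
    · exact cup_apply _ _ (mem_of_subset hτ (Finset.erase_subset _ _) h)
  rw [Finset.sum_congr rfl hL]
  have hA : ∀ v ∈ τ, coboundary K x (τ.filter (fun w => w ≤ v)) =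
      (∑ u ∈ τ.filter (fun w => w < v), x ((τ.erase u).filter (fun w => w ≤ v))) +
        x (τ.filter (fun w => w < v)) := by
    intro v hv
    rw [coboundary_apply _ (mem_of_subset hτ (Finset.filter_subset _ _)
      ⟨v, by simp [hv]⟩)]
    have e : τ.filter (fun w => w ≤ v) = insert v (τ.filter (fun w => w < v)) := by
      ext w; simp only [Finset.mem_filter, Finset.mem_insert]; grind
    have e' : (τ.filter (fun w => w ≤ v)).erase v = τ.filter (fun w => w < v) := by
      ext w; simp only [Finset.mem_filter, Finset.mem_erase]; grind
    have hs : (∑ u ∈ τ.filter (fun w => w ≤ v), x ((τ.filter (fun w => w ≤ v)).erase u)) =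
        (∑ u ∈ τ.filter (fun w => w < v), x ((τ.filter (fun w => w ≤ v)).erase u)) +
          x ((τ.filter (fun w => w ≤ v)).erase v) := by
      conv_lhs => rw [show (τ.filter (fun w => w ≤ v)).sum
        (fun u => x ((τ.filter (fun w => w ≤ v)).erase u)) =
        (insert v (τ.filter (fun w => w < v))).sum
        (fun u => x ((τ.filter (fun w => w ≤ v)).erase u)) by rw [← e]]
      rw [Finset.sum_insert (by simp), add_comm]
    rw [hs, e']
    congr 1
    refine Finset.sum_congr rfl fun u _ => ?_
    rw [Finset.filter_erase]
  have hB : ∀ v ∈ τ, coboundary K y (τ.filter (fun w => v ≤ w)) =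
      (∑ u ∈ τ.filter (fun w => v < w), y ((τ.erase u).filter (fun w => v ≤ w))) +
        y (τ.filter (fun w => v < w)) := by
    intro v hv
    rw [coboundary_apply _ (mem_of_subset hτ (Finset.filter_subset _ _)
      ⟨v, by simp [hv]⟩)]
    have e : τ.filter (fun w => v ≤ w) = insert v (τ.filter (fun w => v < w)) := by
      ext w; simp only [Finset.mem_filter, Finset.mem_insert]; grind
    have e' : (τ.filter (fun w => v ≤ w)).erase v = τ.filter (fun w => v < w) := by
      ext w; simp only [Finset.mem_filter, Finset.mem_erase]; grind
    have hs : (∑ u ∈ τ.filter (fun w => v ≤ w), y ((τ.filter (fun w => v ≤ w)).erase u)) =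
        (∑ u ∈ τ.filter (fun w => v < w), y ((τ.filter (fun w => v ≤ w)).erase u)) +
          y ((τ.filter (fun w => v ≤ w)).erase v) := by
      conv_lhs => rw [show (τ.filter (fun w => v ≤ w)).sum
        (fun u => y ((τ.filter (fun w => v ≤ w)).erase u)) =
        (insert v (τ.filter (fun w => v < w))).sum
        (fun u => y ((τ.filter (fun w => v ≤ w)).erase u)) by rw [← e]]
      rw [Finset.sum_insert (by simp), add_comm]
    rw [hs, e']
    congr 1
    refine Finset.sum_congr rfl fun u _ => ?_
    rw [Finset.filter_erase]
  have hR1 := Finset.sum_congr (rfl : τ = τ) fun v hv =>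
    congrArg (· * y (τ.filter (fun w => v ≤ w))) (hA v hv)
  have hR2 := Finset.sum_congr (rfl : τ = τ) fun v hv =>
    congrArg (x (τ.filter (fun w => w ≤ v)) * ·) (hB v hv)
  rw [hR1, hR2]
  have hT := telescope τ x y
  rw [hx0, hy0] at hT
  simp only [add_mul, mul_add, Finset.sum_add_distrib] at hT ⊢
  have hswap : (∑ v ∈ τ, ∑ w ∈ τ.erase v,
      x ((τ.erase v).filter (fun u => u ≤ w)) * y ((τ.erase v).filter (fun u => w ≤ u))) =
      ∑ w ∈ τ, ∑ v ∈ τ.erase w,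
        x ((τ.erase v).filter (fun u => u ≤ w)) * y ((τ.erase v).filter (fun u => w ≤ u)) := by
    refine Finset.sum_comm' ?_
    intro a b
    simp only [Finset.mem_erase]
    grind
  have hinner : ∀ w ∈ τ, (∑ v ∈ τ.erase w,
        x ((τ.erase v).filter (fun u => u ≤ w)) * y ((τ.erase v).filter (fun u => w ≤ u))) =
      (∑ u ∈ τ.filter (fun z => z < w), x ((τ.erase u).filter (fun z => z ≤ w))) *
          y (τ.filter (fun z => w ≤ z)) +
        x (τ.filter (fun z => z ≤ w)) *
          (∑ u ∈ τ.filter (fun z => w < z), y ((τ.erase u).filter (fun z => w ≤ z))) := by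
    intro w hw
    have e : τ.erase w = τ.filter (fun z => z < w) ∪ τ.filter (fun z => w < z) := by
      ext z; simp only [Finset.mem_filter, Finset.mem_erase, Finset.mem_union]; grind
    have hd : Disjoint (τ.filter (fun z => z < w)) (τ.filter (fun z => w < z)) := by
      rw [Finset.disjoint_left]; intro z; simp only [Finset.mem_filter]; grind
    rw [e, Finset.sum_union hd, Finset.sum_mul, Finset.mul_sum]
    congr 1
    · refine Finset.sum_congr rfl fun v hv => ?_
      have : (τ.erase v).filter (fun u => w ≤ u) = τ.filter (fun u => w ≤ u) := by
        ext z; simp only [Finset.mem_filter, Finset.mem_erase] at hv ⊢; grind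
      rw [this]
    · refine Finset.sum_congr rfl fun v hv => ?_
      have : (τ.erase v).filter (fun u => u ≤ w) = τ.filter (fun u => u ≤ w) := by
        ext z; simp only [Finset.mem_filter, Finset.mem_erase] at hv ⊢; grind
      rw [this]
  rw [hswap, Finset.sum_congr rfl hinner, Finset.sum_add_distrib]
  linear_combination -hT

theorem cup_mem_cocycles {K : PreAbstractSimplicialComplex V} {x y : Cochain V}
    (hx : x ∈ cocycles K) (hy : y ∈ cocycles K) : cup K x y ∈ cocycles K := by
  refine ⟨cup_mem_cochains K x y, ?_⟩
  have h1 : coboundary K x = 0 := hx.2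
  have h2 : coboundary K y = 0 := hy.2
  change coboundary K (cup K x y) = 0
  rw [coboundary_cup hx.1 hy.1, h1, h2]
  simp

theorem cup_coboundary_left {K : PreAbstractSimplicialComplex V} {x y : Cochain V}
    (hx : x ∈ coboundaries K) (hy : y ∈ cocycles K) : cup K x y ∈ coboundaries K := by
  obtain ⟨z, hz, rfl⟩ := hx
  refine ⟨cup K z y, cup_mem_cochains K z y, ?_⟩
  have h2 : coboundary K y = 0 := hy.2
  rw [coboundary_cup hz hy.1, h2]
  simp

theorem cup_coboundary_right {K : PreAbstractSimplicialComplex V} {x y : Cochain V}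
    (hx : x ∈ cocycles K) (hy : y ∈ coboundaries K) : cup K x y ∈ coboundaries K := by
  obtain ⟨z, hz, rfl⟩ := hy
  refine ⟨cup K x z, cup_mem_cochains K x z, ?_⟩
  have h2 : coboundary K x = 0 := hx.2
  rw [coboundary_cup hx.1 hz, h2]
  simp

/-! ### The cup product on cohomology -/

/-- The class of the cup product of two cocycles. -/
def cupCocycles (K : PreAbstractSimplicialComplex V) :
    ↥(cocycles K) →ₗ[ZMod 2] ↥(cocycles K) →ₗ[ZMod 2] Cohomology K :=
  LinearMap.mk₂ (ZMod 2)
    (fun x y => cls K ⟨cup K x.1 y.1, cup_mem_cocycles x.2 y.2⟩)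
    (by intro x x' y; rw [← map_add]; congr 1; ext1; simp)
    (by intro c x y; rw [← map_smul]; congr 1; ext1; simp)
    (by intro x y y'; rw [← map_add]; congr 1; ext1; simp)
    (by intro c x y; rw [← map_smul]; congr 1; ext1; simp)

/-- The cup product `H^*(K) × H^*(K) → H^*(K)`. -/
def cupCohomology (K : PreAbstractSimplicialComplex V) :
    Cohomology K →ₗ[ZMod 2] Cohomology K →ₗ[ZMod 2] Cohomology K :=
  (Submodule.liftQ _
    (Submodule.liftQ ((coboundaries K).submoduleOf (cocycles K)) (cupCocycles K) (by
      intro x hx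
      rw [LinearMap.mem_ker]
      ext y
      exact (Submodule.Quotient.mk_eq_zero _).2 (cup_coboundary_left hx y.2))).flip (by
    intro y hy
    rw [LinearMap.mem_ker]
    ext x
    exact (Submodule.Quotient.mk_eq_zero _).2 (cup_coboundary_right x.2 hy))).flip

theorem cupCohomology_cls (K : PreAbstractSimplicialComplex V) (x y : ↥(cocycles K)) :
    cupCohomology K (cls K x) (cls K y) = cls K ⟨cup K x.1 y.1, cup_mem_cocycles x.2 y.2⟩ :=
  rfl

/-- The cup space of `K`: the image of the linear map `H^{>0}(K) ⊗ H^{>0}(K) → H^*(K)` given by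
the cup product. -/
def cupSpace (K : PreAbstractSimplicialComplex V) : Submodule (ZMod 2) (Cohomology K) :=
  LinearMap.range ((TensorProduct.lift (cupCohomology K)).comp
    (TensorProduct.mapIncl (cohomologyPos K) (cohomologyPos K)))

/-- The degree `p` part of the cup space. -/
def cupSpaceDeg (K : PreAbstractSimplicialComplex V) (p : ℕ) :
    Submodule (ZMod 2) (Cohomology K) :=
  cupSpace K ⊓ cohomologyDeg K p

/-! ### Restriction to a subcomplex -/

theorem coboundary_restrict {K L : PreAbstractSimplicialComplex V} (h : L ≤ K) {x : Cochain V}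
    (hx : x ∈ cochains K) : coboundary L (restrict L x) = restrict L (coboundary K x) := by
  funext τ
  by_cases hτ : τ ∈ L.faces
  swap
  · simp [coboundary, restrict_of_notMem _ hτ]
  rw [coboundary_apply _ hτ, restrict_of_mem _ hτ, coboundary_apply _ (h hτ)]
  refine Finset.sum_congr rfl fun v _ => ?_
  rcases (τ.erase v).eq_empty_or_nonempty with h0 | h0
  · rw [h0, restrict_of_notMem _ (empty_notMem L), hx _ (empty_notMem K)]
  · exact restrict_of_mem _ (mem_of_subset hτ (Finset.erase_subset _ _) h0)

theorem cup_restrict {K L : PreAbstractSimplicialComplex V} (h : L ≤ K) (x y : Cochain V) :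
    cup L (restrict L x) (restrict L y) = restrict L (cup K x y) := by
  funext τ
  by_cases hτ : τ ∈ L.faces
  swap
  · simp [cup, restrict_of_notMem _ hτ]
  rw [cup_apply _ _ hτ, restrict_of_mem _ hτ, cup_apply _ _ (h hτ)]
  refine Finset.sum_congr rfl fun v hv => ?_
  rw [restrict_of_mem _ (mem_of_subset hτ (Finset.filter_subset _ _) ⟨v, by simp [hv]⟩),
    restrict_of_mem _ (mem_of_subset hτ (Finset.filter_subset _ _) ⟨v, by simp [hv]⟩)]

theorem restrict_mem_cocycles {K L : PreAbstractSimplicialComplex V} (h : L ≤ K) {x : Cochain V}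
    (hx : x ∈ cocycles K) : restrict L x ∈ cocycles L := by
  refine ⟨restrict_mem_cochains L x, ?_⟩
  have h2 : coboundary K x = 0 := hx.2
  change coboundary L (restrict L x) = 0
  rw [coboundary_restrict h hx.1, h2, map_zero]

theorem restrict_mem_coboundaries {K L : PreAbstractSimplicialComplex V} (h : L ≤ K)
    {x : Cochain V} (hx : x ∈ coboundaries K) : restrict L x ∈ coboundaries L := by
  obtain ⟨z, hz, rfl⟩ := hx
  exact ⟨restrict L z, restrict_mem_cochains L z, coboundary_restrict h hz⟩

/-- Restriction of cocycles. -/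
def resCocycles {K L : PreAbstractSimplicialComplex V} (h : L ≤ K) :
    ↥(cocycles K) →ₗ[ZMod 2] ↥(cocycles L) :=
  (restrict L).restrict fun _ hx => restrict_mem_cocycles h hx

/-- The map `H^*(K) → H^*(L)` induced by the inclusion of a subcomplex `L` of `K`. -/
def resCohomology {K L : PreAbstractSimplicialComplex V} (h : L ≤ K) :
    Cohomology K →ₗ[ZMod 2] Cohomology L :=
  Submodule.mapQ _ _ (resCocycles h) fun _ hx => restrict_mem_coboundaries h hx

theorem resCohomology_cls {K L : PreAbstractSimplicialComplex V} (h : L ≤ K)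
    (x : ↥(cocycles K)) : resCohomology h (cls K x) = cls L (resCocycles h x) :=
  rfl

theorem cls_surjective (K : PreAbstractSimplicialComplex V) : Function.Surjective (cls K) :=
  Submodule.mkQ_surjective _

theorem resCohomology_refl (K : PreAbstractSimplicialComplex V) (a : Cohomology K) :
    resCohomology (le_refl K) a = a := by
  obtain ⟨x, rfl⟩ := cls_surjective K a
  rw [resCohomology_cls]
  congr 1
  ext τ
  by_cases hτ : τ ∈ K.faces
  · exact restrict_of_mem _ hτ
  · exact (restrict_of_notMem _ hτ).trans (x.2.1 τ hτ).symm

theorem resCohomology_trans {K L M : PreAbstractSimplicialComplex V} (h : L ≤ K) (h' : M ≤ L)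
    (a : Cohomology K) :
    resCohomology h' (resCohomology h a) = resCohomology (h'.trans h) a := by
  obtain ⟨x, rfl⟩ := cls_surjective K a
  rw [resCohomology_cls, resCohomology_cls, resCohomology_cls]
  congr 1
  ext τ
  by_cases hτ : τ ∈ M.faces
  · exact (restrict_of_mem _ hτ).trans ((restrict_of_mem _ (h' hτ)).trans
      (restrict_of_mem _ hτ).symm)
  · exact (restrict_of_notMem _ hτ).trans (restrict_of_notMem _ hτ).symm

theorem resCohomology_cup {K L : PreAbstractSimplicialComplex V} (h : L ≤ K)
    (a b : Cohomology K) : resCohomology h (cupCohomology K a b) =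
      cupCohomology L (resCohomology h a) (resCohomology h b) := by
  obtain ⟨x, rfl⟩ := cls_surjective K a
  obtain ⟨y, rfl⟩ := cls_surjective K b
  rw [cupCohomology_cls, resCohomology_cls, resCohomology_cls, resCohomology_cls,
    cupCohomology_cls]
  congr 1
  ext1
  exact (cup_restrict h x.1 y.1).symm

theorem resCohomology_mem_deg {K L : PreAbstractSimplicialComplex V} (h : L ≤ K) {p : ℕ}
    {a : Cohomology K} (ha : a ∈ cohomologyDeg K p) :
    resCohomology h a ∈ cohomologyDeg L p := by
  obtain ⟨x, hx, rfl⟩ := ha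
  refine ⟨resCocycles h x, ?_, rfl⟩
  intro τ hτ
  change restrict L x.1 τ = 0
  by_cases hL : τ ∈ L.faces
  · rw [restrict_of_mem _ hL]; exact hx τ hτ
  · exact restrict_of_notMem _ hL

theorem resCohomology_mem_pos {K L : PreAbstractSimplicialComplex V} (h : L ≤ K)
    {a : Cohomology K} (ha : a ∈ cohomologyPos K) : resCohomology h a ∈ cohomologyPos L := by
  have : cohomologyPos K ≤ (cohomologyPos L).comap (resCohomology h) :=
    iSup_le fun p => fun b hb =>
      (le_iSup (fun p : ℕ => cohomologyDeg L (p + 1)) p) (resCohomology_mem_deg h hb)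
  exact this ha

theorem cupSpace_eq_map₂ (K : PreAbstractSimplicialComplex V) :
    cupSpace K = Submodule.map₂ (cupCohomology K) (cohomologyPos K) (cohomologyPos K) :=
  (TensorProduct.map₂_eq_range_lift_comp_mapIncl _ _ _).symm

theorem resCohomology_mem_cupSpace {K L : PreAbstractSimplicialComplex V} (h : L ≤ K)
    {a : Cohomology K} (ha : a ∈ cupSpace K) : resCohomology h a ∈ cupSpace L := by
  have : cupSpace K ≤ (cupSpace L).comap (resCohomology h) := by
    rw [cupSpace_eq_map₂, cupSpace_eq_map₂, Submodule.map₂_le]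
    intro x hx y hy
    rw [Submodule.mem_comap, resCohomology_cup]
    exact Submodule.apply_mem_map₂ _ (resCohomology_mem_pos h hx) (resCohomology_mem_pos h hy)
  exact this ha

end OneComplex

/-! ## Persistence modules and barcodes -/

/-- A persistence module over `ZMod 2` indexed by the opposite of `{0 < 1 < ⋯ < n}`: the
structure maps decrease the index. -/
structure PersistenceModule (n : ℕ) where
  space : Fin (n + 1) → Type u
  [addCommGroup : ∀ j, AddCommGroup (space j)]
  [module : ∀ j, Module (ZMod 2) (space j)]
  map : ∀ {s t : Fin (n + 1)}, s ≤ t → (space t →ₗ[ZMod 2] space s)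
  map_refl : ∀ (s : Fin (n + 1)) (x : space s), map (le_refl s) x = x
  map_trans : ∀ {r s t : Fin (n + 1)} (hrs : r ≤ s) (hst : s ≤ t) (x : space t),
    map hrs (map hst x) = map (hrs.trans hst) x

attribute [instance] PersistenceModule.addCommGroup PersistenceModule.module

namespace PersistenceModule

/-- An isomorphism of persistence modules. -/
structure Iso {n : ℕ} (M : PersistenceModule.{u} n) (N : PersistenceModule.{0} n) where
  equiv : ∀ j : Fin (n + 1), M.space j ≃ₗ[ZMod 2] N.space j
  comm : ∀ {s t : Fin (n + 1)} (h : s ≤ t) (x : M.space t),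
    equiv s (M.map h x) = N.map h (equiv t x)

/-- A submodule of a persistence module, with the restricted structure maps. -/
def sub {n : ℕ} (M : PersistenceModule.{u} n) (W : ∀ j, Submodule (ZMod 2) (M.space j))
    (hW : ∀ {s t : Fin (n + 1)} (h : s ≤ t), ∀ x ∈ W t, M.map h x ∈ W s) :
    PersistenceModule.{u} n where
  space j := ↥(W j)
  map h := (M.map h).restrict (hW h)
  map_refl s x := Subtype.ext (M.map_refl s x.1)
  map_trans hrs hst x := Subtype.ext (M.map_trans hrs hst x.1)

end PersistenceModule

/-- A bar `(death, birth]`. -/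
structure Bar (n : ℕ) where
  death : Fin (n + 1)
  birth : Fin (n + 1)

/-- The index `j` lies in the bar `(d, b]`, i.e. `d < j ≤ b`. -/
def Bar.Contains {n : ℕ} (I : Bar n) (j : Fin (n + 1)) : Prop := I.death < j ∧ j ≤ I.birth

/-- The value at `j` of a direct sum of interval modules: one copy of `ZMod 2` for every bar that
contains `j`, and `0` for the other bars. -/
def intervalSpace {n : ℕ} {ι : Type} (bars : ι → Bar n) (j : Fin (n + 1)) :
    Submodule (ZMod 2) (ι → ZMod 2) where
  carrier := {f | ∀ i, ¬ (bars i).Contains j → f i = 0}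
  add_mem' := by
    intro f g hf hg i hi
    simp [hf i hi, hg i hi]
  zero_mem' := by
    intro i _
    rfl
  smul_mem' := by
    intro c f hf i hi
    simp [hf i hi]

/-- The structure maps of a direct sum of interval modules: the identity on the summands whose bar
contains both indices, and zero on the others. -/
def intervalMap {n : ℕ} {ι : Type} (bars : ι → Bar n) (s t : Fin (n + 1)) :
    ↥(intervalSpace bars t) →ₗ[ZMod 2] ↥(intervalSpace bars s) where
  toFun f := ⟨Set.indicator {i | (bars i).Contains s} f.1,
    fun _ hi => Set.indicator_of_notMem (s := {i | (bars i).Contains s}) hi _⟩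
  map_add' f g := Subtype.ext (Set.indicator_add _ f.1 g.1)
  map_smul' c f := Subtype.ext (Set.indicator_const_smul _ c f.1)

/-- The direct sum of the interval modules of a finite family of bars. -/
def intervalSum {n : ℕ} {ι : Type} [Fintype ι] (bars : ι → Bar n) : PersistenceModule.{0} n where
  space j := ↥(intervalSpace bars j)
  map {s t} _ := intervalMap bars s t
  map_refl s f := by
    ext i
    change Set.indicator {i | (bars i).Contains s} f.1 i = f.1 i
    by_cases hi : (bars i).Contains s
    · exact Set.indicator_of_mem (s := {i | (bars i).Contains s}) hi _
    · rw [f.2 i hi]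
      exact Set.indicator_of_notMem (s := {i | (bars i).Contains s}) hi _
  map_trans {r s t} hrs hst f := by
    ext i
    change Set.indicator {i | (bars i).Contains r}
      (Set.indicator {i | (bars i).Contains s} f.1) i =
      Set.indicator {i | (bars i).Contains r} f.1 i
    by_cases hr : (bars i).Contains r
    · rw [Set.indicator_of_mem (s := {i | (bars i).Contains r}) hr,
        Set.indicator_of_mem (s := {i | (bars i).Contains r}) hr]
      by_cases hs : (bars i).Contains s
      · exact Set.indicator_of_mem (s := {i | (bars i).Contains s}) hs _
      · rw [Set.indicator_of_notMem (s := {i | (bars i).Contains s}) hs, f.2 i]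
        exact fun ht => hs ⟨lt_of_lt_of_le hr.1 hrs, hst.trans ht.2⟩
    · rw [Set.indicator_of_notMem (s := {i | (bars i).Contains r}) hr,
        Set.indicator_of_notMem (s := {i | (bars i).Contains r}) hr]

/-- The finite family `bars` of nonempty intervals (taken with multiplicities) is the barcode of
`M`: `M` is isomorphic to the direct sum of the interval modules of these bars. -/
def IsBarcode {n : ℕ} (M : PersistenceModule.{u} n) {ι : Type} [Fintype ι] (bars : ι → Bar n) :
    Prop :=
  (∀ i, (bars i).death < (bars i).birth) ∧ Nonempty (M.Iso (intervalSum bars))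

/-! ## Simplex-wise filtrations and their persistent cup modules -/

section Filtration

variable {V : Type u} [LinearOrder V] {n : ℕ}

/-- A simplex-wise filtration `∅ = K_0 ⊆ K_1 ⊆ ⋯ ⊆ K_n`, where `K_{i+1}` arises from `K_i`
by adding the single simplex `simplex i`. -/
structure SimplexwiseFiltration (V : Type u) [LinearOrder V] (n : ℕ) where
  complex : Fin (n + 1) → PreAbstractSimplicialComplex V
  simplex : Fin n → Finset V
  complex_zero : complex 0 = ⊥
  simplex_notMem : ∀ i : Fin n, simplex i ∉ (complex i.castSucc).faces
  complex_succ : ∀ i : Fin n,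
    (complex i.succ).faces = insert (simplex i) (complex i.castSucc).faces

theorem SimplexwiseFiltration.mono (K : SimplexwiseFiltration V n) : Monotone K.complex := by
  rw [Fin.monotone_iff_le_succ]
  intro i τ hτ
  change τ ∈ (K.complex i.succ).faces
  rw [K.complex_succ i]
  exact Set.mem_insert_of_mem _ hτ

/-- The persistence module `H^*(K_•)`. -/
def cohomologyModule (K : SimplexwiseFiltration V n) : PersistenceModule.{u} n where
  space j := Cohomology (K.complex j)
  map h := resCohomology (K.mono h)
  map_refl s a := resCohomology_refl (K.complex s) a
  map_trans hrs hst a := resCohomology_trans (K.mono hst) (K.mono hrs) a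

/-- The persistent cup module: the image of the morphism
`H^{>0}(K_•) ⊗ H^{>0}(K_•) → H^*(K_•)` given by the cup product. -/
def cupModule (K : SimplexwiseFiltration V n) : PersistenceModule.{u} n :=
  (cohomologyModule K).sub (fun j => cupSpace (K.complex j))
    (fun h _ hx => resCohomology_mem_cupSpace (K.mono h) hx)

/-- The degree `p` part of the persistent cup module. -/
def cupModuleDeg (K : SimplexwiseFiltration V n) (p : ℕ) : PersistenceModule.{u} n :=
  (cohomologyModule K).sub (fun j => cupSpaceDeg (K.complex j) p)
    (fun h _ hx => ⟨resCohomology_mem_cupSpace (K.mono h) hx.1,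
      resCohomology_mem_deg (K.mono h) hx.2⟩)

/-- A persistent cohomology basis of a filtration: the barcode of `H^*(K_•)`, enumerated as
`bar 0, …, bar (size - 1)` in any order, with a homogeneous representative cocycle in `K_b` for
every bar `(d, b]`.  For every index `j`, the restrictions to `K_j` of the representatives of the
bars that contain `j` represent a basis of `H^*(K_j)`, and a representative is a coboundary at
indices at which its bar has died.  (It follows that a representative of `(d, b]` with `b < n` is
no longer a cocycle in `K_{b+1}`.) -/
structure PersistentCohomologyBasis (K : SimplexwiseFiltration V n) where
  size : ℕ
  bar : Fin size → Bar n
  isBarcode : IsBarcode (cohomologyModule K) bar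
  deg : Fin size → ℕ
  rep : ∀ i, ↥(cocycles (K.complex (bar i).birth))
  rep_deg : ∀ i, (rep i).1 ∈ homogeneous V (deg i)
  linearIndependent : ∀ j, LinearIndependent (ZMod 2)
    (fun i : {i // (bar i).Contains j} =>
      resCohomology (K.mono i.2.2) (cls _ (rep i.1)))
  span_eq_top : ∀ j, Submodule.span (ZMod 2)
    (Set.range (fun i : {i // (bar i).Contains j} =>
      resCohomology (K.mono i.2.2) (cls _ (rep i.1)))) = ⊤
  eq_zero : ∀ i j, (hj : j ≤ (bar i).birth) → j ≤ (bar i).death →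
    resCohomology (K.mono hj) (cls _ (rep i)) = 0

end Filtration

/-! ## The algorithm CupPers

* Step 1. Compute the barcode of `H^*(K_•)` with representative cocycles `ξ_i` (a persistent
  cohomology basis).  Let `H` consist of the essential `ξ_i` of positive degree and let `S` be
  the coboundary matrix.
* Step 2. For `k = n, …, 1`:
  restrict the columns of `S` and `H` to the index `k`;
  * Step 2.1. for every `i` with `b_i = k` and `deg ξ_i > 0`: if `k ≠ n`, append `ξ_i` to `H`
    (2.1.1); for every `ξ_j` in `H`, if `ζ = ξ_i ⌣ ξ_j` is nonzero and independent in `S`, append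
    `ζ` to `S`, annotated with its birth `k` and its representative at birth `ζ` (2.1.2);
  * Step 2.2. if `k = d_i` for some `i` with `deg ξ_i > 0`: reduce `S` with left-to-right column
    additions (2.2.1); if a product cocycle is zeroed out, remove it from `S` and generate the bar
    `(k, birth]` with its representative at birth (2.2.2); remove `ξ_i` from `H` (2.2.3).

The result of Step 1 is an arbitrary persistent cohomology basis `Ω`, and the column additions of
Step 2.2 are arbitrary as long as they produce a reduced matrix.
-/

section Algorithm

variable {V : Type u} [LinearOrder V] {n : ℕ}

/-- A column of the matrix `S`.  The annotation `(birth, rep@birth)` is present exactly for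
columns that were inserted as product cocycles; the columns of the coboundary matrix have none. -/
structure Column (V : Type u) (n : ℕ) where
  vec : Cochain V
  annotation : Option (Fin (n + 1) × Cochain V)

/-- A bar-representative pair `((d, b], ζ)`. -/
structure BarRep (V : Type u) (n : ℕ) where
  bar : Bar n
  rep : Cochain V

/-- The state of the algorithm: the matrix `H`, whose columns are (restricted) representatives of
bars of `H^*(K_•)` and are stored along with the number of the bar, the matrix `S`, and the pairs
generated so far. -/
structure State (V : Type u) (n m : ℕ) where
  H : List (Fin m × Cochain V)
  S : List (Column V n)
  out : List (BarRep V n)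

namespace CupPers

variable {K : SimplexwiseFiltration V n}

open Classical in
/-- The state after Step 1: `H` holds the essential representatives of positive degree, and `S`
is the coboundary matrix of `K_n`. -/
def init (Ω : PersistentCohomologyBasis K) : State V n Ω.size where
  H := ((List.finRange Ω.size).filter
      (fun i => (Ω.bar i).birth = Fin.last n ∧ 0 < Ω.deg i)).map (fun i => (i, (Ω.rep i).1))
  S := List.ofFn (fun i : Fin n =>
    ⟨coboundary (K.complex (Fin.last n)) (Pi.single (K.simplex i) 1), none⟩)
  out := []

/-- Restriction of the columns of `S` and `H` to the index `k`. -/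
def restrictState (K : SimplexwiseFiltration V n) {m : ℕ} (k : Fin (n + 1)) (s : State V n m) :
    State V n m where
  H := s.H.map (fun x => (x.1, restrict (K.complex k) x.2))
  S := s.S.map (fun c => ⟨restrict (K.complex k) c.vec, c.annotation⟩)
  out := s.out

open Classical in
/-- Step 2.1.2: append `ζ` as a column born at `k` if it is nonzero and independent of the
columns of `S`. -/
def insertProduct (k : Fin (n + 1)) (S : List (Column V n)) (ζ : Cochain V) :
    List (Column V n) :=
  if ζ ≠ 0 ∧ ζ ∉ Submodule.span (ZMod 2) {x | ∃ c ∈ S, c.vec = x} then S ++ [⟨ζ, some (k, ζ)⟩]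
  else S

open Classical in
/-- The body of the loop of Step 2.1, for a bar `i` that is born at `k`. -/
def birthStep (Ω : PersistentCohomologyBasis K) (k : Fin (n + 1)) (s : State V n Ω.size)
    (i : Fin Ω.size) : State V n Ω.size :=
  let H' := if k ≠ Fin.last n then s.H ++ [(i, (Ω.rep i).1)] else s.H
  { H := H'
    S := H'.foldl (fun S x => insertProduct k S (cup (K.complex k) (Ω.rep i).1 x.2)) s.S
    out := s.out }

open Classical in
/-- Step 2.1. -/
def births (Ω : PersistentCohomologyBasis K) (k : Fin (n + 1)) (s : State V n Ω.size) :
    State V n Ω.size :=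
  ((List.finRange Ω.size).filter (fun i => (Ω.bar i).birth = k ∧ 0 < Ω.deg i)).foldl
    (birthStep Ω k) s

/-- One left-to-right column addition: a column is added to a column on its right. -/
def ColumnAddition (S S' : List (Column V n)) : Prop :=
  ∃ (i j : ℕ) (hi : i < j) (hj : j < S.length),
    S' = S.set j ⟨S[j].vec + (S[i]'(hi.trans hj)).vec, S[j].annotation⟩

open Classical in
/-- The row index of the lowest nonzero entry of a column; rows are ordered as the simplices in
the filtration.  It is `⊥` for the zero column. -/
def low (K : SimplexwiseFiltration V n) (x : Cochain V) : WithBot (Fin n) :=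
  (Finset.univ.filter (fun i : Fin n => x (K.simplex i) ≠ 0)).max

/-- A matrix is reduced if its nonzero columns have pairwise different lowest nonzero entries. -/
def IsReduced (K : SimplexwiseFiltration V n) (S : List (Column V n)) : Prop :=
  S.Pairwise (fun c c' => c.vec ≠ 0 → c'.vec ≠ 0 → low K c.vec ≠ low K c'.vec)

/-- The bar-representative pair that is generated at the index `k` from a column: there is one
only if the column is that of a product cocycle and is zeroed out. -/
def generated (k : Fin (n + 1)) (c : Column V n) : Option (BarRep V n) :=
  open Classical in
  if c.vec = 0 then c.annotation.map (fun a => ⟨⟨k, a.1⟩, a.2⟩) else none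

/-- Step 2.2, for the index `k`, as a relation between the states before and after it. -/
def Deaths (Ω : PersistentCohomologyBasis K) (k : Fin (n + 1)) (s s' : State V n Ω.size) : Prop :=
  (∃ i : Fin Ω.size, (Ω.bar i).death = k ∧ 0 < Ω.deg i ∧
    ∃ S' : List (Column V n), Relation.ReflTransGen ColumnAddition s.S S' ∧ IsReduced K S' ∧
      s'.S = S'.filter (fun c => (generated k c).isNone) ∧
      s'.out = s.out ++ S'.filterMap (generated k) ∧
      s'.H = s.H.filter (fun x => x.1 ≠ i)) ∨
  ((¬ ∃ i : Fin Ω.size, (Ω.bar i).death = k ∧ 0 < Ω.deg i) ∧ s' = s)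

/-- The iteration of the loop of Step 2 for the index `k`. -/
def Iteration (Ω : PersistentCohomologyBasis K) (k : Fin (n + 1)) (s s' : State V n Ω.size) :
    Prop :=
  Deaths Ω k (births Ω k (restrictState K k s)) s'

/-- The iterations for `k, k - 1, …, 1`, in this order, lead from the state `s` to the state
`s'`. -/
def Loop (Ω : PersistentCohomologyBasis K) :
    (k : ℕ) → k < n + 1 → State V n Ω.size → State V n Ω.size → Prop
  | 0, _, s, s' => s' = s
  | k + 1, hk, s, s' => ∃ t, Iteration Ω ⟨k + 1, hk⟩ s t ∧ Loop Ω k (by omega) t s'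

/-- The algorithm, with the result `Ω` of Step 1, can output the list `out`.  (Different outputs
are possible because the column additions of Step 2.2 are not prescribed.) -/
def Outputs (Ω : PersistentCohomologyBasis K) (out : List (BarRep V n)) : Prop :=
  ∃ s, Loop Ω n (Nat.lt_succ_self n) (init Ω) s ∧ s.out = out

/-- The bars of a list of bar-representative pairs. -/
def barsOf (out : List (BarRep V n)) : Fin out.length → Bar n := fun i => (out.get i).bar

open Classical in
/-- The pairs in a list whose representative has degree `p`. -/
def degreePart (p : ℕ) (out : List (BarRep V n)) : List (BarRep V n) :=
  out.filter (fun e => e.rep ∈ homogeneous V p)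

end CupPers

end Algorithm

end CupPersistence

end

open CupPersistence

/-!
The proof works with cochains modulo coboundaries along the filtration instead of with cohomology
classes. A barcode can be read off from homogeneous cochains which die with their bars and which
give, at every index `j`, a basis of the relevant space of cochains on `K_j` modulo coboundaries
(`IsCochainBasis`, `IsCochainBasis.isBarcode`). Such cochains come from the elder rule
(`exists_isCochainBasis`): list homogeneous cochains that span the space at every index, by
decreasing births, and let each of them die at the largest index at which it depends, modulo
coboundaries, on those listed before it. A relation at the death, whose components of other
degrees may be dropped, corrects the cochain by earlier ones so that it vanishes there. For the
list of all homogeneous cocycles this gives the existence of a persistent cohomology basis.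

The cup space at `k` is spanned by the classes of the products of positive-degree members of the
basis whose bars contain `k` (`cupCochains_le_of_reps`). Let `Z` be the list of the product
cocycles inserted by the algorithm, in the order of insertion, hence by decreasing births. It
spans the cup space at every index. The algorithm may multiply a pair of representatives in one
order only, which suffices because the other product is cohomologous; Steenrod's cup-1 product
provides the cobounding cochain (`coboundary_cupOne`). It remains to see that the algorithm finds
the death that the elder rule assigns to each entry of `Z`.

Left-to-right column additions change a column by a combination of the columns to its left
(`Unitriangular`). In a reduced matrix a nonzero column is independent of the columns to its left
(`IsReduced.eq_zero_of_mem_prefixSpan`). Hence, whichever additions are made, the column of a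
product cocycle is zero after the reduction at `k` if and only if at `k` the cocycle depends on
the earlier entries of `Z` (`Represents.vec_eq_zero_iff`); the entries whose columns have already
been removed are combinations of the others and so make no difference
(`Represents.genSpan_prior`). If no bar of positive degree dies at `k`, the matrix is not reduced,
but then the restriction to `K_k` is injective on cohomology of positive degree and no new
dependence can occur (`mem_coboundaries_of_restrict`, `Represents.settled_of_injective`). In `K_1`
every cochain of positive degree is zero, so that all entries of `Z` have died when the loop ends,
and the output is the barcode found by the elder rule. Its members are homogeneous, so those of
degree `p` give the barcode of the degree `p` part (`IsCochainBasis.subtype_deg`).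
-/

noncomputable section

namespace CupPersistence

universe u

section OneComplex

variable {V : Type u} [LinearOrder V]

/-! ### Cochains of one complex -/

theorem coboundary_coboundary (K : PreAbstractSimplicialComplex V) (x : Cochain V) :
    coboundary K (coboundary K x) = 0 := by
  funext τ
  by_cases hτ : τ ∈ K.faces
  swap
  · exact restrict_of_notMem _ hτ
  rw [coboundary_apply _ hτ]
  have h : ∀ v ∈ τ, coboundary K x (τ.erase v) = ∑ w ∈ τ.erase v, x ((τ.erase v).erase w) := by
    intro v _
    rcases (τ.erase v).eq_empty_or_nonempty with h | h
    · rw [h]; exact restrict_of_notMem _ (empty_notMem K)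
    · exact coboundary_apply _ (mem_of_subset hτ (Finset.erase_subset _ _) h)
  rw [Finset.sum_congr rfl h, Finset.sum_sigma']
  refine Finset.sum_involution (fun a _ => ⟨a.2, a.1⟩) ?_ ?_ ?_ ?_
  · rintro ⟨v, w⟩ _
    dsimp only
    rw [Finset.erase_right_comm]
    exact CharTwo.add_self_eq_zero _
  · rintro ⟨v, w⟩ hvw _ h
    simp only [Finset.mem_sigma, Finset.mem_erase] at hvw
    simp only [Sigma.mk.injEq, heq_eq_eq] at h
    exact hvw.2.1 h.1
  · rintro ⟨v, w⟩ hvw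
    simp only [Finset.mem_sigma, Finset.mem_erase] at hvw ⊢
    exact ⟨hvw.2.2, hvw.2.1.symm, hvw.1⟩
  · rintro ⟨v, w⟩ _
    rfl

theorem coboundaries_le_cocycles (K : PreAbstractSimplicialComplex V) :
    coboundaries K ≤ cocycles K := by
  rintro _ ⟨z, -, rfl⟩
  exact ⟨restrict_mem_cochains K _, coboundary_coboundary K z⟩

theorem restrict_eq_self {K : PreAbstractSimplicialComplex V} {x : Cochain V}
    (hx : x ∈ cochains K) : restrict K x = x := by
  funext τ
  by_cases hτ : τ ∈ K.faces
  · exact restrict_of_mem _ hτ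
  · rw [restrict_of_notMem _ hτ, hx τ hτ]

theorem restrict_restrict {K L : PreAbstractSimplicialComplex V} (h : L ≤ K) (x : Cochain V) :
    restrict L (restrict K x) = restrict L x := by
  funext τ
  by_cases hτ : τ ∈ L.faces
  · rw [restrict_of_mem _ hτ, restrict_of_mem _ hτ, restrict_of_mem _ (h hτ)]
  · rw [restrict_of_notMem _ hτ, restrict_of_notMem _ hτ]

/-! ### Commutativity of the cup product up to coboundaries -/

/-- Summing over the elements of a chain the values of a function at the two adjacent lower sets
leaves only the values at the empty set and at the whole chain. -/
theorem sum_lowerSets (φ : Finset V → ZMod 2) (σ : Finset V) :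
    ∑ u ∈ σ, (φ (σ.filter (· < u)) + φ (σ.filter (· ≤ u))) = φ ∅ + φ σ := by
  induction σ using Finset.induction_on_max with
  | empty => simpa using (CharTwo.add_self_eq_zero (φ ∅)).symm
  | insert a s hs ih =>
    have ha : a ∉ s := fun h => lt_irrefl _ (hs a h)
    have e1 : (insert a s).filter (· < a) = s := by
      ext w; simp only [Finset.mem_filter, Finset.mem_insert]; grind
    have e2 : (insert a s).filter (· ≤ a) = insert a s := by
      ext w; simp only [Finset.mem_filter, Finset.mem_insert]; grind
    rw [Finset.sum_insert ha, e1, e2]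
    have h : ∑ u ∈ s, (φ ((insert a s).filter (· < u)) + φ ((insert a s).filter (· ≤ u))) =
        ∑ u ∈ s, (φ (s.filter (· < u)) + φ (s.filter (· ≤ u))) := by
      refine Finset.sum_congr rfl fun u hu => ?_
      rw [Finset.filter_insert, Finset.filter_insert, if_neg (not_lt.2 (hs u hu).le),
        if_neg (not_le.2 (hs u hu))]
    rw [h, ih]
    linear_combination CharTwo.add_self_eq_zero (φ s)

theorem sum_upperSets (φ : Finset V → ZMod 2) (σ : Finset V) :
    ∑ u ∈ σ, (φ (σ.filter (u < ·)) + φ (σ.filter (u ≤ ·))) = φ ∅ + φ σ :=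
  sum_lowerSets (V := Vᵒᵈ) φ σ

/-- The sum over all pairs `u < v` of vertices of the products of the values of `x` on the part
outside of the open interval `(u, v)` and of `y` on the closed interval `[u, v]`.  For homogeneous
cochains this is Steenrod's cup-1 product. -/
def cupOneSum (x y : Cochain V) : Cochain V := fun τ =>
  ∑ u ∈ τ, ∑ v ∈ τ.filter (u < ·),
    x (τ.filter (fun w => w ≤ u ∨ v ≤ w)) * y (τ.filter (fun w => u ≤ w ∧ w ≤ v))

/-- Steenrod's formula for the coboundary of the cup-1 product of two cocycles. -/
theorem coboundary_cupOne {K : PreAbstractSimplicialComplex V} {x y : Cochain V}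
    (hx : x ∈ cocycles K) (hy : y ∈ cocycles K) :
    coboundary K (restrict K (cupOneSum x y)) = cup K x y + cup K y x := by
  funext τ
  by_cases hτ : τ ∈ K.faces
  swap
  · simp [coboundary, cup, restrict_of_notMem _ hτ]
  have zero : ∀ z ∈ cocycles K, ∀ s ⊆ τ, s.Nonempty → ∑ w ∈ s, z (s.erase w) = 0 := by
    intro z hz s hs hne
    have hs' := mem_of_subset hτ hs hne
    have := congrFun (show coboundary K z = 0 from hz.2) s
    rwa [coboundary_apply _ hs'] at this
  rw [Pi.add_apply, coboundary_apply _ hτ, cup_apply _ _ hτ, cup_apply _ _ hτ]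
  have hL : ∀ w ∈ τ, restrict K (cupOneSum x y) (τ.erase w) = cupOneSum x y (τ.erase w) := by
    intro w _
    rcases (τ.erase w).eq_empty_or_nonempty with h | h
    · rw [h, restrict_of_notMem _ (empty_notMem K)]; simp [cupOneSum]
    · exact restrict_of_mem _ (mem_of_subset hτ (Finset.erase_subset _ _) h)
  rw [Finset.sum_congr rfl hL]
  -- Interchange the sums: the deleted vertex `w` is either outside of `[u, v]` or inside `(u, v)`.
  have hswap : ∑ w ∈ τ, cupOneSum x y (τ.erase w) =
      ∑ u ∈ τ, ∑ v ∈ τ.filter (u < ·), ∑ w ∈ (τ.erase u).erase v,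
        x ((τ.erase w).filter (fun t => t ≤ u ∨ v ≤ t)) *
          y ((τ.erase w).filter (fun t => u ≤ t ∧ t ≤ v)) := by
    unfold cupOneSum
    rw [Finset.sum_comm' (t' := τ) (s' := fun u => τ.erase u)
      (by intro a b; simp only [Finset.mem_erase]; grind)]
    refine Finset.sum_congr rfl fun u _ => ?_
    rw [Finset.sum_comm' (t' := τ.filter (u < ·)) (s' := fun v => (τ.erase u).erase v)
      (by intro a b; simp only [Finset.mem_erase, Finset.mem_filter]; grind)]
  have hinner : ∀ u ∈ τ, ∀ v ∈ τ.filter (u < ·), (∑ w ∈ (τ.erase u).erase v,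
        x ((τ.erase w).filter (fun t => t ≤ u ∨ v ≤ t)) *
          y ((τ.erase w).filter (fun t => u ≤ t ∧ t ≤ v))) =
      (x (τ.filter (fun t => t < u ∨ v ≤ t)) + x (τ.filter (fun t => t ≤ u ∨ v < t))) *
        y (τ.filter (fun t => u ≤ t ∧ t ≤ v)) +
      x (τ.filter (fun t => t ≤ u ∨ v ≤ t)) *
        (y (τ.filter (fun t => u < t ∧ t ≤ v)) + y (τ.filter (fun t => u ≤ t ∧ t < v))) := by
    intro u hu v hv
    rw [Finset.mem_filter] at hv
    obtain ⟨hv, huv⟩ := hv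
    have split : (τ.erase u).erase v =
        ((τ.filter (fun t => t ≤ u ∨ v ≤ t)).erase u).erase v ∪
        ((τ.filter (fun t => u ≤ t ∧ t ≤ v)).erase u).erase v := by
      ext t; simp only [Finset.mem_erase, Finset.mem_union, Finset.mem_filter]; grind
    have disj : Disjoint (((τ.filter (fun t => t ≤ u ∨ v ≤ t)).erase u).erase v)
        (((τ.filter (fun t => u ≤ t ∧ t ≤ v)).erase u).erase v) := by
      rw [Finset.disjoint_left]; intro t; simp only [Finset.mem_erase, Finset.mem_filter]; grind
    have two : ∀ z ∈ cocycles K, ∀ s ⊆ τ, u ∈ s → v ∈ s →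
        ∑ w ∈ (s.erase u).erase v, z (s.erase w) = z (s.erase u) + z (s.erase v) := by
      intro z hz s hs hus hvs
      have h := zero z hz s hs ⟨u, hus⟩
      rw [← Finset.add_sum_erase s _ hus, ← Finset.add_sum_erase (s.erase u) _
        (Finset.mem_erase.2 ⟨huv.ne', hvs⟩)] at h
      linear_combination h - CharTwo.add_self_eq_zero (z (s.erase u)) -
        CharTwo.add_self_eq_zero (z (s.erase v))
    have hF := two x hx (τ.filter (fun t => t ≤ u ∨ v ≤ t)) (Finset.filter_subset _ _)
      (by simp [hu]) (by simp [hv])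
    have hM := two y hy (τ.filter (fun t => u ≤ t ∧ t ≤ v)) (Finset.filter_subset _ _)
      (by simp [hu, huv.le]) (by simp [hv, huv.le])
    have eF1 : (τ.filter (fun t => t ≤ u ∨ v ≤ t)).erase u = τ.filter (fun t => t < u ∨ v ≤ t) := by
      ext t; simp only [Finset.mem_erase, Finset.mem_filter]; grind
    have eF2 : (τ.filter (fun t => t ≤ u ∨ v ≤ t)).erase v = τ.filter (fun t => t ≤ u ∨ v < t) := by
      ext t; simp only [Finset.mem_erase, Finset.mem_filter]; grind
    have eM1 : (τ.filter (fun t => u ≤ t ∧ t ≤ v)).erase u = τ.filter (fun t => u < t ∧ t ≤ v) := by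
      ext t; simp only [Finset.mem_erase, Finset.mem_filter]; grind
    have eM2 : (τ.filter (fun t => u ≤ t ∧ t ≤ v)).erase v = τ.filter (fun t => u ≤ t ∧ t < v) := by
      ext t; simp only [Finset.mem_erase, Finset.mem_filter]; grind
    rw [split, Finset.sum_union disj, ← eF1, ← eF2, ← eM1, ← eM2, ← hF, ← hM, Finset.sum_mul,
      Finset.mul_sum]
    congr 1
    · refine Finset.sum_congr rfl fun w hw => ?_
      simp only [Finset.mem_erase, Finset.mem_filter] at hw
      rw [← Finset.filter_erase, show (τ.erase w).filter (fun t => u ≤ t ∧ t ≤ v) =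
        τ.filter (fun t => u ≤ t ∧ t ≤ v) by
          ext t; simp only [Finset.mem_erase, Finset.mem_filter]; grind]
    · refine Finset.sum_congr rfl fun w hw => ?_
      simp only [Finset.mem_erase, Finset.mem_filter] at hw
      rw [← Finset.filter_erase, show (τ.erase w).filter (fun t => t ≤ u ∨ v ≤ t) =
        τ.filter (fun t => t ≤ u ∨ v ≤ t) by
          ext t; simp only [Finset.mem_erase, Finset.mem_filter]; grind]
  rw [hswap, Finset.sum_congr rfl fun u hu => Finset.sum_congr rfl (hinner u hu)]
  -- For fixed `v` the terms in which a boundary vertex `u` is moved telescope, and vice versa.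
  have hlow : ∑ u ∈ τ, ∑ v ∈ τ.filter (u < ·),
      (x (τ.filter (fun t => t < u ∨ v ≤ t)) * y (τ.filter (fun t => u ≤ t ∧ t ≤ v)) +
        x (τ.filter (fun t => t ≤ u ∨ v ≤ t)) * y (τ.filter (fun t => u < t ∧ t ≤ v))) =
      ∑ v ∈ τ, (y (τ.filter (· ≤ v)) * x (τ.filter (v ≤ ·)) + x τ * y {v}) := by
    rw [Finset.sum_comm' (t' := τ) (s' := fun v => τ.filter (· < v))
      (by intro a b; simp only [Finset.mem_filter]; grind)]
    refine Finset.sum_congr rfl fun v hv => ?_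
    have h := sum_lowerSets (fun s => x (s ∪ τ.filter (v ≤ ·)) * y (τ.filter (· ≤ v) \ s))
      (τ.filter (· < v))
    rw [Finset.empty_union, Finset.sdiff_empty,
      show τ.filter (· < v) ∪ τ.filter (v ≤ ·) = τ by
        ext t; simp only [Finset.mem_union, Finset.mem_filter]; grind,
      show τ.filter (· ≤ v) \ τ.filter (· < v) = {v} by
        ext t; simp only [Finset.mem_sdiff, Finset.mem_filter, Finset.mem_singleton]; grind] at h
    rw [mul_comm (y _), ← h]
    refine Finset.sum_congr rfl fun u hu => ?_
    rw [Finset.mem_filter] at hu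
    congr 3
    all_goals
      ext t; simp only [Finset.mem_union, Finset.mem_sdiff, Finset.mem_filter]; grind
  have hupp : ∑ u ∈ τ, ∑ v ∈ τ.filter (u < ·),
      (x (τ.filter (fun t => t ≤ u ∨ v < t)) * y (τ.filter (fun t => u ≤ t ∧ t ≤ v)) +
        x (τ.filter (fun t => t ≤ u ∨ v ≤ t)) * y (τ.filter (fun t => u ≤ t ∧ t < v))) =
      ∑ u ∈ τ, (x (τ.filter (· ≤ u)) * y (τ.filter (u ≤ ·)) + x τ * y {u}) := by
    refine Finset.sum_congr rfl fun u hu => ?_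
    have h := sum_upperSets (fun s => x (τ.filter (· ≤ u) ∪ s) * y (τ.filter (u ≤ ·) \ s))
      (τ.filter (u < ·))
    rw [Finset.union_empty, Finset.sdiff_empty,
      show τ.filter (· ≤ u) ∪ τ.filter (u < ·) = τ by
        ext t; simp only [Finset.mem_union, Finset.mem_filter]; grind,
      show τ.filter (u ≤ ·) \ τ.filter (u < ·) = {u} by
        ext t; simp only [Finset.mem_sdiff, Finset.mem_filter, Finset.mem_singleton]; grind] at h
    rw [← h]
    refine Finset.sum_congr rfl fun v hv => ?_
    rw [Finset.mem_filter] at hv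
    congr 3
    all_goals
      ext t; simp only [Finset.mem_union, Finset.mem_sdiff, Finset.mem_filter]; grind
  have h2 := CharTwo.add_self_eq_zero (∑ u ∈ τ, x τ * y {u})
  simp only [add_mul, mul_add, Finset.sum_add_distrib] at hlow hupp ⊢
  linear_combination hlow + hupp + h2

theorem cup_add_cup_mem_coboundaries {K : PreAbstractSimplicialComplex V} {x y : Cochain V}
    (hx : x ∈ cocycles K) (hy : y ∈ cocycles K) : cup K x y + cup K y x ∈ coboundaries K :=
  ⟨_, restrict_mem_cochains K _, coboundary_cupOne hx hy⟩

/-! ### Homogeneous components -/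

/-- The homogeneous component of degree `p` of a cochain. -/
def homProj (V : Type u) (p : ℕ) : Cochain V →ₗ[ZMod 2] Cochain V where
  toFun x := fun τ => if τ.card = p + 1 then x τ else 0
  map_add' x y := by funext τ; by_cases h : τ.card = p + 1 <;> simp [h]
  map_smul' c x := by funext τ; by_cases h : τ.card = p + 1 <;> simp [h]

theorem homProj_apply (p : ℕ) (x : Cochain V) (τ : Finset V) :
    homProj V p x τ = if τ.card = p + 1 then x τ else 0 := rfl

theorem homProj_mem (p : ℕ) (x : Cochain V) : homProj V p x ∈ homogeneous V p :=
  fun _ h => if_neg h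

theorem homProj_of_mem {p : ℕ} {x : Cochain V} (hx : x ∈ homogeneous V p) :
    homProj V p x = x := by
  funext τ
  rw [homProj_apply]
  split_ifs with h
  · rfl
  · exact (hx τ h).symm

theorem homProj_of_mem_of_ne {p q : ℕ} {x : Cochain V} (hx : x ∈ homogeneous V q)
    (hpq : p ≠ q) : homProj V p x = 0 := by
  funext τ
  rw [homProj_apply]
  split_ifs with h
  · exact hx τ (by omega)
  · rfl

theorem homogeneous_unique {p q : ℕ} {x : Cochain V} (hp : x ∈ homogeneous V p)
    (hq : x ∈ homogeneous V q) (hx : x ≠ 0) : p = q := by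
  by_contra h
  exact hx ((homProj_of_mem hp).symm.trans (homProj_of_mem_of_ne hq h))

theorem homProj_restrict (K : PreAbstractSimplicialComplex V) (p : ℕ) (x : Cochain V) :
    homProj V p (restrict K x) = restrict K (homProj V p x) := by
  funext τ
  by_cases hτ : τ ∈ K.faces
  · rw [restrict_of_mem _ hτ, homProj_apply, homProj_apply, restrict_of_mem _ hτ]
  · rw [restrict_of_notMem _ hτ, homProj_apply, restrict_of_notMem _ hτ, ite_self]

theorem restrict_mem_homogeneous (K : PreAbstractSimplicialComplex V) {p : ℕ} {x : Cochain V}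
    (hx : x ∈ homogeneous V p) : restrict K x ∈ homogeneous V p := by
  rw [← homProj_of_mem hx, ← homProj_restrict]
  exact homProj_mem p _

theorem homProj_mem_cochains {K : PreAbstractSimplicialComplex V} (p : ℕ) {x : Cochain V}
    (hx : x ∈ cochains K) : homProj V p x ∈ cochains K := by
  rw [← restrict_eq_self hx, homProj_restrict]
  exact restrict_mem_cochains K _

theorem homProj_succ_coboundary (K : PreAbstractSimplicialComplex V) (p : ℕ) (x : Cochain V) :
    homProj V (p + 1) (coboundary K x) = coboundary K (homProj V p x) := by
  change homProj V (p + 1) (restrict K (facetSum x)) = restrict K (facetSum (homProj V p x))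
  rw [homProj_restrict]
  congr 1
  funext τ
  change (if τ.card = p + 1 + 1 then ∑ v ∈ τ, x (τ.erase v) else 0) =
    ∑ v ∈ τ, if (τ.erase v).card = p + 1 then x (τ.erase v) else 0
  split_ifs with h
  · exact Finset.sum_congr rfl fun v hv =>
      (if_pos (by rw [Finset.card_erase_of_mem hv, h]; rfl)).symm
  · refine (Finset.sum_eq_zero fun v hv => if_neg ?_).symm
    rw [Finset.card_erase_of_mem hv]
    have := Finset.card_pos.2 ⟨v, hv⟩
    omega

theorem homProj_zero_coboundary {K : PreAbstractSimplicialComplex V} {x : Cochain V}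
    (hx : x ∈ cochains K) : homProj V 0 (coboundary K x) = 0 := by
  funext τ
  rw [homProj_apply]
  split_ifs with h
  · by_cases hτ : τ ∈ K.faces
    · obtain ⟨v, rfl⟩ := Finset.card_eq_one.1 h
      rw [coboundary_apply _ hτ]
      simpa using hx _ (empty_notMem K)
    · exact restrict_of_notMem _ hτ
  · rfl

theorem homProj_mem_coboundaries {K : PreAbstractSimplicialComplex V} (p : ℕ) {x : Cochain V}
    (hx : x ∈ coboundaries K) : homProj V p x ∈ coboundaries K := by
  obtain ⟨z, hz, rfl⟩ := hx
  cases p with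
  | zero => rw [homProj_zero_coboundary hz]; exact zero_mem _
  | succ p => exact ⟨_, homProj_mem_cochains p hz, (homProj_succ_coboundary K p z).symm⟩

theorem homProj_mem_cocycles {K : PreAbstractSimplicialComplex V} (p : ℕ) {x : Cochain V}
    (hx : x ∈ cocycles K) : homProj V p x ∈ cocycles K := by
  refine ⟨homProj_mem_cochains p hx.1, ?_⟩
  change coboundary K _ = 0
  rw [← homProj_succ_coboundary, show coboundary K x = 0 from hx.2, map_zero]

theorem cup_mem_homogeneous (K : PreAbstractSimplicialComplex V) {p q : ℕ} {x y : Cochain V}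
    (hx : x ∈ homogeneous V p) (hy : y ∈ homogeneous V q) :
    cup K x y ∈ homogeneous V (p + q) := by
  refine restrict_mem_homogeneous K fun τ hτ => Finset.sum_eq_zero fun v hv => ?_
  by_cases h1 : (τ.filter (· ≤ v)).card = p + 1
  swap
  · rw [hx _ h1, zero_mul]
  by_cases h2 : (τ.filter (v ≤ ·)).card = q + 1
  swap
  · rw [hy _ h2, mul_zero]
  -- The front part and the back part share exactly the vertex `v`.
  have h3 := Finset.card_union_add_card_inter (τ.filter (· ≤ v)) (τ.filter (v ≤ ·))
  rw [show τ.filter (· ≤ v) ∪ τ.filter (v ≤ ·) = τ by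
      ext t; simp only [Finset.mem_union, Finset.mem_filter]; grind,
    show τ.filter (· ≤ v) ∩ τ.filter (v ≤ ·) = {v} by
      ext t; simp only [Finset.mem_inter, Finset.mem_filter, Finset.mem_singleton]; grind,
    Finset.card_singleton] at h3
  omega

end OneComplex

/-! ### Triangular bases -/

section Triangular

variable {R E ι Λ : Type*} [Field R] [AddCommGroup E] [Module R E] [LinearOrder Λ]

/-- Adding earlier vectors to some vectors and leaving out vectors which depend on the earlier ones
does not make the span smaller. -/
theorem span_le_span_of_triangular [Finite ι] {σ : ι → Λ} {z x : ι → E} {t s : Set ι}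
    (hlow : ∀ i ∈ t, ∀ l, σ l < σ i → l ∈ t)
    (hx : ∀ i ∈ s, x i - z i ∈ Submodule.span R (z '' {l | σ l < σ i}))
    (hdead : ∀ i ∈ t, i ∉ s → z i ∈ Submodule.span R (z '' {l | σ l < σ i})) :
    Submodule.span R (z '' t) ≤ Submodule.span R (x '' s) := by
  have key : ∀ i, i ∈ t → z i ∈ Submodule.span R (x '' s) := by
    intro i
    induction i using (Finite.wellFounded_of_trans_of_irrefl (InvImage (· < ·) σ)).induction with
    | _ i ih =>
      intro hi
      have hle : Submodule.span R (z '' {l | σ l < σ i}) ≤ Submodule.span R (x '' s) := by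
        rw [Submodule.span_le]
        rintro _ ⟨l, hl, rfl⟩
        exact ih l hl (hlow i hi l hl)
      by_cases his : i ∈ s
      · have h := sub_mem (Submodule.subset_span ⟨i, his, rfl⟩ : x i ∈ Submodule.span R (x '' s))
          (hle (hx i his))
        rwa [sub_sub_cancel] at h
      · exact hle (hdead i hi his)
  rw [Submodule.span_le]
  rintro _ ⟨i, hi, rfl⟩
  exact key i hi

/-- Vectors that arise by adding earlier vectors to vectors which are not in the span of the
earlier ones are linearly independent. -/
theorem linearIndependent_of_triangular {σ : ι → Λ} (hσ : Function.Injective σ) {z x : ι → E}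
    {s : Set ι} (hx : ∀ i ∈ s, x i - z i ∈ Submodule.span R (z '' {l | σ l < σ i}))
    (halive : ∀ i ∈ s, z i ∉ Submodule.span R (z '' {l | σ l < σ i})) :
    LinearIndependent R (fun i : s => x i) := by
  classical
  rw [linearIndependent_iff']
  intro F g hg i hi
  by_contra hgi
  -- Consider the last vector with a nonzero coefficient.
  obtain ⟨m, hm, hmax⟩ := Finset.exists_max_image (F.filter fun i => g i ≠ 0) (fun i => σ i.1)
    ⟨i, Finset.mem_filter.2 ⟨hi, hgi⟩⟩
  rw [Finset.mem_filter] at hm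
  refine halive m.1 m.2 ?_
  have hrest : ∑ l ∈ F.erase m, g l • x l.1 ∈ Submodule.span R (z '' {l | σ l < σ m.1}) := by
    refine Submodule.sum_mem _ fun l hl => ?_
    rw [Finset.mem_erase] at hl
    by_cases hgl : g l = 0
    · rw [hgl, zero_smul]; exact zero_mem _
    · have hlt : σ l.1 < σ m.1 := lt_of_le_of_ne (hmax l (Finset.mem_filter.2 ⟨hl.2, hgl⟩))
        fun h => hl.1 (Subtype.ext (hσ h))
      refine Submodule.smul_mem _ _ ?_
      rw [← sub_add_cancel (x l.1) (z l.1)]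
      refine add_mem (Submodule.span_mono (Set.image_mono fun a ha => lt_trans ha hlt) (hx l.1 l.2))
        (Submodule.subset_span ⟨l.1, hlt, rfl⟩)
  have hxm : x m.1 ∈ Submodule.span R (z '' {l | σ l < σ m.1}) := by
    rw [← Finset.add_sum_erase F _ hm.1] at hg
    have h := Submodule.smul_mem _ (g m)⁻¹ (neg_mem hrest)
    rwa [← eq_neg_of_add_eq_zero_left hg, inv_smul_smul₀ hm.2] at h
  have h := sub_mem hxm (hx m.1 m.2)
  rwa [sub_sub_cancel] at h

end Triangular

/-! ### Barcodes from compatible bases -/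

section Barcodes

variable {n : ℕ}

open Classical in
/-- The image at the index `j` of an element that lives at the index `b`; it is zero if `b < j`. -/
def PersistenceModule.mapOrZero (M : PersistenceModule.{u} n) {b : Fin (n + 1)} (x : M.space b)
    (j : Fin (n + 1)) : M.space j :=
  if h : j ≤ b then M.map h x else 0

theorem PersistenceModule.mapOrZero_of_le (M : PersistenceModule.{u} n) {b j : Fin (n + 1)}
    (x : M.space b) (h : j ≤ b) : M.mapOrZero x j = M.map h x :=
  dif_pos h

/-- Elements of a persistence module which die with their bars, and which at every index give a
basis when only the bars containing the index are considered, exhibit the family of bars as the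
barcode: the coordinates with respect to these bases form an isomorphism. -/
theorem isBarcode_of_basis (M : PersistenceModule.{u} n) {ι : Type} [Fintype ι]
    (bars : ι → Bar n) (hb : ∀ i, (bars i).death < (bars i).birth)
    (x : ∀ i, M.space (bars i).birth)
    (hli : ∀ j, LinearIndependent (ZMod 2)
      (fun i : {i // (bars i).Contains j} => M.map i.2.2 (x i.1)))
    (hspan : ∀ j, ⊤ ≤ Submodule.span (ZMod 2)
      (Set.range (fun i : {i // (bars i).Contains j} => M.map i.2.2 (x i.1))))
    (hzero : ∀ i j, (hj : j ≤ (bars i).birth) → j ≤ (bars i).death → M.map hj (x i) = 0) :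
    IsBarcode M bars := by
  classical
  refine ⟨hb, ?_⟩
  let Ψ : ∀ j, ↥(intervalSpace bars j) →ₗ[ZMod 2] M.space j := fun j =>
    (Fintype.linearCombination (ZMod 2) (fun i => M.mapOrZero (x i) j)).comp
      (intervalSpace bars j).subtype
  have hΨ : ∀ j f, Ψ j f = ∑ i, f.1 i • M.mapOrZero (x i) j := fun j f => rfl
  have hsub : ∀ j (f : ↥(intervalSpace bars j)),
      Ψ j f = ∑ i : {i // (bars i).Contains j}, f.1 i.1 • M.map i.2.2 (x i.1) := by
    intro j f
    have h0 : ∀ i, i ∉ Finset.univ.filter (fun i => (bars i).Contains j) →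
        f.1 i • M.mapOrZero (x i) j = 0 := by
      intro i hi
      rw [f.2 i (by simpa using hi), zero_smul]
    rw [hΨ, ← Finset.sum_subset (Finset.subset_univ _) (fun i _ => h0 i),
      Finset.sum_subtype (p := fun i => (bars i).Contains j) _ (by simp)]
    exact Finset.sum_congr rfl fun i _ => congrArg (f.1 i.1 • ·) (M.mapOrZero_of_le _ i.2.2)
  have hbij : ∀ j, Function.Bijective (Ψ j) := by
    intro j
    constructor
    · rw [injective_iff_map_eq_zero]
      intro f hf
      rw [hsub] at hf
      have h := Fintype.linearIndependent_iff.1 (hli j) (fun i => f.1 i.1) hf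
      ext i
      by_cases hi : (bars i).Contains j
      · exact h ⟨i, hi⟩
      · exact f.2 i hi
    · rw [← LinearMap.range_eq_top, ← top_le_iff]
      refine (hspan j).trans (Submodule.span_le.2 ?_)
      rintro _ ⟨i, rfl⟩
      refine ⟨⟨Pi.single i.1 1, fun l hl => Pi.single_eq_of_ne (by rintro rfl; exact hl i.2) _⟩, ?_⟩
      rw [hΨ, Finset.sum_eq_single i.1]
      · simp [M.mapOrZero_of_le _ i.2.2]
      · intro l _ hl
        simp [Pi.single_eq_of_ne hl]
      · simp
  let e := fun j => LinearEquiv.ofBijective (Ψ j) (hbij j)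
  refine ⟨⟨fun j => (e j).symm, ?_⟩⟩
  intro s t h y
  obtain ⟨f, rfl⟩ := (e t).surjective y
  suffices hf : M.map h (Ψ t f) = Ψ s (intervalMap bars s t f) from
    ((e s).symm_apply_eq.2 hf).trans
      (congrArg (intervalMap bars s t) ((e t).symm_apply_apply f).symm)
  rw [hΨ, hΨ, map_sum]
  refine Finset.sum_congr rfl fun i _ => ?_
  rw [map_smul]
  change _ = Set.indicator {i | (bars i).Contains s} f.1 i • _
  by_cases ht : (bars i).Contains t
  · rw [M.mapOrZero_of_le _ ht.2, M.map_trans, M.mapOrZero_of_le _ (h.trans ht.2)]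
    by_cases hs : (bars i).Contains s
    · rw [Set.indicator_of_mem (s := {i | (bars i).Contains s}) hs]
    · rw [hzero i s _ (not_lt.1 fun hd => hs ⟨hd, h.trans ht.2⟩), smul_zero, smul_zero]
  · have h0 : f.1 i = 0 := f.2 i ht
    rw [h0, zero_smul]
    by_cases hs : (bars i).Contains s
    · rw [Set.indicator_of_mem (s := {i | (bars i).Contains s}) hs, h0, zero_smul]
    · rw [Set.indicator_of_notMem (s := {i | (bars i).Contains s}) hs, zero_smul]

/-- The barcode of a persistence module that embeds into `M` can be read off in `M`. -/
theorem isBarcode_of_basis_of_injective {M N : PersistenceModule.{u} n}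
    (φ : ∀ j, N.space j →ₗ[ZMod 2] M.space j) (hφ : ∀ j, Function.Injective (φ j))
    (hcomm : ∀ {s t : Fin (n + 1)} (h : s ≤ t) (y : N.space t),
      φ s (N.map h y) = M.map h (φ t y)) {ι : Type} [Fintype ι]
    (bars : ι → Bar n) (hb : ∀ i, (bars i).death < (bars i).birth)
    (x : ∀ i, M.space (bars i).birth)
    (hx : ∀ i, x i ∈ LinearMap.range (φ (bars i).birth))
    (hli : ∀ j, LinearIndependent (ZMod 2)
      (fun i : {i // (bars i).Contains j} => M.map i.2.2 (x i.1)))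
    (hspan : ∀ j, LinearMap.range (φ j) ≤ Submodule.span (ZMod 2)
      (Set.range (fun i : {i // (bars i).Contains j} => M.map i.2.2 (x i.1))))
    (hzero : ∀ i j, (hj : j ≤ (bars i).birth) → j ≤ (bars i).death → M.map hj (x i) = 0) :
    IsBarcode N bars := by
  choose y hy using hx
  have hyx : ∀ j, (fun i : {i // (bars i).Contains j} => M.map i.2.2 (x i.1)) =
      φ j ∘ fun i : {i // (bars i).Contains j} => N.map i.2.2 (y i.1) := by
    intro j
    funext i
    rw [Function.comp_apply, hcomm, hy]
  refine isBarcode_of_basis N bars hb y (fun j => ?_) (fun j => ?_) (fun i j hj hd => ?_)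
  · have h := hli j
    rw [hyx] at h
    exact h.of_comp
  · have h := hspan j
    rw [hyx, Set.range_comp, Submodule.span_image] at h
    intro v _
    obtain ⟨w, hw, hwv⟩ := h ⟨v, rfl⟩
    rwa [← hφ j hwv]
  · apply hφ j
    rw [hcomm, hy, hzero i j hj hd, map_zero]

/-- Whether a family of bars is a barcode does not depend on its enumeration. -/
theorem IsBarcode.congr {M : PersistenceModule.{u} n} {ι κ : Type} [Fintype ι] [Fintype κ]
    {bars : ι → Bar n} {bars' : κ → Bar n} (h : IsBarcode M bars) (e : κ ≃ ι)
    (he : ∀ i, bars' i = bars (e i)) : IsBarcode M bars' := by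
  obtain rfl : bars' = bars ∘ e := funext he
  obtain ⟨hb, ⟨F⟩⟩ := h
  refine ⟨fun i => hb (e i), ⟨⟨fun j => (F.equiv j).trans
    { toFun := fun f => ⟨f.1 ∘ e, fun i hi => f.2 (e i) hi⟩
      invFun := fun f => ⟨f.1 ∘ e.symm, fun i hi => f.2 (e.symm i) (by simpa using hi)⟩
      map_add' := fun f g => rfl
      map_smul' := fun c f => rfl
      left_inv := fun f => Subtype.ext (funext fun i => congrArg f.1 (e.apply_symm_apply i))
      right_inv := fun f =>
        Subtype.ext (funext fun i => congrArg f.1 (e.symm_apply_apply i)) }, ?_⟩⟩⟩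
  intro s t hst x
  refine Subtype.ext (funext fun i => ?_)
  have h := congrArg (fun f => f.1 (e i)) (F.comm hst x)
  exact h

end Barcodes

/-! ### Cohomology classes and cochains -/

section Classes

variable {V : Type u} [LinearOrder V]

theorem cls_eq_zero_iff {K : PreAbstractSimplicialComplex V} (x : ↥(cocycles K)) :
    cls K x = 0 ↔ x.1 ∈ coboundaries K :=
  Submodule.Quotient.mk_eq_zero _

/-- The embedding of the cohomology into the space of all cochains modulo coboundaries. -/
def cohomologyToQuotient (K : PreAbstractSimplicialComplex V) :
    Cohomology K →ₗ[ZMod 2] Cochain V ⧸ coboundaries K :=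
  Submodule.mapQ _ _ (cocycles K).subtype fun _ hx => hx

/-- The subspace of the cohomology of `K` that consists of the classes of the cocycles in `P`. -/
def classesOf (K : PreAbstractSimplicialComplex V) (P : Submodule (ZMod 2) (Cochain V)) :
    Submodule (ZMod 2) (Cohomology K) :=
  (P.submoduleOf (cocycles K)).map (cls K)

theorem cls_mem_classesOf {K : PreAbstractSimplicialComplex V}
    {P : Submodule (ZMod 2) (Cochain V)} {x : Cochain V} (hx : x ∈ cocycles K) (hP : x ∈ P) :
    cls K ⟨x, hx⟩ ∈ classesOf K P :=
  ⟨⟨x, hx⟩, hP, rfl⟩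

/-- The cochains that represent elements of the cup space: the span of the coboundaries and of the
products of homogeneous cocycles of positive degrees. -/
def cupCochains (K : PreAbstractSimplicialComplex V) : Submodule (ZMod 2) (Cochain V) :=
  coboundaries K ⊔ Submodule.span (ZMod 2) {z | ∃ p q x y, x ∈ cocycles K ∧
    x ∈ homogeneous V (p + 1) ∧ y ∈ cocycles K ∧ y ∈ homogeneous V (q + 1) ∧ cup K x y = z}

theorem coboundaries_le_cupCochains (K : PreAbstractSimplicialComplex V) :
    coboundaries K ≤ cupCochains K :=
  le_sup_left

theorem cup_mem_cupCochains {K : PreAbstractSimplicialComplex V} {p q : ℕ} {x y : Cochain V}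
    (hx : x ∈ cocycles K) (hxp : x ∈ homogeneous V (p + 1)) (hy : y ∈ cocycles K)
    (hyq : y ∈ homogeneous V (q + 1)) : cup K x y ∈ cupCochains K :=
  le_sup_right (a := coboundaries K)
    (Submodule.subset_span ⟨p, q, x, y, hx, hxp, hy, hyq, rfl⟩)

theorem cupCochains_le_cocycles (K : PreAbstractSimplicialComplex V) :
    cupCochains K ≤ cocycles K := by
  refine sup_le (coboundaries_le_cocycles K) (Submodule.span_le.2 ?_)
  rintro _ ⟨p, q, x, y, hx, -, hy, -, rfl⟩
  exact cup_mem_cocycles hx hy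

theorem restrict_mem_cupCochains {K L : PreAbstractSimplicialComplex V} (h : L ≤ K)
    {x : Cochain V} (hx : x ∈ cupCochains K) : restrict L x ∈ cupCochains L := by
  have : cupCochains K ≤ (cupCochains L).comap (restrict L) := by
    refine sup_le (fun z hz => coboundaries_le_cupCochains L (restrict_mem_coboundaries h hz))
      (Submodule.span_le.2 ?_)
    rintro _ ⟨p, q, x, y, hx, hxp, hy, hyq, rfl⟩
    change restrict L (cup K x y) ∈ cupCochains L
    rw [← cup_restrict h]
    exact cup_mem_cupCochains (restrict_mem_cocycles h hx) (restrict_mem_homogeneous L hxp)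
      (restrict_mem_cocycles h hy) (restrict_mem_homogeneous L hyq)
  exact this hx

/-- The cup space is defined through tensors of cohomology classes of positive degree; here it is
described by cochains. -/
theorem cupSpace_eq_classesOf (K : PreAbstractSimplicialComplex V) :
    cupSpace K = classesOf K (cupCochains K) := by
  apply le_antisymm
  · rw [cupSpace_eq_map₂, cohomologyPos, Submodule.map₂_iSup_left]
    refine iSup_le fun p => ?_
    rw [Submodule.map₂_iSup_right]
    refine iSup_le fun q => ?_
    rw [Submodule.map₂_le]
    rintro _ ⟨x, hx, rfl⟩ _ ⟨y, hy, rfl⟩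
    rw [cupCohomology_cls]
    exact cls_mem_classesOf _ (cup_mem_cupCochains x.2 hx y.2 hy)
  · rintro _ ⟨⟨z, hz⟩, hzP, rfl⟩
    have : cupCochains K ≤ ((cupSpace K).comap (cls K)).map (cocycles K).subtype := by
      refine sup_le (fun b hb => ?_) (Submodule.span_le.2 ?_)
      · refine ⟨⟨b, coboundaries_le_cocycles K hb⟩, ?_, rfl⟩
        rw [SetLike.mem_coe, Submodule.mem_comap, (cls_eq_zero_iff _).2 hb]
        exact zero_mem _
      · rintro _ ⟨p, q, x, y, hx, hxp, hy, hyq, rfl⟩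
        refine ⟨⟨_, cup_mem_cocycles hx hy⟩, ?_, rfl⟩
        rw [SetLike.mem_coe, Submodule.mem_comap, cupSpace_eq_map₂,
          ← cupCohomology_cls K ⟨x, hx⟩ ⟨y, hy⟩]
        exact Submodule.apply_mem_map₂ _
          ((le_iSup (fun p : ℕ => cohomologyDeg K (p + 1)) p) ⟨⟨x, hx⟩, hxp, rfl⟩)
          ((le_iSup (fun p : ℕ => cohomologyDeg K (p + 1)) q) ⟨⟨y, hy⟩, hyq, rfl⟩)
    obtain ⟨z', hz', rfl⟩ := this hzP
    exact hz'

theorem cupSpaceDeg_eq_classesOf (K : PreAbstractSimplicialComplex V) (p : ℕ) :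
    cupSpaceDeg K p = classesOf K (cupCochains K ⊓ homogeneous V p) := by
  rw [cupSpaceDeg, cupSpace_eq_classesOf]
  apply le_antisymm
  · rintro _ ⟨⟨x, hx, rfl⟩, ⟨y, hy, hxy⟩⟩
    rw [← hxy]
    -- A homogeneous cocycle that is cohomologous to an element of `cupCochains K` lies in it.
    have h : (x - y).1 ∈ coboundaries K := (cls_eq_zero_iff _).1 (by rw [map_sub, hxy, sub_self])
    refine cls_mem_classesOf _ ⟨?_, hy⟩
    have := sub_mem (show x.1 ∈ cupCochains K from hx) (coboundaries_le_cupCochains K h)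
    simpa using this
  · rintro _ ⟨x, hx, rfl⟩
    exact ⟨⟨x, hx.1, rfl⟩, ⟨x, hx.2, rfl⟩⟩

end Classes

section Filtration

variable {V : Type u} [LinearOrder V] {n : ℕ}

/-! ### Bases of cochains modulo coboundaries along a filtration -/

/-- Homogeneous cochains `x i ∈ P b` for the bars `(d, b]` of a family, such that for every `j` the
restrictions to `K_j` of those whose bar contains `j` form a basis of `P j` modulo coboundaries,
whereas they are coboundaries at indices at which their bars have died. -/
structure IsCochainBasis (K : SimplexwiseFiltration V n)
    (P : Fin (n + 1) → Submodule (ZMod 2) (Cochain V)) {ι : Type} (bars : ι → Bar n)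
    (deg : ι → ℕ) (x : ι → Cochain V) : Prop where
  mem : ∀ i, x i ∈ P (bars i).birth
  mem_homogeneous : ∀ i, x i ∈ homogeneous V (deg i)
  linearIndependent : ∀ j, LinearIndependent (ZMod 2)
    (fun i : {i // (bars i).Contains j} =>
      (coboundaries (K.complex j)).mkQ (restrict (K.complex j) (x i.1)))
  le_span : ∀ j, P j ≤ coboundaries (K.complex j) ⊔ Submodule.span (ZMod 2)
    (Set.range fun i : {i // (bars i).Contains j} => restrict (K.complex j) (x i.1))
  eq_zero : ∀ i j, j ≤ (bars i).death → restrict (K.complex j) (x i) ∈ coboundaries (K.complex j)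

namespace IsCochainBasis

variable {K : SimplexwiseFiltration V n} {P : Fin (n + 1) → Submodule (ZMod 2) (Cochain V)}
  {ι : Type} {bars : ι → Bar n} {deg : ι → ℕ} {x : ι → Cochain V}

theorem linearIndependent_cls (h : IsCochainBasis K P bars deg x)
    (hP : ∀ j, P j ≤ cocycles (K.complex j)) (j : Fin (n + 1)) : LinearIndependent (ZMod 2)
      (fun i : {i // (bars i).Contains j} =>
        resCohomology (K.mono i.2.2) (cls _ ⟨x i.1, hP _ (h.mem i.1)⟩)) :=
  LinearIndependent.of_comp (cohomologyToQuotient (K.complex j)) (h.linearIndependent j)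

theorem classesOf_le_span (h : IsCochainBasis K P bars deg x)
    (hP : ∀ j, P j ≤ cocycles (K.complex j)) (j : Fin (n + 1)) :
    classesOf (K.complex j) (P j) ≤ Submodule.span (ZMod 2)
      (Set.range fun i : {i // (bars i).Contains j} =>
        resCohomology (K.mono i.2.2) (cls _ ⟨x i.1, hP _ (h.mem i.1)⟩)) := by
  rintro _ ⟨⟨y, hy⟩, hyP, rfl⟩
  set S := Submodule.span (ZMod 2) (Set.range fun i : {i // (bars i).Contains j} =>
    resCohomology (K.mono i.2.2) (cls _ ⟨x i.1, hP _ (h.mem i.1)⟩)) with hS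
  have : P j ≤ (S.comap (cls (K.complex j))).map (cocycles (K.complex j)).subtype := by
    refine (h.le_span j).trans (sup_le (fun b hb => ?_) (Submodule.span_le.2 ?_))
    · refine ⟨⟨b, coboundaries_le_cocycles _ hb⟩, ?_, rfl⟩
      rw [SetLike.mem_coe, Submodule.mem_comap, (cls_eq_zero_iff _).2 hb]
      exact zero_mem _
    · rintro _ ⟨i, rfl⟩
      refine ⟨⟨_, restrict_mem_cocycles (K.mono i.2.2) (hP _ (h.mem i.1))⟩, ?_, rfl⟩
      exact Submodule.subset_span ⟨i, rfl⟩
  obtain ⟨y', hy', rfl⟩ := this hyP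
  exact hy'

theorem resCohomology_eq_zero (h : IsCochainBasis K P bars deg x)
    (hP : ∀ j, P j ≤ cocycles (K.complex j)) (i : ι) (j : Fin (n + 1)) (hj : j ≤ (bars i).birth)
    (hd : j ≤ (bars i).death) :
    resCohomology (K.mono hj) (cls _ ⟨x i, hP _ (h.mem i)⟩) = 0 :=
  (cls_eq_zero_iff _).2 (h.eq_zero i j hd)

/-- A basis of cochains yields the barcode of every persistence module that embeds into the
cohomology with the classes of the cochains in `P` as its image. -/
theorem isBarcode [Fintype ι] (h : IsCochainBasis K P bars deg x)
    (hP : ∀ j, P j ≤ cocycles (K.complex j)) (hlt : ∀ i, (bars i).death < (bars i).birth)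
    {N : PersistenceModule.{u} n} (φ : ∀ j, N.space j →ₗ[ZMod 2] Cohomology (K.complex j))
    (hφ : ∀ j, Function.Injective (φ j))
    (hcomm : ∀ {s t : Fin (n + 1)} (hst : s ≤ t) (y : N.space t),
      φ s (N.map hst y) = resCohomology (K.mono hst) (φ t y))
    (hrange : ∀ j, LinearMap.range (φ j) = classesOf (K.complex j) (P j)) :
    IsBarcode N bars :=
  isBarcode_of_basis_of_injective (M := cohomologyModule K) φ hφ hcomm bars hlt
    (fun i => cls _ ⟨x i, hP _ (h.mem i)⟩)
    (fun i => (hrange _).ge (cls_mem_classesOf _ (h.mem i)))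
    (h.linearIndependent_cls hP)
    (fun j => (hrange j).le.trans (h.classesOf_le_span hP j))
    (h.resCohomology_eq_zero hP)

theorem isBarcode_sub [Fintype ι] (h : IsCochainBasis K P bars deg x)
    (hP : ∀ j, P j ≤ cocycles (K.complex j)) (hlt : ∀ i, (bars i).death < (bars i).birth)
    {W : ∀ j, Submodule (ZMod 2) (Cohomology (K.complex j))}
    (hW : ∀ {s t : Fin (n + 1)} (h : s ≤ t), ∀ x ∈ W t, (cohomologyModule K).map h x ∈ W s)
    (hWP : ∀ j, W j = classesOf (K.complex j) (P j)) :
    IsBarcode ((cohomologyModule K).sub W hW) bars :=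
  h.isBarcode hP hlt (N := (cohomologyModule K).sub W hW) (fun j => (W j).subtype)
    (fun _ => Subtype.val_injective) (fun _ _ => rfl)
    (fun j => (Submodule.range_subtype _).trans (hWP j))

theorem linearIndependent_comp (h : IsCochainBasis K P bars deg x) {κ : Type} {f : κ → ι}
    (hf : Function.Injective f) (j : Fin (n + 1)) : LinearIndependent (ZMod 2)
      (fun i : {i // (bars (f i)).Contains j} =>
        (coboundaries (K.complex j)).mkQ (restrict (K.complex j) (x (f i.1)))) :=
  (h.linearIndependent j).comp
    (fun i : {i // (bars (f i)).Contains j} => (⟨f i.1, i.2⟩ : {i // (bars i).Contains j}))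
    fun _ _ hab => Subtype.ext (hf (congrArg (fun i => i.1) hab))

theorem comp_equiv (h : IsCochainBasis K P bars deg x) {κ : Type} (e : κ ≃ ι) :
    IsCochainBasis K P (bars ∘ e) (deg ∘ e) (x ∘ e) where
  mem i := h.mem (e i)
  mem_homogeneous i := h.mem_homogeneous (e i)
  linearIndependent := h.linearIndependent_comp e.injective
  le_span j := by
    refine (h.le_span j).trans (sup_le_sup_left (Submodule.span_mono ?_) _)
    rintro _ ⟨i, rfl⟩
    refine ⟨⟨e.symm i.1, ?_⟩, ?_⟩
    · simpa using i.2
    · simp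
  eq_zero i := h.eq_zero (e i)

/-- The empty bars of a family may be left out. -/
theorem subtype_lt (h : IsCochainBasis K P bars deg x) :
    IsCochainBasis K P (fun i : {i // (bars i).death < (bars i).birth} => bars i.1)
      (fun i => deg i.1) (fun i => x i.1) where
  mem i := h.mem i.1
  mem_homogeneous i := h.mem_homogeneous i.1
  linearIndependent := h.linearIndependent_comp Subtype.val_injective
  le_span j := by
    refine (h.le_span j).trans (sup_le_sup_left (Submodule.span_mono ?_) _)
    rintro _ ⟨i, rfl⟩
    exact ⟨⟨⟨i.1, i.2.1.trans_le i.2.2⟩, i.2⟩, rfl⟩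
  eq_zero i := h.eq_zero i.1

/-- Taking components of degree `p` shows that a homogeneous element of `P` is a combination of
the members of the same degree. -/
theorem mem_sup_span_of_homogeneous (h : IsCochainBasis K P bars deg x) {p : ℕ} {j : Fin (n + 1)}
    {y : Cochain V} (hy : y ∈ P j) (hyp : y ∈ homogeneous V p) :
    y ∈ coboundaries (K.complex j) ⊔ Submodule.span (ZMod 2)
      {w | ∃ i, deg i = p ∧ (bars i).Contains j ∧ restrict (K.complex j) (x i) = w} := by
  have hy' := Submodule.mem_map_of_mem (f := homProj V p) (h.le_span j hy)
  rw [homProj_of_mem hyp, Submodule.map_sup, Submodule.map_span] at hy'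
  refine SetLike.le_def.1 (sup_le ?_ (Submodule.span_le.2 ?_)) hy'
  · rintro _ ⟨b, hb, rfl⟩
    exact le_sup_left (a := coboundaries (K.complex j)) (homProj_mem_coboundaries p hb)
  · rintro _ ⟨_, ⟨i, rfl⟩, rfl⟩
    dsimp only
    have hi := restrict_mem_homogeneous (K.complex j) (h.mem_homogeneous i.1)
    by_cases hp : deg i.1 = p
    · rw [homProj_of_mem (hp ▸ hi)]
      exact le_sup_right (a := coboundaries (K.complex j))
        (Submodule.subset_span ⟨i.1, hp, i.2, rfl⟩)
    · rw [homProj_of_mem_of_ne hi (Ne.symm hp)]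
      exact zero_mem _

/-- The members of degree `p` form a basis of the degree `p` part. -/
theorem subtype_deg (h : IsCochainBasis K P bars deg x) (p : ℕ) :
    IsCochainBasis K (fun j => P j ⊓ homogeneous V p) (fun i : {i // deg i = p} => bars i.1)
      (fun i => deg i.1) (fun i => x i.1) where
  mem i := ⟨h.mem i.1, by have := h.mem_homogeneous i.1; rwa [i.2] at this⟩
  mem_homogeneous i := h.mem_homogeneous i.1
  linearIndependent := h.linearIndependent_comp Subtype.val_injective
  le_span j y hy := by
    refine SetLike.le_def.1 (sup_le_sup_left (Submodule.span_mono ?_) _)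
      (h.mem_sup_span_of_homogeneous hy.1 hy.2)
    rintro _ ⟨i, hp, hi, rfl⟩
    exact ⟨⟨⟨i, hp⟩, hi⟩, rfl⟩
  eq_zero i := h.eq_zero i.1

end IsCochainBasis

/-! ### The elder rule -/

/-- The span, modulo coboundaries, of the restrictions to `K_j` of those cochains that live at `j`,
for a set of cochains `e.2` each of which lives at the indices up to `e.1`. -/
def genSpan (K : SimplexwiseFiltration V n) (j : Fin (n + 1))
    (T : Set (Fin (n + 1) × Cochain V)) : Submodule (ZMod 2) (Cochain V) :=
  coboundaries (K.complex j) ⊔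
    Submodule.span (ZMod 2) ((fun e => restrict (K.complex j) e.2) '' {e | e ∈ T ∧ j ≤ e.1})

section genSpan

variable {K : SimplexwiseFiltration V n}

theorem coboundaries_le_genSpan (j : Fin (n + 1)) (T : Set (Fin (n + 1) × Cochain V)) :
    coboundaries (K.complex j) ≤ genSpan K j T :=
  le_sup_left

theorem restrict_mem_genSpan_of_mem {j : Fin (n + 1)} {T : Set (Fin (n + 1) × Cochain V)}
    {e : Fin (n + 1) × Cochain V} (he : e ∈ T) (hj : j ≤ e.1) :
    restrict (K.complex j) e.2 ∈ genSpan K j T :=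
  le_sup_right (a := coboundaries (K.complex j)) (Submodule.subset_span ⟨e, ⟨he, hj⟩, rfl⟩)

theorem genSpan_le {j : Fin (n + 1)} {T : Set (Fin (n + 1) × Cochain V)}
    {W : Submodule (ZMod 2) (Cochain V)} (hB : coboundaries (K.complex j) ≤ W)
    (h : ∀ e ∈ T, j ≤ e.1 → restrict (K.complex j) e.2 ∈ W) : genSpan K j T ≤ W := by
  refine sup_le hB (Submodule.span_le.2 ?_)
  rintro _ ⟨e, ⟨he, hj⟩, rfl⟩
  exact h e he hj

theorem genSpan_mono (j : Fin (n + 1)) {T T' : Set (Fin (n + 1) × Cochain V)} (h : T ⊆ T') :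
    genSpan K j T ≤ genSpan K j T' :=
  genSpan_le (coboundaries_le_genSpan j T') fun _ he hj => restrict_mem_genSpan_of_mem (h he) hj

theorem restrict_mem_genSpan {k j : Fin (n + 1)} (hkj : k ≤ j)
    {T : Set (Fin (n + 1) × Cochain V)} {x : Cochain V} (hx : x ∈ genSpan K j T) :
    restrict (K.complex k) x ∈ genSpan K k T := by
  have : genSpan K j T ≤ (genSpan K k T).comap (restrict (K.complex k)) := by
    refine genSpan_le (fun b hb => coboundaries_le_genSpan k T
      (restrict_mem_coboundaries (K.mono hkj) hb)) fun e he hj => ?_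
    rw [Submodule.mem_comap, restrict_restrict (K.mono hkj)]
    exact restrict_mem_genSpan_of_mem he (hkj.trans hj)
  exact this hx

end genSpan

/-- The elder rule.  Let homogeneous cochains `z i` of `P`, each living up to the birth of the
`i`-th bar and ordered by decreasing births, span `P` at every index, and let the death of the
`i`-th bar be the largest index at which `z i` depends on the preceding cochains.  Then a relation
at the death turns `z i` into a cochain that dies with the bar, and these cochains form a
basis. -/
theorem exists_isCochainBasis {K : SimplexwiseFiltration V n}
    {P : Fin (n + 1) → Submodule (ZMod 2) (Cochain V)}
    (hPres : ∀ {k j : Fin (n + 1)}, k ≤ j → ∀ y ∈ P j, restrict (K.complex k) y ∈ P k)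
    {ι Λ : Type} [Finite ι] [LinearOrder Λ] {σ : ι → Λ} (hσ : Function.Injective σ)
    {bars : ι → Bar n} {deg : ι → ℕ} {z : ι → Cochain V}
    (hz : ∀ i, z i ∈ P (bars i).birth) (hdeg : ∀ i, z i ∈ homogeneous V (deg i))
    (hanti : ∀ i l, σ l < σ i → (bars i).birth ≤ (bars l).birth)
    (hle : ∀ i, (bars i).death ≤ (bars i).birth)
    (hdead : ∀ i, restrict (K.complex (bars i).death) (z i) ∈
      genSpan K (bars i).death {e | ∃ l, σ l < σ i ∧ ((bars l).birth, z l) = e})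
    (halive : ∀ i j, (bars i).Contains j → restrict (K.complex j) (z i) ∉
      genSpan K j {e | ∃ l, σ l < σ i ∧ ((bars l).birth, z l) = e})
    (hspan : ∀ j, P j ≤ genSpan K j {e | ∃ l, ((bars l).birth, z l) = e}) :
    ∃ x, IsCochainBasis K P bars deg x := by
  classical
  -- `w i` is a combination of earlier cochains that agrees with `z i` at the death of the bar.
  have hw : ∀ i, ∃ w ∈ Submodule.span (ZMod 2) (z '' {l | σ l < σ i}),
      w ∈ homogeneous V (deg i) ∧ restrict (K.complex (bars i).death) (z i - w) ∈
        coboundaries (K.complex (bars i).death) := by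
    intro i
    obtain ⟨b, hb, y, hy, hby⟩ := Submodule.mem_sup.1 (hdead i)
    have hy' : y ∈ (Submodule.span (ZMod 2) (z '' {l | σ l < σ i})).map
        (restrict (K.complex (bars i).death)) := by
      refine (Submodule.span_le.2 ?_ : _ ≤ _) hy
      rintro _ ⟨_, ⟨⟨l, hl, rfl⟩, -⟩, rfl⟩
      exact Submodule.mem_map_of_mem (Submodule.subset_span ⟨l, hl, rfl⟩)
    obtain ⟨w, hw, rfl⟩ := hy'
    refine ⟨homProj V (deg i) w, ?_, homProj_mem _ _, ?_⟩
    · have : Submodule.span (ZMod 2) (z '' {l | σ l < σ i}) ≤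
          (Submodule.span (ZMod 2) (z '' {l | σ l < σ i})).comap (homProj V (deg i)) := by
        rw [Submodule.span_le]
        rintro _ ⟨l, hl, rfl⟩
        rw [SetLike.mem_coe, Submodule.mem_comap]
        by_cases h : deg i = deg l
        · rw [h, homProj_of_mem (hdeg l)]
          exact Submodule.subset_span ⟨l, hl, rfl⟩
        · rw [homProj_of_mem_of_ne (hdeg l) h]
          exact zero_mem _
      exact this hw
    · have h : homProj V (deg i) b = restrict (K.complex (bars i).death)
          (z i - homProj V (deg i) w) := by
        rw [eq_sub_of_add_eq hby, map_sub, homProj_restrict, homProj_restrict,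
          homProj_of_mem (hdeg i), map_sub]
      rw [← h]
      exact homProj_mem_coboundaries _ hb
  choose w hwspan hwdeg hwd using hw
  have hdiff : ∀ i j, j ≤ (bars i).birth →
      restrict (K.complex j) (restrict (K.complex (bars i).birth) (z i - w i)) -
        restrict (K.complex j) (z i) ∈
      Submodule.span (ZMod 2) ((fun l => restrict (K.complex j) (z l)) '' {l | σ l < σ i}) := by
    intro i j hj
    rw [restrict_restrict (K.mono hj), map_sub, sub_sub_cancel_left]
    refine neg_mem ?_
    have h := Submodule.mem_map_of_mem (f := restrict (K.complex j)) (hwspan i)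
    rwa [Submodule.map_span, Set.image_image] at h
  have hquot : ∀ j (S : Set ι) (y : Cochain V),
      (coboundaries (K.complex j)).mkQ y ∈ Submodule.span (ZMod 2)
        ((fun l => (coboundaries (K.complex j)).mkQ (restrict (K.complex j) (z l))) '' S) ↔
      y ∈ coboundaries (K.complex j) ⊔
        Submodule.span (ZMod 2) ((fun l => restrict (K.complex j) (z l)) '' S) := by
    intro j S y
    rw [← Set.image_image (g := (coboundaries (K.complex j)).mkQ), ← Submodule.map_span,
      ← Submodule.mem_comap, Submodule.comap_map_mkQ]
  have hgen : ∀ i j, j ≤ (bars i).birth →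
      genSpan K j {e | ∃ l, σ l < σ i ∧ ((bars l).birth, z l) = e} =
        coboundaries (K.complex j) ⊔
          Submodule.span (ZMod 2) ((fun l => restrict (K.complex j) (z l)) '' {l | σ l < σ i}) := by
    intro i j hj
    unfold genSpan
    congr 2
    ext y
    constructor
    · rintro ⟨_, ⟨⟨l, hl, rfl⟩, -⟩, rfl⟩
      exact ⟨l, hl, rfl⟩
    · rintro ⟨l, hl, rfl⟩
      exact ⟨_, ⟨⟨l, hl, rfl⟩, hj.trans (hanti i l hl)⟩, rfl⟩
  refine ⟨fun i => restrict (K.complex (bars i).birth) (z i - w i), ⟨fun i => ?_, fun i => ?_,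
    fun j => ?_, fun j => ?_, fun i j hj => ?_⟩⟩
  · rw [map_sub]
    refine sub_mem (hPres le_rfl _ (hz i)) ?_
    have : Submodule.span (ZMod 2) (z '' {l | σ l < σ i}) ≤
        (P (bars i).birth).comap (restrict (K.complex (bars i).birth)) := by
      rw [Submodule.span_le]
      rintro _ ⟨l, hl, rfl⟩
      exact hPres (hanti i l hl) _ (hz l)
    exact this (hwspan i)
  · exact restrict_mem_homogeneous _ (sub_mem (hdeg i) (hwdeg i))
  · refine linearIndependent_of_triangular (R := ZMod 2) (s := {i | (bars i).Contains j}) hσ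
      (x := fun i => (coboundaries (K.complex j)).mkQ (restrict (K.complex j)
        (restrict (K.complex (bars i).birth) (z i - w i))))
      (z := fun i => (coboundaries (K.complex j)).mkQ (restrict (K.complex j) (z i))) ?_ ?_
    · intro i hi
      rw [← map_sub, hquot]
      exact le_sup_right (a := coboundaries (K.complex j)) (hdiff i j hi.2)
    · intro i hi
      rw [hquot, ← hgen i j hi.2]
      exact halive i j hi
  · have h := span_le_span_of_triangular (R := ZMod 2) (s := {i | (bars i).Contains j})
      (t := {i | j ≤ (bars i).birth}) (σ := σ)
      (x := fun i => (coboundaries (K.complex j)).mkQ (restrict (K.complex j)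
        (restrict (K.complex (bars i).birth) (z i - w i))))
      (z := fun i => (coboundaries (K.complex j)).mkQ (restrict (K.complex j) (z i)))
      (fun i hi l hl => le_trans hi (hanti i l hl)) ?_ ?_
    · intro y hy
      have h1 : (coboundaries (K.complex j)).mkQ y ∈ Submodule.span (ZMod 2)
          ((fun l => (coboundaries (K.complex j)).mkQ (restrict (K.complex j) (z l))) ''
            {i | j ≤ (bars i).birth}) := by
        rw [hquot]
        refine genSpan_le le_sup_left ?_ (hspan j hy)
        rintro _ ⟨l, rfl⟩ hl
        exact le_sup_right (a := coboundaries (K.complex j)) (Submodule.subset_span ⟨l, hl, rfl⟩)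
      have h2 := h h1
      rw [← Set.image_image (g := (coboundaries (K.complex j)).mkQ), ← Submodule.map_span,
        ← Submodule.mem_comap, Submodule.comap_map_mkQ] at h2
      refine SetLike.le_def.1 (sup_le_sup_left (Submodule.span_mono ?_) _) h2
      rintro _ ⟨i, hi, rfl⟩
      exact ⟨⟨i, hi⟩, rfl⟩
    · intro i hi
      rw [← map_sub, hquot]
      exact le_sup_right (a := coboundaries (K.complex j)) (hdiff i j hi.2)
    · intro i hi hn
      have hj : j ≤ (bars i).death := not_lt.1 fun hd => hn ⟨hd, hi⟩
      rw [hquot, ← hgen i j hi, ← restrict_restrict (K.mono hj)]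
      exact restrict_mem_genSpan hj (hdead i)
  · rw [restrict_restrict (K.mono (hj.trans (hle i))), ← restrict_restrict (K.mono hj)]
    exact restrict_mem_coboundaries (K.mono hj) (hwd i)

end Filtration

/-! ### Persistent cohomology bases -/

section Existence

variable {V : Type u} [LinearOrder V] {n : ℕ} (K : SimplexwiseFiltration V n)

theorem mem_faces_iff (j : Fin (n + 1)) (τ : Finset V) :
    τ ∈ (K.complex j).faces ↔ ∃ i : Fin n, i.castSucc < j ∧ K.simplex i = τ := by
  induction j using Fin.induction with
  | zero =>
    rw [K.complex_zero]
    constructor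
    · intro h
      exact absurd h (Set.notMem_empty τ)
    · rintro ⟨i, hi, -⟩
      exact absurd hi (Fin.not_lt_zero _)
  | succ j ih =>
    rw [K.complex_succ, Set.mem_insert_iff, ih]
    constructor
    · rintro (rfl | ⟨i, hi, rfl⟩)
      · exact ⟨j, Fin.castSucc_lt_succ, rfl⟩
      · exact ⟨i, hi.trans Fin.castSucc_lt_succ, rfl⟩
    · rintro ⟨i, hi, rfl⟩
      rcases (Fin.castSucc_lt_succ_iff.1 hi).lt_or_eq with h | rfl
      · exact Or.inr ⟨i, Fin.castSucc_lt_castSucc_iff.2 h, rfl⟩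
      · exact Or.inl rfl

theorem cochains_zero_eq_bot : cochains (K.complex 0) = ⊥ := by
  rw [eq_bot_iff]
  intro x hx
  refine funext fun τ => hx τ fun h => ?_
  obtain ⟨i, hi, -⟩ := (mem_faces_iff K 0 τ).1 h
  exact absurd hi (Fin.not_lt_zero _)

/-- An upper bound for the numbers of vertices of the simplices. -/
def cardBound : ℕ := Finset.univ.sup fun i : Fin n => (K.simplex i).card

theorem sum_homProj {j : Fin (n + 1)} {x : Cochain V} (hx : x ∈ cochains (K.complex j)) :
    ∑ p ∈ Finset.range (cardBound K), homProj V p x = x := by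
  funext τ
  rw [Finset.sum_apply]
  simp only [homProj_apply]
  by_cases hτ : τ ∈ (K.complex j).faces
  · obtain ⟨i, -, rfl⟩ := (mem_faces_iff K j τ).1 hτ
    have h1 : (K.simplex i).card ≤ cardBound K :=
      Finset.le_sup (f := fun i => (K.simplex i).card) (Finset.mem_univ i)
    have h2 : 0 < (K.simplex i).card := Finset.card_pos.2 ((K.complex j).isRelLowerSet_faces hτ).1
    rw [Finset.sum_eq_single ((K.simplex i).card - 1)]
    · rw [if_pos (by omega)]
    · intro p _ hp
      rw [if_neg (by omega)]
    · intro h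
      rw [Finset.mem_range] at h
      omega
  · simp [hx τ hτ]

instance finite_cochains (j : Fin (n + 1)) : Finite ↥(cochains (K.complex j)) := by
  refine Finite.of_injective (fun x (i : Fin n) => x.1 (K.simplex i)) fun x y hxy => ?_
  refine Subtype.ext (funext fun τ => ?_)
  by_cases hτ : τ ∈ (K.complex j).faces
  · obtain ⟨i, -, rfl⟩ := (mem_faces_iff K j τ).1 hτ
    exact congrFun hxy i
  · rw [x.2 τ hτ, y.2 τ hτ]

instance finite_cocycles (j : Fin (n + 1)) (p : ℕ) :
    Finite ↥(cocycles (K.complex j) ⊓ homogeneous V p) :=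
  Finite.of_injective (fun x => (⟨x.1, x.2.1.1⟩ : ↥(cochains (K.complex j)))) fun _ _ hxy =>
    Subtype.ext (congrArg (fun x => x.1) hxy)

/-- The elder rule, applied to all homogeneous cocycles of all complexes of the filtration. -/
theorem exists_isCochainBasis_cocycles : ∃ (ι : Type) (_ : Finite ι) (bars : ι → Bar n)
    (deg : ι → ℕ) (x : ι → Cochain V), (∀ i, (bars i).death < (bars i).birth) ∧
      IsCochainBasis K (fun j => cocycles (K.complex j)) bars deg x := by
  classical
  let J := Σ b : Fin (n + 1), Σ p : Fin (cardBound K),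
    ↥(cocycles (K.complex b) ⊓ homogeneous V p)
  obtain ⟨N, ⟨e⟩⟩ := Finite.exists_equiv_fin J
  let b : Fin N → Fin (n + 1) := fun i => (e.symm i).1
  let deg : Fin N → ℕ := fun i => (e.symm i).2.1
  let z : Fin N → Cochain V := fun i => (e.symm i).2.2.1
  -- Sort by decreasing births; cochains with equal births may come in any order.
  let σ : Fin N → (Fin (n + 1))ᵒᵈ ×ₗ Fin N := fun i => toLex (OrderDual.toDual (b i), i)
  have hσ : Function.Injective σ := fun i l h => congrArg (fun a => (ofLex a).2) h
  have hz : ∀ i, z i ∈ cocycles (K.complex (b i)) := fun i => (e.symm i).2.2.2.1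
  have hdeg : ∀ i, z i ∈ homogeneous V (deg i) := fun i => (e.symm i).2.2.2.2
  -- The death is the largest index at which `z i` depends on the earlier cochains; the complex at
  -- the index `0` is empty, so there is such an index.
  have hd : ∀ i, ∃ d ≤ b i, restrict (K.complex d) (z i) ∈
      genSpan K d {e | ∃ l, σ l < σ i ∧ (b l, z l) = e} ∧
      ∀ j ≤ b i, restrict (K.complex j) (z i) ∈
        genSpan K j {e | ∃ l, σ l < σ i ∧ (b l, z l) = e} → j ≤ d := by
    intro i
    obtain ⟨d, hd, hmax⟩ := Finset.exists_max_image (Finset.univ.filter fun j => j ≤ b i ∧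
      restrict (K.complex j) (z i) ∈ genSpan K j {e | ∃ l, σ l < σ i ∧ (b l, z l) = e}) id
      ⟨0, by
        refine Finset.mem_filter.2 ⟨Finset.mem_univ _, Fin.zero_le _, ?_⟩
        have h := restrict_mem_cochains (K.complex 0) (z i)
        rw [cochains_zero_eq_bot, Submodule.mem_bot] at h
        rw [h]
        exact zero_mem _⟩
    rw [Finset.mem_filter] at hd
    exact ⟨d, hd.2.1, hd.2.2, fun j hj h => hmax j (Finset.mem_filter.2 ⟨Finset.mem_univ _, hj, h⟩)⟩
  choose d hdb hdead hmax using hd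
  obtain ⟨x, hx⟩ : ∃ x, IsCochainBasis K (fun j => cocycles (K.complex j))
      (fun i => (⟨d i, b i⟩ : Bar n)) deg x := by
    refine exists_isCochainBasis (fun hkj y hy => restrict_mem_cocycles (K.mono hkj) hy)
      hσ hz hdeg ?_ hdb hdead ?_ ?_
    · intro i l hil
      rcases Prod.Lex.lt_iff.1 hil with h | h
      · exact le_of_lt h
      · exact le_of_eq (congrArg OrderDual.ofDual h.1).symm
    · intro i j hj hmem
      exact absurd (hmax i j hj.2 hmem) (not_le.2 hj.1)
    · intro j y hy
      rw [← sum_homProj K hy.1]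
      refine Submodule.sum_mem _ fun p hp => ?_
      let a : J := ⟨j, ⟨p, Finset.mem_range.1 hp⟩,
        ⟨homProj V p y, homProj_mem_cocycles p hy, homProj_mem p y⟩⟩
      have ha : (b (e a), z (e a)) = (j, homProj V p y) :=
        congrArg (fun a : J => (a.1, (a.2.2.1 : Cochain V))) (e.symm_apply_apply a)
      have h := restrict_mem_genSpan_of_mem (K := K) (j := j) (e := (j, homProj V p y))
        (T := {e | ∃ l, (b l, z l) = e}) ⟨e a, ha⟩ le_rfl
      rwa [restrict_eq_self (homProj_mem_cochains p hy.1)] at h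
  -- A cochain that depends on earlier ones already at its birth has an empty bar.
  exact ⟨_, inferInstance, _, _, _, fun i => i.2, hx.subtype_lt⟩

/-- A finite filtration has a persistent cohomology basis. -/
theorem nonempty_persistentCohomologyBasis : Nonempty (PersistentCohomologyBasis K) := by
  classical
  obtain ⟨ι, _, bars, deg, x, hlt, hx⟩ := exists_isCochainBasis_cocycles K
  obtain ⟨N, ⟨e⟩⟩ := Finite.exists_equiv_fin ι
  have h := hx.comp_equiv e.symm
  have htop : ∀ j, classesOf (K.complex j) (cocycles (K.complex j)) = ⊤ := by
    intro j
    rw [classesOf, Submodule.submoduleOf_self, Submodule.map_top, LinearMap.range_eq_top]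
    exact cls_surjective _
  exact ⟨{
    size := N
    bar := bars ∘ e.symm
    isBarcode := h.isBarcode (fun _ => le_rfl) (fun i => hlt _) (N := cohomologyModule K)
      (fun j => LinearMap.id) (fun j => Function.injective_id) (fun _ _ => rfl)
      (fun j => LinearMap.range_id.trans (htop j).symm)
    deg := deg ∘ e.symm
    rep := fun i => ⟨x (e.symm i), h.mem i⟩
    rep_deg := h.mem_homogeneous
    linearIndependent := h.linearIndependent_cls fun _ => le_rfl
    span_eq_top := fun j => top_le_iff.1
      ((htop j).ge.trans (h.classesOf_le_span (fun _ => le_rfl) j))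
    eq_zero := fun i j hj hd => h.resCohomology_eq_zero (fun _ => le_rfl) i j hj hd }⟩

variable {K}

/-- The representatives of a persistent cohomology basis are a basis of all cocycles modulo
coboundaries. -/
theorem PersistentCohomologyBasis.isCochainBasis (Ω : PersistentCohomologyBasis K) :
    IsCochainBasis K (fun j => cocycles (K.complex j)) Ω.bar Ω.deg (fun i => (Ω.rep i).1) where
  mem i := (Ω.rep i).2
  mem_homogeneous := Ω.rep_deg
  linearIndependent j := by
    refine (Ω.linearIndependent j).map' (cohomologyToQuotient (K.complex j)) ?_
    rw [LinearMap.ker_eq_bot']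
    intro a ha
    obtain ⟨y, rfl⟩ := cls_surjective _ a
    exact (cls_eq_zero_iff y).2 ((Submodule.Quotient.mk_eq_zero _).1 ha)
  le_span j y hy := by
    have h : cls _ ⟨y, hy⟩ ∈ Submodule.span (ZMod 2) (Set.range
        (fun i : {i // (Ω.bar i).Contains j} =>
          resCohomology (K.mono i.2.2) (cls _ (Ω.rep i.1)))) := by
      rw [Ω.span_eq_top]
      exact Submodule.mem_top
    have h' := Submodule.mem_map_of_mem (f := cohomologyToQuotient (K.complex j)) h
    rw [Submodule.map_span, ← Set.range_comp] at h'
    have h2 : (coboundaries (K.complex j)).mkQ y ∈ Submodule.map (coboundaries (K.complex j)).mkQ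
        (Submodule.span (ZMod 2) (Set.range fun i : {i // (Ω.bar i).Contains j} =>
          restrict (K.complex j) (Ω.rep i.1).1)) := by
      rw [Submodule.map_span, ← Set.range_comp]
      exact h'
    rwa [← Submodule.mem_comap, Submodule.comap_map_mkQ] at h2
  eq_zero i j hd := by
    have hlt := (Ω.isBarcode.1 i).le
    exact (cls_eq_zero_iff _).1 (Ω.eq_zero i j (hd.trans hlt) hd)

end Existence

namespace CupPers

variable {V : Type u} [LinearOrder V] {n : ℕ}

/-! ### Left-to-right column additions and reduced matrices -/

/-- The span of the first `m` columns of a matrix. -/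
def prefixSpan (S : List (Column V n)) (m : ℕ) : Submodule (ZMod 2) (Cochain V) :=
  Submodule.span (ZMod 2) {x | ∃ l c, l < m ∧ S[l]? = some c ∧ c.vec = x}

theorem vec_mem_prefixSpan {S : List (Column V n)} {m l : ℕ} {c : Column V n} (hl : l < m)
    (hc : S[l]? = some c) : c.vec ∈ prefixSpan S m :=
  Submodule.subset_span ⟨l, c, hl, hc, rfl⟩

theorem prefixSpan_le {S : List (Column V n)} {m : ℕ} {W : Submodule (ZMod 2) (Cochain V)}
    (h : ∀ l c, l < m → S[l]? = some c → c.vec ∈ W) : prefixSpan S m ≤ W := by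
  refine Submodule.span_le.2 ?_
  rintro _ ⟨l, c, hl, hc, rfl⟩
  exact h l c hl hc

/-- The matrix `S'` arises from `S` by changing every column by a combination of the columns to its
left, without any change of the annotations. -/
structure Unitriangular (S S' : List (Column V n)) : Prop where
  length_eq : S'.length = S.length
  annotation_eq : ∀ {l : ℕ} {c c' : Column V n}, S[l]? = some c → S'[l]? = some c' →
    c'.annotation = c.annotation
  sub_mem : ∀ {l : ℕ} {c c' : Column V n}, S[l]? = some c → S'[l]? = some c' →
    c'.vec - c.vec ∈ prefixSpan S l
  prefixSpan_eq : ∀ m, prefixSpan S' m = prefixSpan S m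

theorem Unitriangular.refl (S : List (Column V n)) : Unitriangular S S where
  length_eq := rfl
  annotation_eq h h' := by rw [h] at h'; rw [Option.some.inj h']
  sub_mem h h' := by
    rw [h] at h'
    rw [Option.some.inj h', sub_self]
    exact zero_mem _
  prefixSpan_eq _ := rfl

theorem Unitriangular.trans {S S' S'' : List (Column V n)} (h : Unitriangular S S')
    (h' : Unitriangular S' S'') : Unitriangular S S'' := by
  have key : ∀ {l : ℕ} {c : Column V n}, S[l]? = some c → ∃ c', S'[l]? = some c' := by
    intro l c hc
    have hl : l < S'.length := by
      rw [h.length_eq]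
      exact (List.getElem?_eq_some_iff.1 hc).1
    exact ⟨_, List.getElem?_eq_getElem hl⟩
  refine ⟨h'.length_eq.trans h.length_eq, fun hc hc'' => ?_, fun {l} _ _ hc hc'' => ?_,
    fun m => (h'.prefixSpan_eq m).trans (h.prefixSpan_eq m)⟩
  · obtain ⟨c', hc'⟩ := key hc
    exact (h'.annotation_eq hc' hc'').trans (h.annotation_eq hc hc')
  · obtain ⟨c', hc'⟩ := key hc
    have h1 := h'.sub_mem hc' hc''
    rw [h.prefixSpan_eq] at h1
    have h2 := add_mem h1 (h.sub_mem hc hc')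
    rwa [sub_add_sub_cancel] at h2

theorem ColumnAddition.unitriangular {S S' : List (Column V n)} (h : ColumnAddition S S') :
    Unitriangular S S' := by
  obtain ⟨i, j, hij, hj, rfl⟩ := h
  have hi := hij.trans hj
  set d : Column V n := ⟨S[j].vec + S[i].vec, S[j].annotation⟩ with hd
  have hne : ∀ l, l ≠ j → (S.set j d)[l]? = S[l]? := fun l hl =>
    List.getElem?_set_ne (Ne.symm hl)
  have heq : (S.set j d)[j]? = some d := List.getElem?_set_self hj
  have hSi : S[i]? = some S[i] := List.getElem?_eq_getElem hi
  have hSj : S[j]? = some S[j] := List.getElem?_eq_getElem hj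
  refine ⟨List.length_set, fun {l} c c' hc hc' => ?_, fun {l} c c' hc hc' => ?_, fun m => ?_⟩
  · by_cases hl : l = j
    · subst hl
      rw [← Option.some.inj (heq.symm.trans hc'), ← Option.some.inj (hSj.symm.trans hc)]
    · rw [hne l hl, hc] at hc'
      rw [Option.some.inj hc']
  · by_cases hl : l = j
    · subst hl
      rw [← Option.some.inj (heq.symm.trans hc'), ← Option.some.inj (hSj.symm.trans hc), hd,
        add_sub_cancel_left]
      exact vec_mem_prefixSpan hij hSi
    · rw [hne l hl, hc] at hc'
      rw [Option.some.inj hc', sub_self]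
      exact zero_mem _
  · apply le_antisymm
    · refine prefixSpan_le fun l c hl hc => ?_
      by_cases hlj : l = j
      · subst hlj
        rw [← Option.some.inj (heq.symm.trans hc)]
        exact add_mem (vec_mem_prefixSpan hl hSj) (vec_mem_prefixSpan (hij.trans hl) hSi)
      · rw [hne l hlj] at hc
        exact vec_mem_prefixSpan hl hc
    · refine prefixSpan_le fun l c hl hc => ?_
      by_cases hlj : l = j
      · subst hlj
        have h1 := vec_mem_prefixSpan hl heq
        have h2 := vec_mem_prefixSpan (hij.trans hl) ((hne i hij.ne).trans hSi)
        have h3 := sub_mem h1 h2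
        rw [hd, add_sub_cancel_right] at h3
        rwa [← Option.some.inj (hSj.symm.trans hc)]
      · rw [← hne l hlj] at hc
        exact vec_mem_prefixSpan hl hc

theorem unitriangular_of_reflTransGen {S S' : List (Column V n)}
    (h : Relation.ReflTransGen ColumnAddition S S') : Unitriangular S S' := by
  induction h with
  | refl => exact Unitriangular.refl S
  | tail _ h ih => exact ih.trans h.unitriangular

section Low

variable (K : SimplexwiseFiltration V n)

theorem le_low {x : Cochain V} {i : Fin n} (h : x (K.simplex i) ≠ 0) :
    (i : WithBot (Fin n)) ≤ low K x :=
  Finset.le_max (Finset.mem_filter.2 ⟨Finset.mem_univ _, h⟩)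

theorem apply_ne_zero_of_low_eq {x : Cochain V} {i : Fin n} (h : low K x = i) :
    x (K.simplex i) ≠ 0 :=
  (Finset.mem_filter.1 (Finset.mem_of_max h)).2

theorem low_le {x : Cochain V} {b : WithBot (Fin n)}
    (h : ∀ i : Fin n, x (K.simplex i) ≠ 0 → (i : WithBot (Fin n)) ≤ b) : low K x ≤ b :=
  Finset.max_le fun i hi => h i (Finset.mem_filter.1 hi).2

theorem low_add_of_lt {x y : Cochain V} (h : low K x < low K y) :
    low K (x + y) = low K y := by
  apply le_antisymm
  · refine low_le K fun i hi => ?_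
    by_cases hx : x (K.simplex i) = 0
    · refine le_low K fun hy => hi ?_
      rw [Pi.add_apply, hx, hy, add_zero]
    · exact (le_low K hx).trans h.le
  · obtain ⟨i, hi⟩ := WithBot.ne_bot_iff_exists.1 (bot_le.trans_lt h).ne'
    rw [← hi]
    have hx : x (K.simplex i) = 0 := by
      by_contra hx
      exact absurd (le_low K hx) (not_le.2 (hi ▸ h))
    refine le_low K ?_
    rw [Pi.add_apply, hx, zero_add]
    exact apply_ne_zero_of_low_eq K hi.symm

theorem low_add_of_ne {x y : Cochain V} (h : low K x ≠ low K y) :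
    low K (x + y) = low K x ∨ low K (x + y) = low K y := by
  rcases lt_or_gt_of_ne h with h | h
  · exact Or.inr (low_add_of_lt K h)
  · rw [add_comm]
    exact Or.inl (low_add_of_lt K h)

variable {K}

/-- In a reduced matrix the lowest entries of the columns cannot cancel in a combination, so one of
them survives. -/
theorem eq_zero_or_low_eq_of_mem_prefixSpan {S : List (Column V n)} (hS : IsReduced K S) (m : ℕ)
    {x : Cochain V} (hx : x ∈ prefixSpan S m) :
    x = 0 ∨ ∃ l c, l < m ∧ S[l]? = some c ∧ c.vec ≠ 0 ∧ low K x = low K c.vec := by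
  induction m generalizing x with
  | zero =>
    left
    have h : prefixSpan S 0 ≤ ⊥ := prefixSpan_le fun l c hl => absurd hl (Nat.not_lt_zero l)
    exact (Submodule.mem_bot _).1 (h hx)
  | succ m ih =>
    have hstep : x ∈ prefixSpan S m ∨
        ∃ c w, S[m]? = some c ∧ w ∈ prefixSpan S m ∧ x = w + c.vec := by
      rcases hm : S[m]? with _ | c
      · left
        refine (prefixSpan_le fun l c hl hc => ?_ : prefixSpan S (m + 1) ≤ _) hx
        rcases (Nat.lt_succ_iff.1 hl).lt_or_eq with h | rfl
        · exact vec_mem_prefixSpan h hc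
        · rw [hm] at hc
          cases hc
      · have h : prefixSpan S (m + 1) ≤ prefixSpan S m ⊔ Submodule.span (ZMod 2) {c.vec} := by
          refine prefixSpan_le fun l d hl hd => ?_
          rcases (Nat.lt_succ_iff.1 hl).lt_or_eq with h | rfl
          · exact Submodule.mem_sup_left (vec_mem_prefixSpan h hd)
          · rw [hm] at hd
            rw [← Option.some.inj hd]
            exact Submodule.mem_sup_right (Submodule.mem_span_singleton_self _)
        obtain ⟨w, hw, v, hv, rfl⟩ := Submodule.mem_sup.1 (h hx)
        obtain ⟨a, rfl⟩ := Submodule.mem_span_singleton.1 hv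
        rcases (by decide : ∀ a : ZMod 2, a = 0 ∨ a = 1) a with rfl | rfl
        · left
          rwa [zero_smul, add_zero]
        · exact Or.inr ⟨c, w, rfl, hw, by rw [one_smul]⟩
    rcases hstep with h | ⟨c, w, hc, hw, rfl⟩
    · rcases ih h with h | ⟨l, c, hl, h⟩
      · exact Or.inl h
      · exact Or.inr ⟨l, c, hl.trans (Nat.lt_succ_self m), h⟩
    · by_cases hc0 : c.vec = 0
      · rw [hc0, add_zero]
        rcases ih hw with h | ⟨l, c, hl, h⟩
        · exact Or.inl h
        · exact Or.inr ⟨l, c, hl.trans (Nat.lt_succ_self m), h⟩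
      · right
        rcases ih hw with rfl | ⟨l, d, hl, hd, hd0, hlow⟩
        · exact ⟨m, c, Nat.lt_succ_self m, hc, hc0, by rw [zero_add]⟩
        · have hne : low K w ≠ low K c.vec := by
            rw [hlow]
            obtain ⟨hl', rfl⟩ := List.getElem?_eq_some_iff.1 hd
            obtain ⟨hm', rfl⟩ := List.getElem?_eq_some_iff.1 hc
            exact List.pairwise_iff_getElem.1 hS l m hl' hm' hl hd0 hc0
          rcases low_add_of_ne K hne with h | h
          · exact ⟨l, d, hl.trans (Nat.lt_succ_self m), hd, hd0, h.trans hlow⟩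
          · exact ⟨m, c, Nat.lt_succ_self m, hc, hc0, h⟩

/-- In a reduced matrix the nonzero columns are independent of the columns to their left. -/
theorem IsReduced.eq_zero_of_mem_prefixSpan {S : List (Column V n)} (hS : IsReduced K S) {m : ℕ}
    {c : Column V n} (hc : S[m]? = some c) (hmem : c.vec ∈ prefixSpan S m) : c.vec = 0 := by
  rcases eq_zero_or_low_eq_of_mem_prefixSpan hS m hmem with h | ⟨l, d, hl, hd, hd0, hlow⟩
  · exact h
  · by_contra hc0
    obtain ⟨hl', rfl⟩ := List.getElem?_eq_some_iff.1 hd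
    obtain ⟨hm', rfl⟩ := List.getElem?_eq_some_iff.1 hc
    exact List.pairwise_iff_getElem.1 hS l m hl' hm' hl hd0 hc0 hlow.symm

variable (K)

/-- The position of the lowest nonzero entry, counted from `1`, and `0` for the zero column. -/
def lowRank (x : Cochain V) : ℕ :=
  (Finset.univ.filter (fun i : Fin n => x (K.simplex i) ≠ 0)).sup fun i => i.1 + 1

/-- Adding a column with the same lowest nonzero entry cancels this entry, and so moves the lowest
entry up. -/
theorem lowRank_add_lt {x y : Cochain V} {j : Fin (n + 1)} (hy : y ∈ cochains (K.complex j))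
    (hy0 : y ≠ 0) (hlow : low K x = low K y) : lowRank K (y + x) < lowRank K y := by
  have hne : low K y ≠ ⊥ := by
    obtain ⟨τ, hτ⟩ := Function.ne_iff.1 hy0
    have hτ' : τ ∈ (K.complex j).faces := by
      by_contra h
      exact hτ (hy τ h)
    obtain ⟨i, -, rfl⟩ := (mem_faces_iff K j τ).1 hτ'
    exact ne_bot_of_le_ne_bot (WithBot.coe_ne_bot (a := i)) (le_low K hτ)
  obtain ⟨i, hi⟩ := WithBot.ne_bot_iff_exists.1 hne
  have hyi := apply_ne_zero_of_low_eq K hi.symm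
  have hxi := apply_ne_zero_of_low_eq K (hlow.trans hi.symm)
  have hle : i.1 + 1 ≤ lowRank K y :=
    Finset.le_sup (f := fun i : Fin n => i.1 + 1) (Finset.mem_filter.2 ⟨Finset.mem_univ _, hyi⟩)
  refine (Finset.sup_lt_iff (Nat.succ_pos _ |>.trans_le hle)).2 fun l hl => lt_of_lt_of_le ?_ hle
  have hl := (Finset.mem_filter.1 hl).2
  have hli : l ≤ i := by
    by_cases hyl : y (K.simplex l) = 0
    · refine WithBot.coe_le_coe.1 (hi ▸ hlow ▸ le_low K fun hxl => hl ?_)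
      rw [Pi.add_apply, hyl, hxl, add_zero]
    · exact WithBot.coe_le_coe.1 (hi ▸ le_low K hyl)
  have hne : l ≠ i := by
    rintro rfl
    -- Both entries are `1`, hence they cancel.
    have one : ∀ a : ZMod 2, a ≠ 0 → a = 1 := by decide
    refine hl ?_
    rw [Pi.add_apply, one _ hyi, one _ hxi]
    rfl
  have := lt_of_le_of_ne hli hne
  omega

theorem sum_map_set_lt {α : Type*} (f : α → ℕ) (l : List α) (j : ℕ) (hj : j < l.length) (c : α)
    (h : f c < f l[j]) : ((l.set j c).map f).sum < (l.map f).sum := by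
  induction l generalizing j with
  | nil => exact absurd hj (Nat.not_lt_zero j)
  | cons a l ih =>
    cases j with
    | zero => simpa using h
    | succ j =>
      have := ih j (by simpa using hj) (by simpa using h)
      simpa using this

/-- Every matrix can be reduced: as long as two nonzero columns have the same lowest entry, adding
the left one to the right one decreases the sum of the ranks of the lowest entries. -/
theorem exists_isReduced (j : Fin (n + 1)) (S : List (Column V n))
    (hS : ∀ c ∈ S, c.vec ∈ cochains (K.complex j)) :
    ∃ S', Relation.ReflTransGen ColumnAddition S S' ∧ IsReduced K S' := by
  induction h : (S.map fun c => lowRank K c.vec).sum using Nat.strong_induction_on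
    generalizing S with
  | _ N ih =>
    subst h
    by_cases hred : IsReduced K S
    · exact ⟨S, Relation.ReflTransGen.refl, hred⟩
    · rw [IsReduced, List.pairwise_iff_getElem] at hred
      push Not at hred
      obtain ⟨a, b, ha, hb, hab, ha0, hb0, hlow⟩ := hred
      have hlt := sum_map_set_lt (fun c : Column V n => lowRank K c.vec) S b hb
        ⟨S[b].vec + S[a].vec, S[b].annotation⟩
        (lowRank_add_lt K (hS _ (List.getElem_mem hb)) hb0 hlow)
      obtain ⟨S', h1, h2⟩ := ih _ hlt (S.set b ⟨S[b].vec + S[a].vec, S[b].annotation⟩) (by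
        intro c hc
        rcases List.mem_or_eq_of_mem_set hc with hc | rfl
        · exact hS c hc
        · exact add_mem (hS _ (List.getElem_mem hb)) (hS _ (List.getElem_mem ha))) rfl
      exact ⟨S', Relation.ReflTransGen.head ⟨a, b, hab, hb, rfl⟩ h1, h2⟩

end Low

end CupPers

namespace CupPers

variable {V : Type u} [LinearOrder V] {n : ℕ}

/-! ### The state of the matrix of product cocycles -/

/-- The first `m` entries of a list. -/
def prior {α : Type*} (Z : List α) (m : ℕ) : Set α := {e | ∃ l, l < m ∧ Z[l]? = some e}

theorem prior_mono {α : Type*} (Z : List α) {m m' : ℕ} (h : m ≤ m') : prior Z m ⊆ prior Z m' :=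
  fun _ ⟨l, hl, he⟩ => ⟨l, hl.trans_le h, he⟩

theorem prior_append {α : Type*} (Z Z' : List α) {m : ℕ} (h : m ≤ Z.length) :
    prior (Z ++ Z') m = prior Z m := by
  ext e
  refine exists_congr fun l => and_congr_right fun hl => ?_
  rw [List.getElem?_append_left (hl.trans_le h)]

theorem prior_length_subset {α : Type*} {Z Z' : List α} (h : Z <+: Z') :
    prior Z Z.length ⊆ prior Z' Z'.length := by
  obtain ⟨Y, rfl⟩ := h
  rw [← prior_append Z Y le_rfl]
  exact prior_mono _ (by simp)

/-- The meaning of the matrix `S` and of the output at the index `k`.  The list `Z` contains all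
product cocycles inserted so far with their births, in the order of insertion.  The columns of `S`
are the unannotated columns `U`, which span the coboundaries, followed by the columns in `A`, which
are stored along with the position in `Z` of the product cocycle they come from and agree with it
modulo earlier entries of `Z`.  The list `O` contains the generated pairs, also with positions.  The
death of a generated pair is the largest index at which its product cocycle depends on the earlier
entries of `Z`; the product cocycles of the columns in `A` are independent of the earlier ones
at their births and at all indices larger than `k`. -/
structure Represents (K : SimplexwiseFiltration V n) (k : Fin (n + 1))
    (Z : List (Fin (n + 1) × Cochain V)) (U : List (Column V n)) (A : List (ℕ × Column V n))
    (O : List (ℕ × BarRep V n)) : Prop where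
  annotation_eq_none : ∀ c ∈ U, c.annotation = none
  span_unannotated : Submodule.span (ZMod 2) {x | ∃ c ∈ U, c.vec = x} =
    coboundaries (K.complex k)
  sorted : (A.map Prod.fst).Pairwise (· < ·)
  column : ∀ a ∈ A, ∃ e, Z[a.1]? = some e ∧ a.2.annotation = some e ∧
    a.2.vec - restrict (K.complex k) e.2 ∈ genSpan K k (prior Z a.1)
  alive : ∀ i ∈ A.map Prod.fst, ∀ e, Z[i]? = some e → ∀ j ≤ e.1, (k < j ∨ j = e.1) →
    restrict (K.complex j) e.2 ∉ genSpan K j (prior Z i)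
  dead : ∀ o ∈ O, Z[o.1]? = some (o.2.bar.birth, o.2.rep) ∧ k ≤ o.2.bar.death ∧
    o.2.bar.death < o.2.bar.birth ∧
    restrict (K.complex o.2.bar.death) o.2.rep ∈ genSpan K o.2.bar.death (prior Z o.1) ∧
    ∀ j, o.2.bar.Contains j → restrict (K.complex j) o.2.rep ∉ genSpan K j (prior Z o.1)
  perm : (A.map Prod.fst ++ O.map Prod.fst).Perm (List.range Z.length)
  births_sorted : Z.Pairwise (fun e f => f.1 ≤ e.1)
  le_birth : ∀ e ∈ Z, k ≤ e.1
  mem : ∀ e ∈ Z, e.2 ∈ cupCochains (K.complex e.1)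
  mem_homogeneous : ∀ e ∈ Z, ∃ p, e.2 ∈ homogeneous V (p + 1)

/-- The product cocycles of the remaining columns are independent of the earlier ones at `k`. -/
def Settled (K : SimplexwiseFiltration V n) (k : Fin (n + 1))
    (Z : List (Fin (n + 1) × Cochain V)) (A : List (ℕ × Column V n)) : Prop :=
  ∀ i ∈ A.map Prod.fst, ∀ e, Z[i]? = some e →
    restrict (K.complex k) e.2 ∉ genSpan K k (prior Z i)

/-- The restriction of a column to the index `k`; it keeps the annotation. -/
def restrictColumn (K : SimplexwiseFiltration V n) (k : Fin (n + 1)) (c : Column V n) :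
    Column V n :=
  ⟨restrict (K.complex k) c.vec, c.annotation⟩

namespace Represents

variable {K : SimplexwiseFiltration V n} {k : Fin (n + 1)} {Z : List (Fin (n + 1) × Cochain V)}
  {U : List (Column V n)} {A : List (ℕ × Column V n)} {O : List (ℕ × BarRep V n)}

theorem le_birth_of_prior (h : Represents K k Z U A O) {i : ℕ} {e f : Fin (n + 1) × Cochain V}
    (he : Z[i]? = some e) (hf : f ∈ prior Z i) : e.1 ≤ f.1 := by
  obtain ⟨l, hl, hf⟩ := hf
  obtain ⟨hl', rfl⟩ := List.getElem?_eq_some_iff.1 hf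
  obtain ⟨hi', rfl⟩ := List.getElem?_eq_some_iff.1 he
  exact List.pairwise_iff_getElem.1 h.births_sorted l i hl' hi' hl

theorem vec_mem (h : Represents K k Z U A O) {a : ℕ × Column V n} (ha : a ∈ A) {m : ℕ}
    (hm : a.1 < m) : a.2.vec ∈ genSpan K k (prior Z m) := by
  obtain ⟨e, he, -, hd⟩ := h.column a ha
  have h1 := genSpan_mono k (prior_mono Z hm.le) hd
  have h2 : restrict (K.complex k) e.2 ∈ genSpan K k (prior Z m) :=
    restrict_mem_genSpan_of_mem ⟨a.1, hm, he⟩ (h.le_birth e (List.mem_of_getElem? he))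
  have h3 := add_mem h1 h2
  rwa [sub_add_cancel] at h3

/-- The columns that come from the first `m` product cocycles span the same space as these
product cocycles, because those whose columns have been removed depend on earlier ones. -/
theorem genSpan_prior (h : Represents K k Z U A O) (m : ℕ) :
    genSpan K k (prior Z m) = coboundaries (K.complex k) ⊔
      Submodule.span (ZMod 2) {x | ∃ a ∈ A, a.1 < m ∧ a.2.vec = x} := by
  apply le_antisymm
  · induction m with
    | zero =>
      refine genSpan_le le_sup_left ?_
      rintro e ⟨l, hl, -⟩
      exact absurd hl (Nat.not_lt_zero l)
    | succ m ih =>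
      have hmono : coboundaries (K.complex k) ⊔
          Submodule.span (ZMod 2) {x | ∃ a ∈ A, a.1 < m ∧ a.2.vec = x} ≤
          coboundaries (K.complex k) ⊔
            Submodule.span (ZMod 2) {x | ∃ a ∈ A, a.1 < m + 1 ∧ a.2.vec = x} := by
        refine sup_le_sup_left (Submodule.span_mono ?_) _
        rintro _ ⟨a, ha, ham, rfl⟩
        exact ⟨a, ha, ham.trans (Nat.lt_succ_self m), rfl⟩
      refine genSpan_le le_sup_left ?_
      rintro e ⟨l, hl, he⟩ hke
      rcases (Nat.lt_succ_iff.1 hl).lt_or_eq with hlm | rfl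
      · exact hmono (ih (restrict_mem_genSpan_of_mem ⟨l, hlm, he⟩ hke))
      · have hmem : l ∈ A.map Prod.fst ++ O.map Prod.fst :=
          h.perm.mem_iff.2 (List.mem_range.2 (List.getElem?_eq_some_iff.1 he).1)
        rcases List.mem_append.1 hmem with hA | hO
        · obtain ⟨a, ha, rfl⟩ := List.mem_map.1 hA
          obtain ⟨e', he', -, hd⟩ := h.column a ha
          obtain rfl : e = e' := Option.some.inj (he.symm.trans he')
          have h1 := hmono (ih hd)
          have h2 : a.2.vec ∈ coboundaries (K.complex k) ⊔
              Submodule.span (ZMod 2) {x | ∃ b ∈ A, b.1 < a.1 + 1 ∧ b.2.vec = x} :=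
            Submodule.mem_sup_right (Submodule.subset_span ⟨a, ha, Nat.lt_succ_self _, rfl⟩)
          have h3 := sub_mem h2 h1
          rwa [sub_sub_cancel] at h3
        · obtain ⟨o, ho, rfl⟩ := List.mem_map.1 hO
          obtain ⟨he', hk, -, hd, -⟩ := h.dead o ho
          obtain rfl := Option.some.inj (he.symm.trans he')
          have h1 := restrict_mem_genSpan hk hd
          rw [restrict_restrict (K.mono hk)] at h1
          exact hmono (ih h1)
  · refine sup_le (coboundaries_le_genSpan k _) (Submodule.span_le.2 ?_)
    rintro _ ⟨a, ha, ham, rfl⟩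
    exact h.vec_mem ha ham

theorem lt_length (h : Represents K k Z U A O) {i : ℕ} (hi : i ∈ A.map Prod.fst) :
    i < Z.length :=
  List.mem_range.1 (h.perm.mem_iff.1 (List.mem_append_left _ hi))

theorem span_columns (h : Represents K k Z U A O) :
    Submodule.span (ZMod 2) {x | ∃ c ∈ U ++ A.map Prod.snd, c.vec = x} =
      genSpan K k (prior Z Z.length) := by
  rw [h.genSpan_prior, ← h.span_unannotated, ← Submodule.span_union]
  congr 1
  ext x
  constructor
  · rintro ⟨c, hc, rfl⟩
    rcases List.mem_append.1 hc with hc | hc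
    · exact Or.inl ⟨c, hc, rfl⟩
    · obtain ⟨a, ha, rfl⟩ := List.mem_map.1 hc
      exact Or.inr ⟨a, ha, h.lt_length (List.mem_map_of_mem ha), rfl⟩
  · rintro (⟨c, hc, rfl⟩ | ⟨a, ha, -, rfl⟩)
    · exact ⟨c, List.mem_append_left _ hc, rfl⟩
    · exact ⟨a.2, List.mem_append_right _ (List.mem_map_of_mem ha), rfl⟩

theorem prefixSpan_unannotated (h : Represents K k Z U A O) :
    prefixSpan (U ++ A.map Prod.snd) U.length = coboundaries (K.complex k) := by
  rw [← h.span_unannotated]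
  apply le_antisymm
  · refine prefixSpan_le fun l c hl hc => ?_
    rw [List.getElem?_append_left hl] at hc
    exact Submodule.subset_span ⟨c, List.mem_of_getElem? hc, rfl⟩
  · refine Submodule.span_le.2 ?_
    rintro _ ⟨c, hc, rfl⟩
    obtain ⟨l, hl, rfl⟩ := List.getElem_of_mem hc
    refine vec_mem_prefixSpan hl ?_
    rw [List.getElem?_append_left hl, List.getElem?_eq_getElem hl]

/-- The columns to the left of an annotated column span the same space, modulo coboundaries, as the
product cocycles that were inserted before its own, including those whose columns have already been
removed. -/
theorem prefixSpan_eq (h : Represents K k Z U A O) {r : ℕ} {a : ℕ × Column V n}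
    (ha : A[r]? = some a) :
    prefixSpan (U ++ A.map Prod.snd) (U.length + r) = genSpan K k (prior Z a.1) := by
  obtain ⟨hr, rfl⟩ := List.getElem?_eq_some_iff.1 ha
  have hsorted := List.pairwise_iff_getElem.1 h.sorted
  rw [h.genSpan_prior]
  apply le_antisymm
  · refine prefixSpan_le fun l c hl hc => ?_
    by_cases hlU : l < U.length
    · exact Submodule.mem_sup_left (h.prefixSpan_unannotated.le (vec_mem_prefixSpan hlU hc))
    · rw [List.getElem?_append_right (not_lt.1 hlU), List.getElem?_map] at hc
      obtain ⟨b, hb, rfl⟩ := Option.map_eq_some_iff.1 hc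
      obtain ⟨hb', rfl⟩ := List.getElem?_eq_some_iff.1 hb
      refine Submodule.mem_sup_right (Submodule.subset_span ⟨_, List.getElem_mem hb', ?_, rfl⟩)
      have := hsorted (l - U.length) r (by simpa using hb') (by simpa using hr) (by omega)
      simpa using this
  · refine sup_le ?_ (Submodule.span_le.2 ?_)
    · rw [← h.prefixSpan_unannotated]
      exact prefixSpan_le fun l c hl hc => vec_mem_prefixSpan (by omega) hc
    · rintro _ ⟨b, hb, hlt, rfl⟩
      obtain ⟨l, hl, rfl⟩ := List.getElem_of_mem hb
      have hlr : l < r := by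
        by_contra hrl
        rcases (not_lt.1 hrl).lt_or_eq with h1 | h1
        · have := hsorted r l (by simpa using hr) (by simpa using hl) h1
          simp only [List.getElem_map] at this
          omega
        · subst h1
          exact lt_irrefl _ hlt
      refine vec_mem_prefixSpan (l := U.length + l) (by omega) ?_
      rw [List.getElem?_append_right (by omega), List.getElem?_map, Nat.add_sub_cancel_left,
        List.getElem?_eq_getElem hl]
      rfl

/-! ### Insertion of product cocycles -/

/-- A product cocycle that is not in the span of `S` is appended to `S` and to the list `Z`. -/
theorem append (h : Represents K k Z U A O) {ζ : Cochain V}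
    (hζ : ζ ∈ cupCochains (K.complex k)) (hdeg : ∃ p, ζ ∈ homogeneous V (p + 1))
    (hnot : ζ ∉ genSpan K k (prior Z Z.length)) :
    Represents K k (Z ++ [(k, ζ)]) U (A ++ [(Z.length, ⟨ζ, some (k, ζ)⟩)]) O := by
  have hres : restrict (K.complex k) ζ = ζ :=
    restrict_eq_self (cupCochains_le_cocycles _ hζ).1
  have hlast : (Z ++ [(k, ζ)])[Z.length]? = some (k, ζ) := by simp
  have hO : ∀ o ∈ O, o.1 < Z.length := fun o ho =>
    List.mem_range.1 (h.perm.mem_iff.1 (List.mem_append_right _ (List.mem_map_of_mem ho)))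
  have hold : ∀ i < Z.length, (Z ++ [(k, ζ)])[i]? = Z[i]? ∧
      prior (Z ++ [(k, ζ)]) i = prior Z i := fun i hi =>
    ⟨List.getElem?_append_left hi, prior_append Z _ hi.le⟩
  have hmem : ∀ e ∈ Z ++ [(k, ζ)], e ∈ Z ∨ e = (k, ζ) := fun e he => by simpa using he
  refine ⟨h.annotation_eq_none, h.span_unannotated, ?_, ?_, ?_, ?_, ?_, ?_, ?_, ?_, ?_⟩
  · rw [List.map_append, List.pairwise_append]
    refine ⟨h.sorted, List.pairwise_singleton _ _, fun i hi l hl => ?_⟩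
    obtain rfl : l = Z.length := by simpa using hl
    exact h.lt_length hi
  · intro a ha
    rcases List.mem_append.1 ha with ha | ha
    · have hlt := h.lt_length (List.mem_map_of_mem ha)
      rw [(hold _ hlt).1, (hold _ hlt).2]
      exact h.column a ha
    · obtain rfl := List.mem_singleton.1 ha
      refine ⟨(k, ζ), hlast, rfl, ?_⟩
      rw [hres, sub_self]
      exact zero_mem _
  · intro i hi e he j hje hj
    rw [List.map_append] at hi
    rcases List.mem_append.1 hi with hi | hi
    · have hlt := h.lt_length hi
      rw [(hold _ hlt).1] at he
      rw [(hold _ hlt).2]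
      exact h.alive i hi e he j hje hj
    · obtain rfl : i = Z.length := by simpa using hi
      obtain rfl := Option.some.inj (hlast.symm.trans he)
      obtain rfl : j = k := by
        rcases hj with hj | hj
        · exact absurd hje (not_le.2 hj)
        · exact hj
      rw [prior_append Z _ le_rfl, hres]
      exact hnot
  · intro o ho
    rw [(hold _ (hO o ho)).1, (hold _ (hO o ho)).2]
    exact h.dead o ho
  · rw [List.map_append, List.length_append, List.length_singleton, List.range_succ,
      List.append_assoc]
    refine (List.Perm.append_left _ List.perm_append_comm).trans ?_
    rw [← List.append_assoc]
    exact h.perm.append_right _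
  · rw [List.pairwise_append]
    refine ⟨h.births_sorted, List.pairwise_singleton _ _, fun e he f hf => ?_⟩
    obtain rfl := List.mem_singleton.1 hf
    exact h.le_birth e he
  · intro e he
    rcases hmem e he with he | rfl
    · exact h.le_birth e he
    · exact le_rfl
  · intro e he
    rcases hmem e he with he | rfl
    · exact h.mem e he
    · exact hζ
  · intro e he
    rcases hmem e he with he | rfl
    · exact h.mem_homogeneous e he
    · exact hdeg

theorem exists_insertProduct (h : Represents K k Z U A O) {ζ : Cochain V}
    (hζ : ζ ∈ cupCochains (K.complex k)) (hdeg : ∃ p, ζ ∈ homogeneous V (p + 1)) :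
    ∃ Z' A', Z <+: Z' ∧ Represents K k Z' U A' O ∧
      insertProduct k (U ++ A.map Prod.snd) ζ = U ++ A'.map Prod.snd ∧
      ζ ∈ genSpan K k (prior Z' Z'.length) := by
  unfold insertProduct
  rw [h.span_columns]
  split_ifs with hc
  · have h' := h.append hζ hdeg hc.2
    refine ⟨_, _, List.prefix_append _ _, h', by simp, ?_⟩
    have h1 := restrict_mem_genSpan_of_mem (K := K) (j := k) (e := (k, ζ))
      (T := prior (Z ++ [(k, ζ)]) (Z ++ [(k, ζ)]).length) ⟨Z.length, by simp, by simp⟩ le_rfl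
    rwa [restrict_eq_self (cupCochains_le_cocycles _ hζ).1] at h1
  · refine ⟨Z, A, List.prefix_rfl, h, rfl, ?_⟩
    by_contra hn
    refine hc ⟨fun h0 => hn ?_, hn⟩
    rw [h0]
    exact zero_mem _

theorem exists_foldl_insertProduct {α : Type*} (Y : List α) (f : α → Cochain V)
    (hf : ∀ y ∈ Y, f y ∈ cupCochains (K.complex k) ∧ ∃ p, f y ∈ homogeneous V (p + 1))
    (h : Represents K k Z U A O) :
    ∃ Z' A', Z <+: Z' ∧ Represents K k Z' U A' O ∧
      Y.foldl (fun S y => insertProduct k S (f y)) (U ++ A.map Prod.snd) =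
        U ++ A'.map Prod.snd ∧
      ∀ y ∈ Y, f y ∈ genSpan K k (prior Z' Z'.length) := by
  induction Y generalizing Z A with
  | nil => exact ⟨Z, A, List.prefix_rfl, h, rfl, fun y hy => absurd hy List.not_mem_nil⟩
  | cons y Y ih =>
    have hy := hf y List.mem_cons_self
    obtain ⟨Z₁, A₁, hZ₁, h₁, hS₁, hy₁⟩ := h.exists_insertProduct hy.1 hy.2
    obtain ⟨Z₂, A₂, hZ₂, h₂, hS₂, hy₂⟩ := ih (fun y hy => hf y (List.mem_cons_of_mem _ hy)) h₁
    refine ⟨Z₂, A₂, hZ₁.trans hZ₂, h₂, ?_, ?_⟩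
    · rw [List.foldl_cons, hS₁, hS₂]
    · intro w hw
      rcases List.mem_cons.1 hw with rfl | hw
      · exact genSpan_mono k (prior_length_subset hZ₂) hy₁
      · exact hy₂ w hw

/-! ### Reduction and removal of columns -/

/-- Column additions do not affect what the matrix represents. -/
theorem exists_of_unitriangular (h : Represents K k Z U A O) {S' : List (Column V n)}
    (hS : Unitriangular (U ++ A.map Prod.snd) S') :
    ∃ U' A', S' = U' ++ A'.map Prod.snd ∧ Represents K k Z U' A' O := by
  have hlen : S'.length = U.length + A.length := by
    rw [hS.length_eq, List.length_append, List.length_map]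
  have hU : (S'.take U.length).length = U.length := by
    rw [List.length_take, hlen]
    omega
  have hA : (A.map Prod.fst).length = (S'.drop U.length).length := by
    rw [List.length_map, List.length_drop, hlen]
    omega
  have hfst : ((A.map Prod.fst).zip (S'.drop U.length)).map Prod.fst = A.map Prod.fst :=
    List.map_fst_zip hA.le
  have hsnd : ((A.map Prod.fst).zip (S'.drop U.length)).map Prod.snd = S'.drop U.length :=
    List.map_snd_zip hA.ge
  refine ⟨S'.take U.length, (A.map Prod.fst).zip (S'.drop U.length), ?_, ?_⟩
  · rw [hsnd, List.take_append_drop]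
  refine ⟨?_, ?_, by rw [hfst]; exact h.sorted, ?_, by rw [hfst]; exact h.alive, h.dead,
    by rw [hfst]; exact h.perm, h.births_sorted,
    h.le_birth, h.mem, h.mem_homogeneous⟩
  · intro c hc
    obtain ⟨l, hl⟩ := List.getElem?_of_mem hc
    rw [List.getElem?_take] at hl
    split_ifs at hl with hlU
    have hl0 : (U ++ A.map Prod.snd)[l]? = some U[l] := by
      rw [List.getElem?_append_left hlU, List.getElem?_eq_getElem hlU]
    rw [hS.annotation_eq hl0 hl]
    exact h.annotation_eq_none _ (List.getElem_mem hlU)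
  · rw [← h.prefixSpan_unannotated, ← hS.prefixSpan_eq]
    apply le_antisymm
    · refine Submodule.span_le.2 ?_
      rintro _ ⟨c, hc, rfl⟩
      obtain ⟨l, hl⟩ := List.getElem?_of_mem hc
      rw [List.getElem?_take] at hl
      split_ifs at hl with hlU
      exact vec_mem_prefixSpan hlU hl
    · refine prefixSpan_le fun l c hl hc => Submodule.subset_span ⟨c, ?_, rfl⟩
      refine List.mem_of_getElem? (i := l) ?_
      rw [List.getElem?_take, if_pos hl, hc]
  · intro a' ha'
    obtain ⟨r, hr⟩ := List.getElem?_of_mem ha'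
    rw [List.getElem?_zip_eq_some] at hr
    obtain ⟨hr1, hr2⟩ := hr
    rw [List.getElem?_map] at hr1
    obtain ⟨a, ha, ha1⟩ := Option.map_eq_some_iff.1 hr1
    rw [List.getElem?_drop] at hr2
    have hr0 : (U ++ A.map Prod.snd)[U.length + r]? = some a.2 := by
      rw [List.getElem?_append_right (by omega), List.getElem?_map, Nat.add_sub_cancel_left, ha]
      rfl
    obtain ⟨e, he, hann, hd⟩ := h.column a (List.mem_of_getElem? ha)
    refine ⟨e, ha1 ▸ he, (hS.annotation_eq hr0 hr2).trans hann, ?_⟩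
    have h1 := hS.sub_mem hr0 hr2
    rw [h.prefixSpan_eq ha] at h1
    rw [← ha1, ← sub_add_sub_cancel _ a.2.vec]
    exact add_mem h1 hd

/-- A reduced matrix has a zero column exactly where the product cocycle depends on the earlier
ones.  This does not involve the column additions by which the matrix was reduced. -/
theorem vec_eq_zero_iff (h : Represents K k Z U A O) (hred : IsReduced K (U ++ A.map Prod.snd))
    {a : ℕ × Column V n} (ha : a ∈ A) {e : Fin (n + 1) × Cochain V} (he : Z[a.1]? = some e) :
    a.2.vec = 0 ↔ restrict (K.complex k) e.2 ∈ genSpan K k (prior Z a.1) := by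
  obtain ⟨e', he', -, hd⟩ := h.column a ha
  obtain rfl := Option.some.inj (he.symm.trans he')
  constructor
  · intro h0
    rw [h0, zero_sub] at hd
    simpa using hd
  · intro hmem
    have h1 := add_mem hd hmem
    rw [sub_add_cancel] at h1
    obtain ⟨r, hr⟩ := List.getElem?_of_mem ha
    rw [← h.prefixSpan_eq hr] at h1
    refine hred.eq_zero_of_mem_prefixSpan ?_ h1
    rw [List.getElem?_append_right (by omega), List.getElem?_map, Nat.add_sub_cancel_left, hr]
    rfl

theorem _root_.List.map_perm_filter_append_filterMap {α β γ : Type*} (f : α → β)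
    (g : α → Option γ) (l : List α) :
    (l.map f).Perm ((l.filter fun a => (g a).isNone).map f ++
      l.filterMap fun a => (g a).map fun _ => f a) := by
  induction l with
  | nil => rfl
  | cons a l ih =>
    rcases h : g a with _ | c
    · simpa [h] using ih
    · have h1 : List.filterMap (fun a => (g a).map fun _ => f a) (a :: l) =
          f a :: l.filterMap fun a => (g a).map fun _ => f a := by
        rw [List.filterMap_cons, h]; rfl
      rw [h1, List.map_cons, List.filter_cons_of_neg (by simp [h])]
      exact (ih.cons _).trans List.perm_middle.symm

/-- The pair generated from a column, along with the position of the product cocycle. -/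
def generatedAt (k : Fin (n + 1)) (a : ℕ × Column V n) : Option (ℕ × BarRep V n) :=
  (generated k a.2).map fun b => (a.1, b)

/-- Turning the zero columns into bars that die at `k` preserves the meaning of the state, and
afterwards no remaining product cocycle depends on the earlier ones at `k`. -/
theorem removeGenerated (h : Represents K k Z U A O)
    (hred : IsReduced K (U ++ A.map Prod.snd)) :
    Represents K k Z U (A.filter fun a => (generated k a.2).isNone)
        (O ++ A.filterMap (generatedAt k)) ∧
      Settled K k Z (A.filter fun a => (generated k a.2).isNone) := by
  classical
  have hsub : (A.filter fun a => (generated k a.2).isNone).Sublist A := List.filter_sublist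
  have hgen : ∀ a ∈ A, ∀ e, Z[a.1]? = some e →
      generated k a.2 = if a.2.vec = 0 then some ⟨⟨k, e.1⟩, e.2⟩ else none := by
    intro a ha e he
    obtain ⟨e', he', hann, -⟩ := h.column a ha
    obtain rfl := Option.some.inj (he.symm.trans he')
    unfold generated
    rw [hann]
    split_ifs <;> rfl
  refine ⟨⟨h.annotation_eq_none, h.span_unannotated, h.sorted.sublist (hsub.map _),
    fun a ha => h.column a (hsub.subset ha),
    fun i hi => h.alive i ((hsub.map _).subset hi), ?_, ?_, h.births_sorted, h.le_birth, h.mem,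
    h.mem_homogeneous⟩, ?_⟩
  · intro o ho
    rcases List.mem_append.1 ho with ho | ho
    · exact h.dead o ho
    · obtain ⟨a, ha, hao⟩ := List.mem_filterMap.1 ho
      obtain ⟨e, he, -⟩ := h.column a ha
      obtain ⟨b, hb, rfl⟩ := Option.map_eq_some_iff.1 hao
      rw [hgen a ha e he] at hb
      split_ifs at hb with h0
      obtain rfl := Option.some.inj hb
      -- The bar is nonempty because a product cocycle is inserted only if it is independent.
      have hmem := (h.vec_eq_zero_iff hred ha he).1 h0
      have halive := h.alive a.1 (List.mem_map_of_mem ha) e he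
      have hke := h.le_birth e (List.mem_of_getElem? he)
      have hne : k ≠ e.1 := by
        rintro rfl
        exact halive e.1 le_rfl (Or.inr rfl) hmem
      exact ⟨he, le_rfl, lt_of_le_of_ne hke hne, hmem, fun j hj => halive j hj.2 (Or.inl hj.1)⟩
  · have h1 : (A.filterMap (generatedAt k)).map Prod.fst =
        A.filterMap fun a => (generated k a.2).map fun _ => a.1 := by
      rw [List.map_filterMap]
      congr 1
      funext a
      unfold generatedAt
      rw [Option.map_map]
      rfl
    have h2 := List.map_perm_filter_append_filterMap Prod.fst (fun a => generated k a.2) A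
    refine List.Perm.trans ?_ h.perm
    rw [List.map_append, h1]
    refine List.Perm.trans ?_ (h2.symm.append_right _)
    rw [List.append_assoc]
    exact List.Perm.append_left _ List.perm_append_comm
  · intro i hi e he hmem
    obtain ⟨a, ha, rfl⟩ := List.mem_map.1 hi
    obtain ⟨ha, hnone⟩ := List.mem_filter.1 ha
    rw [hgen a ha e he, if_pos ((h.vec_eq_zero_iff hred ha he).2 hmem)] at hnone
    cases hnone

theorem filter_columns (h : Represents K k Z U A O) :
    (U ++ A.map Prod.snd).filter (fun c => (generated k c).isNone) =
      U ++ (A.filter fun a => (generated k a.2).isNone).map Prod.snd := by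
  rw [List.filter_append, List.filter_map, List.filter_eq_self.2]
  · rfl
  · intro c hc
    unfold generated
    rw [h.annotation_eq_none c hc]
    split_ifs <;> rfl

theorem filterMap_columns (h : Represents K k Z U A O) :
    (U ++ A.map Prod.snd).filterMap (generated k) =
      (A.filterMap (generatedAt k)).map Prod.snd := by
  rw [List.filterMap_append, List.filterMap_eq_nil_iff.2, List.nil_append, List.filterMap_map,
    List.map_filterMap]
  · congr 1
    funext a
    unfold generatedAt
    rw [Option.map_map]
    exact Option.map_id'.symm
  · intro c hc
    unfold generated
    rw [h.annotation_eq_none c hc]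
    split_ifs <;> rfl

/-! ### Passing to a smaller index -/

/-- Restriction to the next smaller index `k` preserves the meaning of the state, provided that the
product cocycles of the remaining columns are independent of the earlier ones at `j`. -/
theorem restrict_level {j : Fin (n + 1)} (h : Represents K j Z U A O) (hset : Settled K j Z A)
    (hkj : k < j) (hsucc : ∀ i, k < i → j ≤ i) :
    Represents K k Z (U.map (restrictColumn K k)) (A.map (Prod.map id (restrictColumn K k))) O := by
  have hfst : (A.map (Prod.map id (restrictColumn K k))).map Prod.fst = A.map Prod.fst := by
    rw [List.map_map]
    rfl
  refine ⟨?_, ?_, by rw [hfst]; exact h.sorted, ?_, ?_, ?_, by rw [hfst]; exact h.perm,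
    h.births_sorted,
    fun e he => hkj.le.trans (h.le_birth e he), h.mem, h.mem_homogeneous⟩
  · intro c hc
    obtain ⟨d, hd, rfl⟩ := List.mem_map.1 hc
    exact h.annotation_eq_none d hd
  · have hB : coboundaries (K.complex k) =
        (coboundaries (K.complex j)).map (restrict (K.complex k)) := by
      apply le_antisymm
      · rintro _ ⟨z, hz, rfl⟩
        -- The extension of a cochain by zero is a cochain of the larger complex.
        have hzj : z ∈ cochains (K.complex j) := fun τ hτ => hz τ fun hk => hτ (K.mono hkj.le hk)
        refine ⟨_, ⟨z, hzj, rfl⟩, ?_⟩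
        rw [← coboundary_restrict (K.mono hkj.le) hzj, restrict_eq_self hz]
      · rintro _ ⟨b, hb, rfl⟩
        exact restrict_mem_coboundaries (K.mono hkj.le) hb
    rw [hB, ← h.span_unannotated, Submodule.map_span]
    congr 1
    ext x
    constructor
    · rintro ⟨c, hc, rfl⟩
      obtain ⟨d, hd, rfl⟩ := List.mem_map.1 hc
      exact ⟨_, ⟨d, hd, rfl⟩, rfl⟩
    · rintro ⟨_, ⟨d, hd, rfl⟩, rfl⟩
      exact ⟨_, List.mem_map_of_mem hd, rfl⟩
  · intro a' ha'
    obtain ⟨a, ha, rfl⟩ := List.mem_map.1 ha'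
    obtain ⟨e, he, hann, hd⟩ := h.column a ha
    refine ⟨e, he, hann, ?_⟩
    have h1 := restrict_mem_genSpan hkj.le hd
    rwa [map_sub, restrict_restrict (K.mono hkj.le)] at h1
  · rw [hfst]
    intro i hi e he l hle hl
    rcases hl with hl | rfl
    · rcases (hsucc l hl).lt_or_eq with hjl | rfl
      · exact h.alive i hi e he l hle (Or.inl hjl)
      · exact hset i hi e he
    · exact h.alive i hi e he _ le_rfl (Or.inr rfl)
  · intro o ho
    obtain ⟨h1, h2, h3⟩ := h.dead o ho
    exact ⟨h1, hkj.le.trans h2, h3⟩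

/-- If the restriction from the next index `j` to `k` is injective modulo coboundaries on
cocycles without component of degree zero, then no product cocycle becomes dependent on earlier
ones. -/
theorem settled_of_injective {j : Fin (n + 1)} (h : Represents K k Z U A O) (hkj : k < j)
    (hsucc : ∀ i, k < i → j ≤ i)
    (hinj : ∀ v ∈ cocycles (K.complex j), homProj V 0 v = 0 →
      restrict (K.complex k) v ∈ coboundaries (K.complex k) → v ∈ coboundaries (K.complex j)) :
    Settled K k Z A := by
  intro i hi e he hmem
  have hek := h.le_birth e (List.mem_of_getElem? he)
  rcases hek.lt_or_eq with hlt | heq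
  swap
  · exact h.alive i hi e he k hek (Or.inr heq) hmem
  have hje := hsucc _ hlt
  refine h.alive i hi e he j hje (Or.inl hkj) ?_
  obtain ⟨b, hb, y, hy, hby⟩ := Submodule.mem_sup.1 hmem
  have hgood : ∀ f ∈ Z, j ≤ f.1 → restrict (K.complex j) f.2 ∈
      cocycles (K.complex j) ⊓ LinearMap.ker (homProj V 0) := by
    intro f hf hjf
    obtain ⟨p, hp⟩ := h.mem_homogeneous f hf
    exact ⟨restrict_mem_cocycles (K.mono hjf) (cupCochains_le_cocycles _ (h.mem f hf)),
      homProj_of_mem_of_ne (restrict_mem_homogeneous _ hp) (by omega)⟩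
  -- A relation at `k` is the restriction of an element `w` of the span of the same product cocycles
  -- at `j`, where all of them are already defined.
  have hy' : y ∈ (Submodule.span (ZMod 2) ((fun f => restrict (K.complex j) f.2) ''
      {f | f ∈ prior Z i ∧ j ≤ f.1})).map (restrict (K.complex k)) := by
    refine (Submodule.span_le.2 ?_ : _ ≤ _) hy
    rintro _ ⟨f, ⟨hf, -⟩, rfl⟩
    exact ⟨_, Submodule.subset_span ⟨f, ⟨hf, hje.trans (h.le_birth_of_prior he hf)⟩, rfl⟩,
      restrict_restrict (K.mono hkj.le) _⟩
  obtain ⟨w, hw, rfl⟩ := hy'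
  have hwgood : w ∈ cocycles (K.complex j) ⊓ LinearMap.ker (homProj V 0) := by
    refine (Submodule.span_le.2 ?_ : _ ≤ _) hw
    rintro _ ⟨f, ⟨⟨l, -, hf⟩, hjf⟩, rfl⟩
    exact hgood f (List.mem_of_getElem? hf) hjf
  have hv := sub_mem (hgood e (List.mem_of_getElem? he) hje) hwgood
  have h1 := hinj _ hv.1 hv.2 (by
    rw [map_sub, restrict_restrict (K.mono hkj.le), ← hby, add_sub_cancel_right]
    exact hb)
  have h2 := add_mem (coboundaries_le_genSpan j (prior Z i) h1)
    (Submodule.mem_sup_right hw : w ∈ genSpan K j (prior Z i))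
  rwa [sub_add_cancel] at h2

end Represents

end CupPers

namespace CupPers

variable {V : Type u} [LinearOrder V] {n : ℕ} {K : SimplexwiseFiltration V n}

/-! ### Products of the members of a persistent cohomology basis -/

/-- Modulo coboundaries, the products of the representatives of positive degree whose bars contain
`k` span the cup space at `k`. -/
theorem cupCochains_le_of_reps (Ω : PersistentCohomologyBasis K) {k : Fin (n + 1)}
    {W : Submodule (ZMod 2) (Cochain V)} (hB : coboundaries (K.complex k) ≤ W)
    (h : ∀ i i', 0 < Ω.deg i → 0 < Ω.deg i' → (Ω.bar i).Contains k → (Ω.bar i').Contains k →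
      cup (K.complex k) (restrict (K.complex k) (Ω.rep i).1)
        (restrict (K.complex k) (Ω.rep i').1) ∈ W) :
    cupCochains (K.complex k) ≤ W := by
  set Q := coboundaries (K.complex k) ⊔ Submodule.span (ZMod 2)
    {w | ∃ i, 0 < Ω.deg i ∧ (Ω.bar i).Contains k ∧ restrict (K.complex k) (Ω.rep i).1 = w} with hQ
  have hmem : ∀ p x, x ∈ cocycles (K.complex k) → x ∈ homogeneous V (p + 1) → x ∈ Q := by
    intro p x hx hxp
    refine SetLike.le_def.1 (sup_le_sup_left (Submodule.span_mono ?_) _)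
      (Ω.isCochainBasis.mem_sup_span_of_homogeneous (j := k) hx hxp)
    rintro _ ⟨i, hi, hik, rfl⟩
    exact ⟨i, by omega, hik, rfl⟩
  have hcoc : ∀ i, (Ω.bar i).Contains k →
      restrict (K.complex k) (Ω.rep i).1 ∈ cocycles (K.complex k) := fun i hi =>
    restrict_mem_cocycles (K.mono hi.2) (Ω.rep i).2
  have h1 : ∀ i', 0 < Ω.deg i' → (Ω.bar i').Contains k →
      Q ≤ W.comap ((cup (K.complex k)).flip (restrict (K.complex k) (Ω.rep i').1)) := by
    intro i' hi' hk'
    refine sup_le (fun b hb => hB (cup_coboundary_left hb (hcoc i' hk'))) (Submodule.span_le.2 ?_)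
    rintro _ ⟨i, hi, hk, rfl⟩
    exact h i i' hi hi' hk hk'
  refine sup_le hB (Submodule.span_le.2 ?_)
  rintro _ ⟨p, q, x, y, hx, hxp, hy, hyq, rfl⟩
  have h2 : Q ≤ W.comap (cup (K.complex k) x) := by
    refine sup_le (fun b hb => hB (cup_coboundary_right hx hb)) (Submodule.span_le.2 ?_)
    rintro _ ⟨i', hi', hk', rfl⟩
    exact h1 i' hi' hk' (hmem p x hx hxp)
  exact h2 (hmem q y hy hyq)

/-- If no bar of positive degree dies at `k`, then the restriction to `K_k` from the next complex
is injective on cohomology in positive degrees. -/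
theorem mem_coboundaries_of_restrict (Ω : PersistentCohomologyBasis K) {k j : Fin (n + 1)}
    (hkj : k < j) (hpred : ∀ i, i < j → i ≤ k)
    (hno : ¬ ∃ i, (Ω.bar i).death = k ∧ 0 < Ω.deg i) {v : Cochain V}
    (hv : v ∈ cocycles (K.complex j)) (hv0 : homProj V 0 v = 0)
    (hvk : restrict (K.complex k) v ∈ coboundaries (K.complex k)) :
    v ∈ coboundaries (K.complex j) := by
  have hΩ := Ω.isCochainBasis
  rw [← sum_homProj K hv.1]
  refine Submodule.sum_mem _ fun p _ => ?_
  rcases Nat.eq_zero_or_pos p with rfl | hp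
  · rw [hv0]
    exact zero_mem _
  obtain ⟨b, hb, w, hw, hbw⟩ := Submodule.mem_sup.1 (hΩ.mem_sup_span_of_homogeneous (j := j)
    (homProj_mem_cocycles p hv) (homProj_mem p v))
  have hset : {w | ∃ i, Ω.deg i = p ∧ (Ω.bar i).Contains j ∧
        restrict (K.complex j) (Ω.rep i).1 = w} =
      (fun i => restrict (K.complex j) (Ω.rep i).1) ''
        {i | Ω.deg i = p ∧ (Ω.bar i).Contains j} := by
    ext w
    constructor
    · rintro ⟨i, h1, h2, rfl⟩
      exact ⟨i, ⟨h1, h2⟩, rfl⟩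
    · rintro ⟨i, ⟨h1, h2⟩, rfl⟩
      exact ⟨i, h1, h2, rfl⟩
  rw [hset] at hw
  obtain ⟨l, hl, rfl⟩ := (Finsupp.mem_span_image_iff_linearCombination _).1 hw
  have hcont : ∀ i, i ∈ {i | Ω.deg i = p ∧ (Ω.bar i).Contains j} → (Ω.bar i).Contains k := by
    rintro i ⟨hip, hi⟩
    refine ⟨lt_of_le_of_ne (hpred _ hi.1) fun hd => hno ⟨i, hd, hip ▸ hp⟩, hkj.le.trans hi.2⟩
  have hli : LinearIndepOn (ZMod 2) (fun i => (coboundaries (K.complex k)).mkQ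
      (restrict (K.complex k) (Ω.rep i).1)) {i | (Ω.bar i).Contains k} :=
    hΩ.linearIndependent k
  have hzero : Finsupp.linearCombination (ZMod 2) (fun i => (coboundaries (K.complex k)).mkQ
      (restrict (K.complex k) (Ω.rep i).1)) l = 0 := by
    have h1 : (fun i => (coboundaries (K.complex k)).mkQ (restrict (K.complex k) (Ω.rep i).1)) =
        ((coboundaries (K.complex k)).mkQ.comp (restrict (K.complex k))) ∘
          fun i => restrict (K.complex j) (Ω.rep i).1 := by
      funext i
      simp only [Function.comp_apply, LinearMap.comp_apply]
      rw [restrict_restrict (K.mono hkj.le)]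
    rw [h1, ← LinearMap.map_finsupp_linearCombination, eq_sub_of_add_eq' hbw,
      LinearMap.comp_apply]
    refine (Submodule.Quotient.mk_eq_zero _).2 ?_
    rw [map_sub, ← homProj_restrict]
    exact sub_mem (homProj_mem_coboundaries p hvk) (restrict_mem_coboundaries (K.mono hkj.le) hb)
  have hl0 := linearIndepOn_iff.1 hli l
    ((Finsupp.mem_supported _ _).2 (((Finsupp.mem_supported _ _).1 hl).trans hcont)) hzero
  rw [← hbw, hl0, map_zero, add_zero]
  exact hb

/-! ### The iterations of the loop -/

/-- The columns of `H` are the restrictions of representatives of positive degree of bars with the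
property `E`, and all those of bars that have not died are present. -/
def HoldsReps (Ω : PersistentCohomologyBasis K) (k : Fin (n + 1)) (E : Fin Ω.size → Prop)
    (H : List (Fin Ω.size × Cochain V)) : Prop :=
  (∀ x ∈ H, 0 < Ω.deg x.1 ∧ E x.1 ∧ x.2 = restrict (K.complex k) (Ω.rep x.1).1) ∧
    ∀ i, 0 < Ω.deg i → E i → (Ω.bar i).death < k →
      (i, restrict (K.complex k) (Ω.rep i).1) ∈ H

/-- The invariant of the loop, after the restriction to the index `k`. -/
structure AfterRestriction (Ω : PersistentCohomologyBasis K) (k : Fin (n + 1))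
    (s : State V n Ω.size) (Z : List (Fin (n + 1) × Cochain V)) (U : List (Column V n))
    (A : List (ℕ × Column V n)) (O : List (ℕ × BarRep V n)) : Prop where
  represents : Represents K k Z U A O
  S_eq : s.S = U ++ A.map Prod.snd
  out_eq : s.out = O.map Prod.snd
  holdsReps : HoldsReps Ω k (fun i => k < (Ω.bar i).birth ∨ (Ω.bar i).birth = Fin.last n) s.H
  cupCochains_le : ∀ j, k < j → cupCochains (K.complex j) ≤ genSpan K j (prior Z Z.length)

/-- The invariant of the loop, after the treatment of the bars that are born at `k`. -/
structure AfterBirths (Ω : PersistentCohomologyBasis K) (k : Fin (n + 1))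
    (s : State V n Ω.size) (Z : List (Fin (n + 1) × Cochain V)) (U : List (Column V n))
    (A : List (ℕ × Column V n)) (O : List (ℕ × BarRep V n)) : Prop where
  represents : Represents K k Z U A O
  S_eq : s.S = U ++ A.map Prod.snd
  out_eq : s.out = O.map Prod.snd
  holdsReps : HoldsReps Ω k (fun i => k ≤ (Ω.bar i).birth) s.H
  cupCochains_le : ∀ j, k ≤ j → cupCochains (K.complex j) ≤ genSpan K j (prior Z Z.length)

theorem restrict_rep_of_birth_eq (Ω : PersistentCohomologyBasis K) {k : Fin (n + 1)}
    {i : Fin Ω.size} (h : (Ω.bar i).birth = k) :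
    restrict (K.complex k) (Ω.rep i).1 = (Ω.rep i).1 := by
  subst h
  exact restrict_eq_self (Ω.rep i).2.1

/-- The births at `k`, treated one after another.  Once they have been treated, all products of two
columns of `H` are in the span of the inserted product cocycles: if `k ≠ n`, the new representatives
join `H` one by one and are multiplied by what is there; if `k = n`, they are in `H` from the
start. -/
theorem exists_foldl_birthStep (Ω : PersistentCohomologyBasis K) {k : Fin (n + 1)}
    (L : List (Fin Ω.size)) (hL : ∀ i ∈ L, (Ω.bar i).birth = k ∧ 0 < Ω.deg i)
    {s : State V n Ω.size} {Z : List (Fin (n + 1) × Cochain V)} {U : List (Column V n)}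
    {A : List (ℕ × Column V n)} {O : List (ℕ × BarRep V n)} (h : Represents K k Z U A O)
    (hS : s.S = U ++ A.map Prod.snd)
    (hH : ∀ x ∈ s.H, 0 < Ω.deg x.1 ∧ k ≤ (Ω.bar x.1).birth ∧
      x.2 = restrict (K.complex k) (Ω.rep x.1).1) :
    ∃ Z' A', Z <+: Z' ∧ Represents K k Z' U A' O ∧
      (L.foldl (birthStep Ω k) s).S = U ++ A'.map Prod.snd ∧
      (L.foldl (birthStep Ω k) s).out = s.out ∧
      (k = Fin.last n → (L.foldl (birthStep Ω k) s).H = s.H) ∧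
      (k ≠ Fin.last n → (L.foldl (birthStep Ω k) s).H =
        s.H ++ L.map fun i => (i, (Ω.rep i).1)) ∧
      (∀ i ∈ L, ∀ x ∈ s.H, cup (K.complex k) (Ω.rep i).1 x.2 ∈ genSpan K k (prior Z' Z'.length)) ∧
      (k ≠ Fin.last n →
        (∀ x ∈ s.H, ∀ y ∈ s.H, cup (K.complex k) x.2 y.2 ∈ genSpan K k (prior Z Z.length)) →
        ∀ x ∈ (L.foldl (birthStep Ω k) s).H, ∀ y ∈ (L.foldl (birthStep Ω k) s).H,
          cup (K.complex k) x.2 y.2 ∈ genSpan K k (prior Z' Z'.length)) := by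
  induction L generalizing s Z A with
  | nil =>
    exact ⟨Z, A, List.prefix_rfl, h, hS, rfl, fun _ => rfl, fun _ => (List.append_nil _).symm,
      fun i hi => absurd hi List.not_mem_nil, fun _ hgood => hgood⟩
  | cons i L ih =>
    obtain ⟨hi, hideg⟩ := hL i List.mem_cons_self
    have hirep : (Ω.rep i).1 = restrict (K.complex k) (Ω.rep i).1 :=
      (restrict_rep_of_birth_eq Ω hi).symm
    have hicoc : (Ω.rep i).1 ∈ cocycles (K.complex k) := by
      rw [hirep]
      exact restrict_mem_cocycles (K.mono hi.ge) (Ω.rep i).2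
    set t := birthStep Ω k s i with ht
    have htH : ∀ x ∈ t.H, x ∈ s.H ∨ (k ≠ Fin.last n ∧ x = (i, (Ω.rep i).1)) := by
      intro x hx
      simp only [ht, birthStep] at hx
      split_ifs at hx with hk
      · rcases List.mem_append.1 hx with hx | hx
        · exact Or.inl hx
        · exact Or.inr ⟨hk, List.mem_singleton.1 hx⟩
      · exact Or.inl hx
    have htlast : k = Fin.last n → t.H = s.H := by
      intro hk
      simp only [ht, birthStep]
      rw [if_neg (not_not.2 hk)]
    have htne : k ≠ Fin.last n → t.H = s.H ++ [(i, (Ω.rep i).1)] := by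
      intro hk
      simp only [ht, birthStep]
      rw [if_pos hk]
    have hsub : ∀ x ∈ s.H, x ∈ t.H := by
      intro x hx
      by_cases hk : k = Fin.last n
      · rwa [htlast hk]
      · rw [htne hk]
        exact List.mem_append_left _ hx
    have htspec : ∀ x ∈ t.H, 0 < Ω.deg x.1 ∧ k ≤ (Ω.bar x.1).birth ∧
        x.2 = restrict (K.complex k) (Ω.rep x.1).1 := by
      intro x hx
      rcases htH x hx with hx | ⟨-, rfl⟩
      · exact hH x hx
      · exact ⟨hideg, hi.ge, hirep⟩
    have htcoc : ∀ x ∈ t.H, x.2 ∈ cocycles (K.complex k) ∧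
        x.2 ∈ homogeneous V (Ω.deg x.1) := by
      intro x hx
      obtain ⟨-, h2, h3⟩ := htspec x hx
      rw [h3]
      exact ⟨restrict_mem_cocycles (K.mono h2) (Ω.rep x.1).2,
        restrict_mem_homogeneous _ (Ω.rep_deg x.1)⟩
    obtain ⟨Z₁, A₁, hZ₁, h₁, hS₁, hprod⟩ := h.exists_foldl_insertProduct t.H
      (fun x => cup (K.complex k) (Ω.rep i).1 x.2) (fun x hx => by
        obtain ⟨p, hp⟩ := Nat.exists_eq_succ_of_ne_zero hideg.ne'
        obtain ⟨q, hq⟩ := Nat.exists_eq_succ_of_ne_zero (htspec x hx).1.ne'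
        have h1 := Ω.rep_deg i
        have h2 := (htcoc x hx).2
        rw [hp] at h1
        rw [hq] at h2
        refine ⟨cup_mem_cupCochains hicoc h1 (htcoc x hx).1 h2, p + (q + 1), ?_⟩
        have h3 := cup_mem_homogeneous (K.complex k) h1 h2
        rwa [show p.succ + q.succ = p + (q + 1) + 1 by omega] at h3)
    have htS : t.S = U ++ A₁.map Prod.snd := by
      rw [← hS₁, ← hS]
      rfl
    obtain ⟨Z₂, A₂, hZ₂, h₂, hS₂, hout₂, hlast₂, hne₂, hprod₂, hgood₂⟩ :=
      ih (fun l hl => hL l (List.mem_cons_of_mem _ hl)) h₁ htS htspec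
    refine ⟨Z₂, A₂, hZ₁.trans hZ₂, h₂, hS₂, hout₂, fun hk => (hlast₂ hk).trans (htlast hk),
      fun hk => ?_, ?_, fun hk hgood => hgood₂ hk ?_⟩
    · refine (hne₂ hk).trans ?_
      rw [htne hk, List.append_assoc]
      rfl
    · intro l hl x hx
      rcases List.mem_cons.1 hl with rfl | hl
      · exact genSpan_mono k (prior_length_subset hZ₂) (hprod x (hsub x hx))
      · exact hprod₂ l hl x (hsub x hx)
    · intro x hx y hy
      rcases htH x hx with hx' | ⟨-, rfl⟩
      · rcases htH y hy with hy' | ⟨-, rfl⟩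
        · exact genSpan_mono k (prior_length_subset hZ₁) (hgood x hx' y hy')
        · -- Only the product in the other order has been inserted, but the two are cohomologous.
          have h1 := coboundaries_le_genSpan k (prior Z₁ Z₁.length)
            (cup_add_cup_mem_coboundaries (htcoc x hx).1 hicoc)
          have h2 := sub_mem h1 (hprod x hx)
          rwa [add_sub_cancel_right] at h2
      · exact hprod y hy

/-- The births at `k` make the inserted product cocycles span the cup space at `k`. -/
theorem AfterRestriction.births {Ω : PersistentCohomologyBasis K} {k : Fin (n + 1)}
    {s : State V n Ω.size} {Z : List (Fin (n + 1) × Cochain V)} {U : List (Column V n)}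
    {A : List (ℕ × Column V n)} {O : List (ℕ × BarRep V n)}
    (h : AfterRestriction Ω k s Z U A O) :
    ∃ Z' A', AfterBirths Ω k (births Ω k s) Z' U A' O := by
  classical
  set L := (List.finRange Ω.size).filter (fun i => (Ω.bar i).birth = k ∧ 0 < Ω.deg i) with hLdef
  have hL : ∀ i, i ∈ L ↔ (Ω.bar i).birth = k ∧ 0 < Ω.deg i := by
    intro i
    rw [hLdef, List.mem_filter, decide_eq_true_iff]
    exact and_iff_right (List.mem_finRange i)
  have hbirths : CupPers.births Ω k s = L.foldl (birthStep Ω k) s := by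
    rw [hLdef]
    unfold CupPers.births
    congr
  have hH : ∀ x ∈ s.H, 0 < Ω.deg x.1 ∧ k ≤ (Ω.bar x.1).birth ∧
      x.2 = restrict (K.complex k) (Ω.rep x.1).1 := by
    intro x hx
    obtain ⟨h1, h2, h3⟩ := h.holdsReps.1 x hx
    refine ⟨h1, ?_, h3⟩
    rcases h2 with h2 | h2
    · exact h2.le
    · rw [h2]
      exact Fin.le_last k
  obtain ⟨Z', A', hZ, h', hS, hout, hlast, hne, hprod, hgood⟩ :=
    exists_foldl_birthStep Ω L (fun i hi => (hL i).1 hi) h.represents h.S_eq hH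
  rw [← hbirths] at hS hout hlast hne hgood
  have hholds : HoldsReps Ω k (fun i => k ≤ (Ω.bar i).birth) (CupPers.births Ω k s).H := by
    by_cases hk : k = Fin.last n
    · rw [hlast hk]
      refine ⟨hH, fun i hi hki hd => h.holdsReps.2 i hi (Or.inr ?_) hd⟩
      exact le_antisymm (Fin.le_last _) (hk ▸ hki)
    · rw [hne hk]
      constructor
      · intro x hx
        rcases List.mem_append.1 hx with hx | hx
        · exact hH x hx
        · obtain ⟨i, hi, rfl⟩ := List.mem_map.1 hx
          obtain ⟨hi1, hi2⟩ := (hL i).1 hi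
          exact ⟨hi2, hi1.ge, (restrict_rep_of_birth_eq Ω hi1).symm⟩
      · intro i hi hki hd
        rcases hki.lt_or_eq with hlt | heq
        · exact List.mem_append_left _ (h.holdsReps.2 i hi (Or.inl hlt) hd)
        · rw [restrict_rep_of_birth_eq Ω heq.symm]
          exact List.mem_append_right _ (List.mem_map.2 ⟨i, (hL i).2 ⟨heq.symm, hi⟩, rfl⟩)
  have hproducts : ∀ x ∈ (CupPers.births Ω k s).H, ∀ y ∈ (CupPers.births Ω k s).H,
      cup (K.complex k) x.2 y.2 ∈ genSpan K k (prior Z' Z'.length) := by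
    by_cases hk : k = Fin.last n
    · rw [hlast hk]
      intro x hx y hy
      obtain ⟨h1, h2, h3⟩ := hH x hx
      have hb : (Ω.bar x.1).birth = k := le_antisymm (hk ▸ Fin.le_last _) h2
      rw [h3, restrict_rep_of_birth_eq Ω hb]
      exact hprod x.1 ((hL x.1).2 ⟨hb, h1⟩) y hy
    · refine hgood hk fun x hx y hy => ?_
      -- Products of earlier representatives are restrictions of elements of the cup space at the
      -- next index.
      obtain ⟨hx1, hx2, hx3⟩ := h.holdsReps.1 x hx
      obtain ⟨hy1, hy2, hy3⟩ := h.holdsReps.1 y hy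
      have hklast : k < Fin.last n := lt_of_le_of_ne (Fin.le_last k) hk
      have hxk : k < (Ω.bar x.1).birth := hx2.elim id fun h => h ▸ hklast
      have hyk : k < (Ω.bar y.1).birth := hy2.elim id fun h => h ▸ hklast
      let j := min (Ω.bar x.1).birth (Ω.bar y.1).birth
      have hkj : k < j := lt_min hxk hyk
      obtain ⟨p, hp⟩ := Nat.exists_eq_succ_of_ne_zero hx1.ne'
      obtain ⟨q, hq⟩ := Nat.exists_eq_succ_of_ne_zero hy1.ne'
      have hcup : cup (K.complex j) (restrict (K.complex j) (Ω.rep x.1).1)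
          (restrict (K.complex j) (Ω.rep y.1).1) ∈ cupCochains (K.complex j) :=
        cup_mem_cupCochains
          (restrict_mem_cocycles (K.mono (min_le_left _ _)) (Ω.rep x.1).2)
          (restrict_mem_homogeneous _ (p := p + 1) (by have := Ω.rep_deg x.1; rwa [hp] at this))
          (restrict_mem_cocycles (K.mono (min_le_right _ _)) (Ω.rep y.1).2)
          (restrict_mem_homogeneous _ (p := q + 1) (by have := Ω.rep_deg y.1; rwa [hq] at this))
      have h1 := restrict_mem_genSpan hkj.le (h.cupCochains_le j hkj hcup)
      rwa [← cup_restrict (K.mono hkj.le), restrict_restrict (K.mono hkj.le),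
        restrict_restrict (K.mono hkj.le), ← hx3, ← hy3] at h1
  refine ⟨Z', A', h', hS, hout.trans h.out_eq, hholds, fun j hj => ?_⟩
  rcases hj.lt_or_eq with hj | rfl
  · exact (h.cupCochains_le j hj).trans (genSpan_mono j (prior_length_subset hZ))
  · refine cupCochains_le_of_reps Ω (coboundaries_le_genSpan _ _) fun i i' hi hi' hk hk' => ?_
    exact hproducts (i, restrict (K.complex k) (Ω.rep i).1) (hholds.2 i hi hk.2 hk.1)
      (i', restrict (K.complex k) (Ω.rep i').1) (hholds.2 i' hi' hk'.2 hk'.1)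

/-- After the step for the deaths at `k` no remaining product cocycle depends on the earlier ones
at `k`, whether or not the matrix has been reduced. -/
theorem AfterBirths.deaths {Ω : PersistentCohomologyBasis K} {k : Fin (n + 1)}
    {s s' : State V n Ω.size} {Z : List (Fin (n + 1) × Cochain V)} {U : List (Column V n)}
    {A : List (ℕ × Column V n)} {O : List (ℕ × BarRep V n)}
    (h : AfterBirths Ω k s Z U A O) (hd : Deaths Ω k s s') :
    ∃ U' A' O', AfterBirths Ω k s' Z U' A' O' ∧ Settled K k Z A' := by
  rcases hd with ⟨i, hi, -, S', hS', hred, hS, hout, hH⟩ | ⟨hno, rfl⟩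
  · have htri := unitriangular_of_reflTransGen hS'
    rw [h.S_eq] at htri
    obtain ⟨U', A', rfl, h'⟩ := h.represents.exists_of_unitriangular htri
    obtain ⟨h1, h2⟩ := h'.removeGenerated hred
    refine ⟨_, _, _, ⟨h1, hS.trans h'.filter_columns, ?_, ⟨?_, ?_⟩, h.cupCochains_le⟩, h2⟩
    · rw [hout, h.out_eq, h'.filterMap_columns, List.map_append]
    · intro x hx
      rw [hH] at hx
      exact h.holdsReps.1 x (List.mem_filter.1 hx).1
    · intro l hl hkl hdl
      rw [hH]
      refine List.mem_filter.2 ⟨h.holdsReps.2 l hl hkl hdl, decide_eq_true ?_⟩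
      rintro rfl
      exact absurd hdl (not_lt.2 hi.ge)
  · -- No bar of positive degree dies at `k`, so the matrix need not be reduced.
    refine ⟨U, A, O, h, ?_⟩
    by_cases hk : k = Fin.last n
    · intro i hi e he
      have hke := h.represents.le_birth e (List.mem_of_getElem? he)
      exact h.represents.alive i hi e he k hke (Or.inr (le_antisymm hke (hk ▸ Fin.le_last _)))
    · have hlt : k.1 + 1 < n + 1 := by
        have := lt_of_le_of_ne (Fin.le_last k) hk
        have := Fin.lt_def.1 this
        rw [Fin.val_last] at this
        omega
      have hkj : k < (⟨k.1 + 1, hlt⟩ : Fin (n + 1)) := Fin.lt_def.2 (Nat.lt_succ_self _)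
      exact h.represents.settled_of_injective hkj (fun i hi => Nat.succ_le_of_lt hi)
        fun v hv hv0 hvk => mem_coboundaries_of_restrict Ω hkj (fun i hi => Nat.lt_succ_iff.1 hi)
          hno hv hv0 hvk

theorem AfterBirths.restrictState {Ω : PersistentCohomologyBasis K} {k j : Fin (n + 1)}
    {s : State V n Ω.size} {Z : List (Fin (n + 1) × Cochain V)} {U : List (Column V n)}
    {A : List (ℕ × Column V n)} {O : List (ℕ × BarRep V n)}
    (h : AfterBirths Ω j s Z U A O) (hset : Settled K j Z A) (hkj : k < j)
    (hsucc : ∀ i, k < i → j ≤ i) :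
    ∃ U' A', AfterRestriction Ω k (restrictState K k s) Z U' A' O := by
  refine ⟨_, _, h.represents.restrict_level hset hkj hsucc, ?_, h.out_eq, ⟨?_, ?_⟩,
    fun i hi => h.cupCochains_le i (hsucc i hi)⟩
  · simp only [CupPers.restrictState]
    rw [h.S_eq, List.map_append, List.map_map, List.map_map]
    rfl
  · intro x hx
    obtain ⟨y, hy, rfl⟩ := List.mem_map.1 hx
    obtain ⟨h1, h2, h3⟩ := h.holdsReps.1 y hy
    refine ⟨h1, Or.inl (hkj.trans_le h2), ?_⟩
    rw [h3]
    exact restrict_restrict (K.mono hkj.le) _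
  · intro i hi hE hd
    have hji : j ≤ (Ω.bar i).birth := by
      rcases hE with hE | hE
      · exact hsucc _ hE
      · rw [hE]
        exact Fin.le_last j
    refine List.mem_map.2 ⟨_, h.holdsReps.2 i hi hji (hd.trans hkj), ?_⟩
    exact Prod.ext rfl (restrict_restrict (K.mono hkj.le) _)

theorem cochains_le_span_single (j : Fin (n + 1)) :
    cochains (K.complex j) ≤ Submodule.span (ZMod 2)
      (Set.range fun i : Fin n => (Pi.single (K.simplex i) 1 : Cochain V)) := by
  intro x hx
  have hsum : x = ∑ τ ∈ Finset.univ.image K.simplex, x τ • (Pi.single τ 1 : Cochain V) := by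
    funext τ
    rw [Finset.sum_apply]
    simp only [Pi.smul_apply, Pi.single_apply, smul_eq_mul, mul_ite, mul_one, mul_zero]
    rw [Finset.sum_ite_eq]
    split_ifs with h
    · rfl
    · refine hx τ fun hτ => h ?_
      obtain ⟨i, -, rfl⟩ := (mem_faces_iff K j τ).1 hτ
      exact Finset.mem_image_of_mem _ (Finset.mem_univ i)
  rw [hsum]
  refine Submodule.sum_mem _ fun τ hτ => Submodule.smul_mem _ _ (Submodule.subset_span ?_)
  obtain ⟨i, -, rfl⟩ := Finset.mem_image.1 hτ
  exact ⟨i, rfl⟩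

theorem afterRestriction_init (Ω : PersistentCohomologyBasis K) :
    ∃ U, AfterRestriction Ω (Fin.last n) (restrictState K (Fin.last n) (init Ω)) [] U [] [] := by
  classical
  refine ⟨(restrictState K (Fin.last n) (init Ω)).S, ⟨?_, ?_, List.Pairwise.nil, ?_, ?_, ?_,
    List.Perm.refl _, List.Pairwise.nil, ?_, ?_, ?_⟩, (List.append_nil _).symm, rfl, ⟨?_, ?_⟩,
    fun j hj => absurd hj (not_lt.2 (Fin.le_last j))⟩
  any_goals
    intro a ha
    exact absurd ha List.not_mem_nil
  · intro c hc
    simp only [restrictState, init, List.mem_map, List.mem_ofFn'] at hc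
    obtain ⟨_, ⟨i, rfl⟩, rfl⟩ := hc
    rfl
  · apply le_antisymm
    · refine Submodule.span_le.2 ?_
      rintro _ ⟨c, hc, rfl⟩
      simp only [restrictState, init, List.mem_map, List.mem_ofFn'] at hc
      obtain ⟨_, ⟨i, rfl⟩, rfl⟩ := hc
      refine restrict_mem_coboundaries le_rfl ⟨Pi.single (K.simplex i) 1, fun τ hτ => ?_, rfl⟩
      refine Pi.single_eq_of_ne ?_ _
      rintro rfl
      exact hτ ((mem_faces_iff K _ _).2 ⟨i, Fin.castSucc_lt_last i, rfl⟩)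
    · rintro _ ⟨z, hz, rfl⟩
      have h := Submodule.mem_map_of_mem (f := coboundary (K.complex (Fin.last n)))
        (cochains_le_span_single (Fin.last n) hz)
      rw [Submodule.map_span] at h
      refine SetLike.le_def.1 (Submodule.span_mono ?_) h
      rintro _ ⟨_, ⟨i, rfl⟩, rfl⟩
      refine ⟨⟨restrict (K.complex (Fin.last n)) (coboundary (K.complex (Fin.last n))
        (Pi.single (K.simplex i) 1)), none⟩, ?_, restrict_eq_self (restrict_mem_cochains _ _)⟩
      exact List.mem_map.2 ⟨_, (List.mem_ofFn' _ _).2 ⟨i, rfl⟩, rfl⟩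
  · intro x hx
    obtain ⟨y, hy, rfl⟩ := List.mem_map.1 hx
    obtain ⟨i, hi, rfl⟩ := List.mem_map.1 hy
    have hi := of_decide_eq_true (List.mem_filter.1 hi).2
    exact ⟨hi.2, Or.inr hi.1, rfl⟩
  · intro i hi hE hd
    have hb : (Ω.bar i).birth = Fin.last n :=
      hE.elim (fun h => absurd h (not_lt.2 (Fin.le_last _))) id
    refine List.mem_map.2 ⟨(i, (Ω.rep i).1), List.mem_map.2 ⟨i, ?_, rfl⟩, rfl⟩
    exact List.mem_filter.2 ⟨List.mem_finRange i, decide_eq_true ⟨hb, hi⟩⟩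

/-- The invariant passes through the loop. -/
theorem Loop.afterRestriction {Ω : PersistentCohomologyBasis K} : ∀ (k : ℕ) (hk : k < n + 1)
    {s s' : State V n Ω.size}, Loop Ω k hk s s' →
    (∃ Z U A O, AfterRestriction Ω ⟨k, hk⟩ (restrictState K ⟨k, hk⟩ s) Z U A O) →
    ∃ Z U A O, AfterRestriction Ω 0 (restrictState K 0 s') Z U A O
  | 0, _, _, _, h, hs => by
    rw [show _ = _ from h]
    exact hs
  | k + 1, hk, s, s', ⟨t, hit, hloop⟩, ⟨Z, U, A, O, hs⟩ => by
    obtain ⟨Z', A', hbirths⟩ := hs.births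
    obtain ⟨U₁, A₁, O₁, hdeaths, hset⟩ := hbirths.deaths hit
    have hkj : (⟨k, Nat.lt_of_succ_lt hk⟩ : Fin (n + 1)) < ⟨k + 1, hk⟩ :=
      Fin.lt_def.2 (Nat.lt_succ_self k)
    obtain ⟨U₂, A₂, h⟩ := hdeaths.restrictState hset hkj fun i hi => Nat.succ_le_of_lt hi
    exact Loop.afterRestriction k (Nat.lt_of_succ_lt hk) hloop ⟨_, _, _, _, h⟩

theorem foldl_insertProduct_mem_cochains {L : PreAbstractSimplicialComplex V} {α : Type*}
    (k : Fin (n + 1)) (f : α → Cochain V) (hf : ∀ y, f y ∈ cochains L) (Y : List α)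
    {S : List (Column V n)} (hS : ∀ c ∈ S, c.vec ∈ cochains L) :
    ∀ c ∈ Y.foldl (fun S y => insertProduct k S (f y)) S, c.vec ∈ cochains L := by
  induction Y generalizing S with
  | nil => exact hS
  | cons y Y ih =>
    refine ih fun c hc => ?_
    simp only [insertProduct] at hc
    split_ifs at hc
    · rcases List.mem_append.1 hc with hc | hc
      · exact hS c hc
      · rw [List.mem_singleton.1 hc]
        exact hf y
    · exact hS c hc

theorem births_mem_cochains (Ω : PersistentCohomologyBasis K) (k : Fin (n + 1))
    {s : State V n Ω.size} (hS : ∀ c ∈ s.S, c.vec ∈ cochains (K.complex k)) :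
    ∀ c ∈ (births Ω k s).S, c.vec ∈ cochains (K.complex k) := by
  have key : ∀ (L : List (Fin Ω.size)) (s : State V n Ω.size),
      (∀ c ∈ s.S, c.vec ∈ cochains (K.complex k)) →
      ∀ c ∈ (L.foldl (birthStep Ω k) s).S, c.vec ∈ cochains (K.complex k) := by
    intro L
    induction L with
    | nil => exact fun s hs => hs
    | cons i L ih =>
      intro s hs
      exact ih _ (foldl_insertProduct_mem_cochains k
        (fun x : Fin Ω.size × Cochain V => cup (K.complex k) (Ω.rep i).1 x.2)
        (fun x => cup_mem_cochains _ _ _) _ hs)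
  exact key _ s hS

theorem exists_iteration (Ω : PersistentCohomologyBasis K) (k : Fin (n + 1))
    (s : State V n Ω.size) : ∃ s', Iteration Ω k s s' := by
  by_cases h : ∃ i : Fin Ω.size, (Ω.bar i).death = k ∧ 0 < Ω.deg i
  · obtain ⟨i, hi, hdeg⟩ := h
    obtain ⟨S', h1, h2⟩ := exists_isReduced K k (births Ω k (restrictState K k s)).S
      (births_mem_cochains Ω k fun c hc => by
        obtain ⟨d, -, rfl⟩ := List.mem_map.1 hc
        exact restrict_mem_cochains _ _)
    exact ⟨⟨_, _, _⟩, Or.inl ⟨i, hi, hdeg, S', h1, h2, rfl, rfl, rfl⟩⟩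
  · exact ⟨_, Or.inr ⟨h, rfl⟩⟩

theorem exists_loop (Ω : PersistentCohomologyBasis K) : ∀ (k : ℕ) (hk : k < n + 1)
    (s : State V n Ω.size), ∃ s', Loop Ω k hk s s'
  | 0, _, s => ⟨s, rfl⟩
  | k + 1, hk, s => by
    obtain ⟨t, ht⟩ := exists_iteration Ω ⟨k + 1, hk⟩ s
    obtain ⟨s', hs'⟩ := exists_loop Ω k (Nat.lt_of_succ_lt hk) t
    exact ⟨s', t, ht, hs'⟩

/-! ### The barcode of the persistent cup module -/

/-- In `K_0` and `K_1` there are no simplices of positive dimension. -/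
theorem restrict_eq_zero_of_le_one {j : Fin (n + 1)} (hj : j.1 ≤ 1) {p : ℕ} {x : Cochain V}
    (hx : x ∈ homogeneous V (p + 1)) : restrict (K.complex j) x = 0 := by
  funext τ
  by_cases hτ : τ ∈ (K.complex j).faces
  swap
  · exact restrict_of_notMem _ hτ
  refine restrict_mem_homogeneous _ hx τ fun hcard => ?_
  -- Otherwise `τ` would have two different vertices, whose simplices would be added before `1`.
  obtain ⟨a, ha, b, hb, hab⟩ := Finset.one_lt_card.1 (by omega : 1 < τ.card)
  have hmem : ∀ c ∈ τ, ∃ i : Fin n, i.castSucc < j ∧ K.simplex i = {c} := fun c hc =>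
    (mem_faces_iff K j {c}).1
      (mem_of_subset hτ (Finset.singleton_subset_iff.2 hc) (Finset.singleton_nonempty c))
  obtain ⟨i, hi, hia⟩ := hmem a ha
  obtain ⟨l, hl, hlb⟩ := hmem b hb
  have hil : i = l := by
    have h1 := Fin.lt_def.1 hi
    have h2 := Fin.lt_def.1 hl
    rw [Fin.val_castSucc] at h1 h2
    exact Fin.ext (by omega)
  rw [← hil, hia] at hlb
  exact hab (Finset.singleton_injective hlb)

/-- At the end no product cocycles are left: they vanish at the index `1`. -/
theorem AfterRestriction.eq_nil {Ω : PersistentCohomologyBasis K} {s : State V n Ω.size}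
    {Z : List (Fin (n + 1) × Cochain V)} {U : List (Column V n)} {A : List (ℕ × Column V n)}
    {O : List (ℕ × BarRep V n)} (h : AfterRestriction Ω 0 s Z U A O) : A = [] := by
  rw [List.eq_nil_iff_forall_not_mem]
  intro a ha
  obtain ⟨e, he, -⟩ := h.represents.column a ha
  obtain ⟨p, hp⟩ := h.represents.mem_homogeneous e (List.mem_of_getElem? he)
  have hj : ∃ j ≤ e.1, ((0 : Fin (n + 1)) < j ∨ j = e.1) ∧ j.1 ≤ 1 := by
    by_cases h0 : e.1.1 ≤ 1
    · exact ⟨e.1, le_rfl, Or.inr rfl, h0⟩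
    · have := e.1.2
      exact ⟨⟨1, by omega⟩, Fin.le_def.2 (by change 1 ≤ e.1.1; omega),
        Or.inl (Fin.lt_def.2 (by simp)), le_rfl⟩
  obtain ⟨j, hje, hj, hj1⟩ := hj
  refine h.represents.alive a.1 (List.mem_map_of_mem ha) e he j hje hj ?_
  rw [restrict_eq_zero_of_le_one hj1 hp]
  exact zero_mem _

/-- The elder rule, applied to the list `Z` of the product cocycles inserted by the algorithm.  The
`i`-th bar is that of the entry of `Z` at the position `σ i`. -/
theorem Represents.exists_isCochainBasis {Z : List (Fin (n + 1) × Cochain V)}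
    {U : List (Column V n)} {A : List (ℕ × Column V n)} {O : List (ℕ × BarRep V n)}
    (hR : Represents K 0 Z U A O)
    (hcup : ∀ j, 0 < j → cupCochains (K.complex j) ≤ genSpan K j (prior Z Z.length))
    {ι : Type} [Finite ι] {σ : ι → ℕ} (hσ : Function.Injective σ)
    (hσZ : ∀ m < Z.length, ∃ i, σ i = m) {bars : ι → Bar n} {z : ι → Cochain V}
    (hget : ∀ i, Z[σ i]? = some ((bars i).birth, z i))
    (hlt : ∀ i, (bars i).death < (bars i).birth)
    (hdead : ∀ i, restrict (K.complex (bars i).death) (z i) ∈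
      genSpan K (bars i).death (prior Z (σ i)))
    (halive : ∀ i j, (bars i).Contains j →
      restrict (K.complex j) (z i) ∉ genSpan K j (prior Z (σ i))) :
    ∃ (deg : ι → ℕ) (x : ι → Cochain V),
      IsCochainBasis K (fun j => cupCochains (K.complex j)) bars deg x ∧
      ∀ i, z i ∈ homogeneous V (deg i) ∧ z i ≠ 0 := by
  have hset : ∀ m, {e | ∃ l, σ l < m ∧ ((bars l).birth, z l) = e} = prior Z m := by
    intro m
    ext e
    constructor
    · rintro ⟨l, hl, rfl⟩
      exact ⟨_, hl, hget l⟩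
    · rintro ⟨l, hl, he⟩
      obtain ⟨i, rfl⟩ := hσZ l (List.getElem?_eq_some_iff.1 he).1
      exact ⟨i, hl, Option.some.inj ((hget i).symm.trans he)⟩
  have hmemZ : ∀ i, ((bars i).birth, z i) ∈ Z := fun i => List.mem_of_getElem? (hget i)
  obtain ⟨p, hp⟩ : ∃ p : ι → ℕ, ∀ i, z i ∈ homogeneous V (p i + 1) :=
    Classical.axiomOfChoice fun i => hR.mem_homogeneous _ (hmemZ i)
  have hmem : ∀ i, z i ∈ cupCochains (K.complex (bars i).birth) := by
    intro i
    have h := hR.mem _ (hmemZ i)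
    exact h
  have hanti : ∀ i l, σ l < σ i → (bars i).birth ≤ (bars l).birth :=
    fun i l hil => hR.le_birth_of_prior (hget i) ⟨_, hil, hget l⟩
  have hspan : ∀ j, cupCochains (K.complex j) ≤
      genSpan K j {e | ∃ l, ((bars l).birth, z l) = e} := by
    intro j
    rcases (Fin.zero_le j).lt_or_eq with hj | rfl
    · refine (hcup j hj).trans (genSpan_mono j ?_)
      rw [← hset]
      rintro e ⟨l, -, he⟩
      exact ⟨l, he⟩
    · refine (cupCochains_le_cocycles _).trans fun y hy => ?_
      have h0 : y ∈ cochains (K.complex 0) := hy.1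
      rw [cochains_zero_eq_bot, Submodule.mem_bot] at h0
      rw [h0]
      exact zero_mem _
  have hdead' := hdead
  have halive' := halive
  simp only [← hset] at hdead' halive'
  obtain ⟨x, hx⟩ := CupPersistence.exists_isCochainBasis
    (P := fun j => cupCochains (K.complex j)) (deg := fun i => p i + 1)
    (fun hkj y hy => restrict_mem_cupCochains (K.mono hkj) hy) hσ hmem hp hanti
    (fun i => (hlt i).le) hdead' halive' hspan
  refine ⟨_, x, hx, fun i => ⟨hp i, fun h0 => ?_⟩⟩
  -- A product cocycle is independent of the earlier ones at its birth, hence nonzero.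
  refine halive i (bars i).birth ⟨hlt i, le_rfl⟩ ?_
  rw [h0, map_zero]
  exact zero_mem _

/-- At the end every inserted product cocycle has been turned into an output bar, so the output
enumerates the list `Z`. -/
theorem AfterRestriction.exists_isCochainBasis_barsOf {Ω : PersistentCohomologyBasis K}
    {s : State V n Ω.size} {Z : List (Fin (n + 1) × Cochain V)} {U : List (Column V n)}
    {A : List (ℕ × Column V n)} {O : List (ℕ × BarRep V n)}
    (h : AfterRestriction Ω 0 s Z U A O) :
    ∃ (deg : Fin s.out.length → ℕ) (x : Fin s.out.length → Cochain V),
      IsCochainBasis K (fun j => cupCochains (K.complex j)) (barsOf s.out) deg x ∧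
      ∀ i, (barsOf s.out i).death < (barsOf s.out i).birth ∧
        (s.out.get i).rep ∈ homogeneous V (deg i) ∧ (s.out.get i).rep ≠ 0 := by
  have hlen : s.out.length = O.length := by rw [h.out_eq, List.length_map]
  have hget : ∀ i, (O.get (Fin.cast hlen i)).2 = s.out.get i := by
    intro i
    simp only [List.get_eq_getElem, h.out_eq, List.getElem_map, Fin.val_cast]
  have hnd : (O.map Prod.fst).Nodup :=
    ((h.represents.perm.nodup_iff.2 List.nodup_range).of_append_right)
  obtain rfl := h.eq_nil
  have hdead := fun i : Fin s.out.length =>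
    h.represents.dead (O.get (Fin.cast hlen i)) (List.get_mem _ _)
  simp only [hget] at hdead
  obtain ⟨deg, x, hx, hrep⟩ := h.represents.exists_isCochainBasis h.cupCochains_le
    (σ := fun i => (O.get (Fin.cast hlen i)).1) (bars := barsOf s.out)
    (z := fun i => (s.out.get i).rep)
    (by
      intro i l hil
      have h1 := (List.Nodup.getElem_inj_iff hnd (i := i.1) (j := l.1)
        (hi := by rw [List.length_map, ← hlen]; exact i.2)
        (hj := by rw [List.length_map, ← hlen]; exact l.2)).1 (by
          rw [List.getElem_map, List.getElem_map]
          exact hil)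
      exact Fin.ext h1)
    (by
      intro m hm
      have hperm : (O.map Prod.fst).Perm (List.range Z.length) := h.represents.perm
      obtain ⟨b, hb, rfl⟩ := List.mem_map.1 (hperm.mem_iff.2 (List.mem_range.2 hm))
      obtain ⟨r, rfl⟩ := List.get_of_mem hb
      exact ⟨Fin.cast hlen.symm r, rfl⟩)
    (fun i => (hdead i).1) (fun i => (hdead i).2.2.1) (fun i => (hdead i).2.2.2.1)
    (fun i => (hdead i).2.2.2.2)
  exact ⟨deg, x, hx, fun i => ⟨(hdead i).2.2.1, hrep i⟩⟩

/-- The entries of a filtered list correspond to the entries of the list that satisfy the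
condition. -/
theorem exists_equiv_filter {α : Type*} (l : List α) (q : α → Prop) [DecidablePred q] :
    ∃ e : Fin (l.filter q).length ≃ {i : Fin l.length // q (l.get i)},
      ∀ i, (l.filter q).get i = l.get (e i).1 := by
  set L := (List.finRange l.length).filter fun i => q (l.get i) with hL
  have hl : l.filter q = L.map l.get := by
    conv_lhs => rw [← List.map_get_finRange l, List.filter_map]
    rfl
  have hlen : (l.filter q).length = L.length := by rw [hl, List.length_map]
  have hnd : L.Nodup := (List.nodup_finRange _).filter _
  have hmem : ∀ i, i ∈ L ↔ q (l.get i) := by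
    intro i
    rw [hL, List.mem_filter, decide_eq_true_iff]
    exact and_iff_right (List.mem_finRange i)
  refine ⟨(finCongr hlen).trans ((List.Nodup.getEquiv L hnd).trans
    (Equiv.subtypeEquivRight hmem)), fun i => ?_⟩
  simp only [List.get_eq_getElem, hl, List.getElem_map]
  rfl

theorem isBarcode_of_outputs {Ω : PersistentCohomologyBasis K} {out : List (BarRep V n)}
    (hout : Outputs Ω out) : IsBarcode (cupModule K) (barsOf out) ∧
      ∀ p : ℕ, IsBarcode (cupModuleDeg K p) (barsOf (degreePart p out)) := by
  classical
  obtain ⟨s, hloop, rfl⟩ := hout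
  obtain ⟨U₀, hinit⟩ := afterRestriction_init Ω
  obtain ⟨Z, U, A, O, h⟩ := Loop.afterRestriction n _ hloop ⟨_, _, _, _, hinit⟩
  obtain ⟨deg, x, hx, hrep⟩ := h.exists_isCochainBasis_barsOf
  change IsCochainBasis K _ (barsOf s.out) _ _ at hx
  have hle : ∀ j, cupCochains (K.complex j) ≤ cocycles (K.complex j) := fun j =>
    cupCochains_le_cocycles _
  refine ⟨hx.isBarcode_sub hle (fun i => (hrep i).1)
      (fun h _ hx => resCohomology_mem_cupSpace (K.mono h) hx) fun j => cupSpace_eq_classesOf _,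
    fun p => ?_⟩
  have hp : IsBarcode (cupModuleDeg K p) (fun i : {i // deg i = p} => barsOf s.out i.1) :=
    (hx.subtype_deg p).isBarcode_sub (W := fun j => cupSpaceDeg (K.complex j) p)
      (fun j => inf_le_left.trans (hle j)) (fun i => (hrep i.1).1)
      (fun h _ hx => ⟨resCohomology_mem_cupSpace (K.mono h) hx.1,
        resCohomology_mem_deg (K.mono h) hx.2⟩) fun j => cupSpaceDeg_eq_classesOf _ p
  obtain ⟨e, he⟩ := exists_equiv_filter s.out fun e => e.rep ∈ homogeneous V p
  have hdeg : ∀ i, (s.out.get i).rep ∈ homogeneous V p ↔ deg i = p := fun i =>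
    ⟨fun hi => homogeneous_unique (hrep i).2.1 hi (hrep i).2.2, fun hi => hi ▸ (hrep i).2.1⟩
  have hfilter : degreePart p s.out = s.out.filter fun e => e.rep ∈ homogeneous V p := by
    unfold degreePart
    congr
  rw [hfilter]
  exact hp.congr (e.trans (Equiv.subtypeEquivRight hdeg)) fun i => congrArg BarRep.bar (he i)

end CupPers

end CupPersistence

end

theorem mainTheorem1 {V : Type*} [LinearOrder V] {n : ℕ} (K : SimplexwiseFiltration V n) :
    Nonempty (PersistentCohomologyBasis K) ∧
    ∀ Ω : PersistentCohomologyBasis K,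
      (∃ out, CupPers.Outputs Ω out) ∧
      ∀ out, CupPers.Outputs Ω out →
        IsBarcode (cupModule K) (CupPers.barsOf out) ∧
        ∀ p : ℕ, IsBarcode (cupModuleDeg K p) (CupPers.barsOf (CupPers.degreePart p out)) := by
  refine ⟨nonempty_persistentCohomologyBasis K, fun Ω => ⟨?_, fun out hout =>
    CupPers.isBarcode_of_outputs hout⟩⟩
  obtain ⟨s, hs⟩ := CupPers.exists_loop Ω n (Nat.lt_succ_self n) (CupPers.init Ω)
  exact ⟨s.out, s, hs, rfl⟩
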